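/- Let $U$ be the hyperbolic plane or the Euclidean plane (the latter occurs for genus $2$), and let $N_g$ $(g\ge 1)$ be the closed non-orientable surface of genus $g$, i.e. the connected sum of $g$ projective planes, so that $\pi_1(N_g)=\langle d_1,\dots,d_g\mid d_1^2\cdots d_g^2=1\rangle$. Let $\Gamma$ be a discrete subgroup of the isometry group of $U$ of signature $(h,\varepsilon,[(2)^r],\{(-)^k\})$ with $\varepsilon\in\{+,-\}$ and $k\ge 1$. That is, $\Gamma$ is generated by elements $x_1,\dots,x_r$ (elliptic, i.e. nontrivial rotations about points), $e_1,\dots,e_k$ (nontrivial translations, in the hyperbolic case hyperbolic translations), $c_{1},\dots,c_{k}$ (reflections in geodesic lines) and, if $\varepsilon=+$, $a_1,b_1,\dots,a_h,b_h$ (nontrivial translations, as before), respectively, if $\varepsilon=-$, $d_1,\dots,d_h$ (glide reflections), with the defining relations $$x_j^2=1,\qquad c_i^2=1,\qquad c_i=e_i^{-1}c_ie_i,\qquad x_1\cdots x_r\,e_1\cdots e_k\,[a_1,b_1]\cdots[a_h,b_h]=1\ \text{ if }\varepsilon=+,$$ $$\text{respectively}\quad x_1\cdots x_r\,e_1\cdots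 e_k\,d_1^2\cdots d_h^2=1\ \text{ if }\varepsilon=-,$$ where $[a,b]=aba^{-1}b^{-1}$. Fix such generators. Let $\theta\colon\Gamma\to\mathbb Z_2=\{1,X\}$ be an NSK-map of genus $g$, i.e. a surjective homomorphism whose kernel is isomorphic to $\pi_1(N_g)$. Let $\iota$ be the corresponding involution of the surface $U/\ker\theta\approx N_g$, i.e. $\iota([z])=[\gamma z]$ for any $\gamma\in\Gamma$ with $\theta(\gamma)=X$. A reflection curve of $\iota$ is (the image of) a simple closed curve on $U/\ker\theta$ that $\iota$ fixes pointwise; it is two-sided if it is the core of an open annulus in the surface, and one-sided if it is the core of an open Möbius band in the surface. Put $$n=\#\{\,j\in\{1,\dots,k\}\mid\theta(e_j)=X\,\}.$$ Then $\iota$ has exactly $k$ reflection curves; exactly $n$ of them are one-sided, and the other $k-n$ are two-sided (and not one-sided). -/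

import Mathlib

open scoped UpperHalfPlane

/-! ### Isometries of the hyperbolic or Euclidean plane

The definitions below make sense in any metric space `U`; they are used for a metric space `U`
isometric to the hyperbolic plane or to the Euclidean plane.  There the isometric maps `ℝ → U` are
exactly the unit speed parametrizations of the (complete) geodesic lines. -/

namespace PlaneIsometry

variable {U : Type*} [MetricSpace U]

/-- A reflection: an isometry whose fixed point set is a geodesic line. -/
def IsReflection (f : U ≃ᵢ U) : Prop :=
  ∃ ℓ : ℝ → U, Isometry ℓ ∧ {z | f z = z} = Set.range ℓ

/-- In the plane, an isometry preserves the orientation if and only if it is a product of two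
reflections. -/
def IsOrientationPreserving (f : U ≃ᵢ U) : Prop :=
  ∃ s t : U ≃ᵢ U, IsReflection s ∧ IsReflection t ∧ f = s * t

/-- `f` moves the points of some geodesic line along this line by a fixed nonzero amount. -/
def ShiftsLine (f : U ≃ᵢ U) : Prop :=
  ∃ ℓ : ℝ → U, Isometry ℓ ∧ ∃ a : ℝ, a ≠ 0 ∧ ∀ s, f (ℓ s) = ℓ (s + a)

/-- A nontrivial translation (in the hyperbolic plane: a hyperbolic translation). -/
def IsTranslation (f : U ≃ᵢ U) : Prop :=
  IsOrientationPreserving f ∧ ShiftsLine f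

/-- A glide reflection (with nonzero translation part). -/
def IsGlideReflection (f : U ≃ᵢ U) : Prop :=
  ¬ IsOrientationPreserving f ∧ ShiftsLine f

/-- A nontrivial rotation about a point (an elliptic transformation). -/
def IsRotation (f : U ≃ᵢ U) : Prop :=
  IsOrientationPreserving f ∧ ∃ z₀ : U, {z | f z = z} = {z₀}

/-- A discrete subgroup of the isometry group: the identity is isolated in `Γ` for the
compact-open topology (uniform convergence on compact sets). -/
def IsDiscreteSubgroup (Γ : Subgroup (U ≃ᵢ U)) : Prop :=
  ∃ K : Set U, IsCompact K ∧ ∃ ε : ℝ, 0 < ε ∧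
    ∀ f ∈ Γ, (∀ z ∈ K, dist (f z) z < ε) → f = 1

end PlaneIsometry

/-! ### The signature `(h, ε, [(2)^r], {(-)^k})` and its presentation -/

namespace NEC

/-- The sign of a signature. -/
inductive Sign
  | plus
  | minus

/-- The symbols of the canonical generators for the signature `(h, ε, [(2)^r], {(-)^k})`. The
reflection `c_{i,0}` is written `c i`. -/
inductive CanonicalGen (h r k : ℕ) : Sign → Type
  | x {ε : Sign} (j : Fin r) : CanonicalGen h r k ε
  | e {ε : Sign} (i : Fin k) : CanonicalGen h r k ε
  | c {ε : Sign} (i : Fin k) : CanonicalGen h r k ε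
  | a (j : Fin h) : CanonicalGen h r k Sign.plus
  | b (j : Fin h) : CanonicalGen h r k Sign.plus
  | d (j : Fin h) : CanonicalGen h r k Sign.minus

open FreeGroup CanonicalGen

/-- `[a_1, b_1] ⋯ [a_h, b_h]` for the sign `+`, and `d_1² ⋯ d_h²` for the sign `-`. -/
def handleWord (h r k : ℕ) : (ε : Sign) → FreeGroup (CanonicalGen h r k ε)
  | .plus => (List.ofFn fun j : Fin h =>
      of (a j) * of (b j) * (of (a j))⁻¹ * (of (b j))⁻¹).prod
  | .minus => (List.ofFn fun j : Fin h => of (d j) ^ 2).prod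

/-- The long relator `x_1 ⋯ x_r e_1 ⋯ e_k [a_1, b_1] ⋯ [a_h, b_h]`, or
`x_1 ⋯ x_r e_1 ⋯ e_k d_1² ⋯ d_h²`. -/
def longRelator (h r k : ℕ) (ε : Sign) : FreeGroup (CanonicalGen h r k ε) :=
  (List.ofFn fun j : Fin r => of (x j)).prod * (List.ofFn fun i : Fin k => of (e i)).prod *
    handleWord h r k ε

/-- The defining relators `x_j²`, `c_i²`, `c_i⁻¹ e_i⁻¹ c_i e_i` (that is `c_i = e_i⁻¹ c_i e_i`)
and the long relator. -/
def relators (h r k : ℕ) (ε : Sign) : Set (FreeGroup (CanonicalGen h r k ε)) :=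
  (Set.range fun j : Fin r => of (x j) ^ 2) ∪ (Set.range fun i : Fin k => of (c i) ^ 2) ∪
    (Set.range fun i : Fin k => (of (c i))⁻¹ * ((of (e i))⁻¹ * of (c i) * of (e i))) ∪
    {longRelator h r k ε}

/-- The geometric type of each canonical generator: the `x_j` are elliptic, the `c_i` are
reflections, the `e_i`, `a_j`, `b_j` are translations and the `d_j` are glide reflections. -/
def HasType {U : Type*} [MetricSpace U] {h r k : ℕ} :
    {ε : Sign} → CanonicalGen h r k ε → (U ≃ᵢ U) → Prop
  | _, x _, f => PlaneIsometry.IsRotation f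
  | _, e _, f => PlaneIsometry.IsTranslation f
  | _, c _, f => PlaneIsometry.IsReflection f
  | _, a _, f => PlaneIsometry.IsTranslation f
  | _, b _, f => PlaneIsometry.IsTranslation f
  | _, d _, f => PlaneIsometry.IsGlideReflection f

/-- `Γ` has signature `(h, ε, [(2)^r], {(-)^k})` with canonical generators `gen`: they generate
`Γ`, the relations between them are the consequences of the defining relators, and each of them is
an isometry of the prescribed type. -/
structure IsCanonicalSystem {U : Type*} [MetricSpace U] (Γ : Subgroup (U ≃ᵢ U)) {h r k : ℕ}
    {ε : Sign} (gen : CanonicalGen h r k ε → Γ) : Prop where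
  generates : Function.Surjective (FreeGroup.lift gen)
  relations : (FreeGroup.lift gen).ker = Subgroup.normalClosure (relators h r k ε)
  types : ∀ s, HasType s (gen s : U ≃ᵢ U)

end NEC

/-! ### NSK-maps and the corresponding involutions -/

namespace NSK

/-- The fundamental group `π₁(N_g) = ⟨d_1, …, d_g | d_1² ⋯ d_g² = 1⟩` of the closed non-orientable
surface `N_g` of genus `g`, the connected sum of `g` projective planes. -/
abbrev SurfaceGroup (g : ℕ) : Type :=
  PresentedGroup {(List.ofFn fun j : Fin g => FreeGroup.of j ^ 2).prod}

/-- The group `ℤ₂ = {1, X}`, written multiplicatively. -/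
abbrev Z2 : Type := Multiplicative (ZMod 2)

/-- The nontrivial element of `ℤ₂`. -/
abbrev X : Z2 := Multiplicative.ofAdd 1

variable {U : Type*} [MetricSpace U] {Γ : Subgroup (U ≃ᵢ U)}

/-- `θ : Γ → ℤ₂` is an NSK-map of genus `g`. -/
structure IsNSKMap (g : ℕ) (θ : Γ →* Z2) : Prop where
  surjective : Function.Surjective θ
  ker_iso : Nonempty (θ.ker ≃* SurfaceGroup g)

/-- Being in the same orbit of `ker θ`. -/
def kernelSetoid (θ : Γ →* Z2) : Setoid U where
  r z w := ∃ γ : Γ, θ γ = 1 ∧ (γ : U ≃ᵢ U) z = w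
  iseqv :=
    { refl := fun z => ⟨1, map_one θ, rfl⟩
      symm := by
        rintro z w ⟨γ, hγ, rfl⟩
        refine ⟨γ⁻¹, by rw [map_inv, hγ, inv_one], ?_⟩
        exact (γ : U ≃ᵢ U).symm_apply_apply z
      trans := by
        rintro z w v ⟨γ, hγ, rfl⟩ ⟨δ, hδ, rfl⟩
        exact ⟨δ * γ, by rw [map_mul, hγ, hδ, one_mul], rfl⟩ }

/-- The surface `U / ker θ`, with the quotient topology. -/
abbrev KernelSurface (θ : Γ →* Z2) : Type _ := Quotient (kernelSetoid θ)

/-- The projection `U → U / ker θ`. -/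
def proj (θ : Γ →* Z2) (z : U) : KernelSurface θ := Quotient.mk (kernelSetoid θ) z

theorem proj_smul_eq {θ : Γ →* Z2} {γ δ : Γ} (h : θ γ = θ δ) {z w : U}
    (hzw : proj θ z = proj θ w) : proj θ ((γ : U ≃ᵢ U) z) = proj θ ((δ : U ≃ᵢ U) w) := by
  obtain ⟨α, hα, rfl⟩ := Quotient.exact hzw
  refine Quotient.sound ⟨δ * α * γ⁻¹, ?_, ?_⟩
  · rw [map_mul, map_mul, map_inv, hα, h, mul_one, mul_inv_cancel]
  · change (δ : U ≃ᵢ U) ((α : U ≃ᵢ U) ((γ : U ≃ᵢ U).symm ((γ : U ≃ᵢ U) z))) = _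
    rw [IsometryEquiv.symm_apply_apply]

/-- The map `[z] ↦ [γ z]` of `U / ker θ`. -/
def inducedMap (θ : Γ →* Z2) (γ : Γ) : KernelSurface θ → KernelSurface θ :=
  Quotient.lift (fun z => proj θ ((γ : U ≃ᵢ U) z)) fun _ _ h =>
    proj_smul_eq rfl (Quotient.sound h)

theorem inducedMap_proj (θ : Γ →* Z2) (γ : Γ) (z : U) :
    inducedMap θ γ (proj θ z) = proj θ ((γ : U ≃ᵢ U) z) := rfl

theorem continuous_inducedMap (θ : Γ →* Z2) (γ : Γ) : Continuous (inducedMap θ γ) :=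
  Continuous.quotient_lift (continuous_quot_mk.comp (γ : U ≃ᵢ U).continuous) _

theorem inducedMap_inducedMap (θ : Γ →* Z2) (γ : Γ) (p : KernelSurface θ) :
    inducedMap θ γ (inducedMap θ γ p) = p := by
  induction p using Quotient.inductionOn with
  | _ z =>
    have h : θ (γ * γ) = θ 1 := by
      rw [map_mul, map_one]
      generalize θ γ = t
      revert t
      decide
    exact proj_smul_eq h (rfl : proj θ z = proj θ z)

/-- The involution of `U / ker θ` that corresponds to `θ`: it is induced by an arbitrary `γ ∈ Γ`
with `θ γ = X`. -/
noncomputable def involution (θ : Γ →* Z2) (hθ : Function.Surjective θ) :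
    KernelSurface θ ≃ₜ KernelSurface θ where
  toFun := inducedMap θ (hθ X).choose
  invFun := inducedMap θ (hθ X).choose
  left_inv := inducedMap_inducedMap θ _
  right_inv := inducedMap_inducedMap θ _
  continuous_toFun := continuous_inducedMap θ _
  continuous_invFun := continuous_inducedMap θ _

/-- The involution does not depend on the choice of `γ`. -/
theorem involution_proj (θ : Γ →* Z2) (hθ : Function.Surjective θ) (γ : Γ) (hγ : θ γ = X)
    (z : U) : involution θ hθ (proj θ z) = proj θ ((γ : U ≃ᵢ U) z) :=
  proj_smul_eq ((hθ X).choose_spec.trans hγ.symm) (rfl : proj θ z = proj θ z)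

end NSK

/-! ### Curves on surfaces -/

namespace SurfaceCurve

/-- The orbits of the `ℤ`-action on `ℝ × ℝ` generated by `(s, t) ↦ (s + 1, σ t)`, `σ = ±1`. -/
def bandSetoid (σ : ℤˣ) : Setoid (ℝ × ℝ) where
  r p q := ∃ n : ℤ, q = (p.1 + n, (((σ ^ n : ℤˣ) : ℤ) : ℝ) * p.2)
  iseqv :=
    { refl := fun p => ⟨0, by simp⟩
      symm := by
        rintro ⟨s, t⟩ _ ⟨n, rfl⟩
        refine ⟨-n, ?_⟩
        ext
        · simp
        · have h : (((σ ^ (-n) : ℤˣ) : ℤ) : ℝ) * (((σ ^ n : ℤˣ) : ℤ) : ℝ) = 1 := by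
            rw [← Int.cast_mul, ← Units.val_mul, ← zpow_add]
            simp
          simp only
          rw [← mul_assoc, h, one_mul]
      trans := by
        rintro ⟨s, t⟩ _ _ ⟨n, rfl⟩ ⟨m, rfl⟩
        refine ⟨n + m, ?_⟩
        ext
        · push_cast
          ring
        · simp only
          rw [← mul_assoc, ← Int.cast_mul, ← Units.val_mul, ← zpow_add, add_comm m n] }

/-- The open band `(ℝ × ℝ) / ℤ`: the open annulus for `σ = 1`, the open Möbius band for
`σ = -1`. -/
abbrev Band (σ : ℤˣ) : Type := Quotient (bandSetoid σ)

/-- The core circle of the band. -/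
def core (σ : ℤˣ) : Set (Band σ) :=
  Set.range fun s : ℝ => Quotient.mk (bandSetoid σ) (s, 0)

variable {S : Type*} [TopologicalSpace S]

/-- `C` is (the image of) a simple closed curve. -/
def IsSimpleClosedCurve (C : Set S) : Prop :=
  ∃ f : Circle → S, Continuous f ∧ Function.Injective f ∧ Set.range f = C

/-- `C` is two-sided: it is the core of an open annulus in the surface. -/
def IsTwoSided (C : Set S) : Prop :=
  ∃ f : Band 1 → S, Topology.IsOpenEmbedding f ∧ f '' core 1 = C

/-- `C` is one-sided: it is the core of an open Möbius band in the surface. -/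
def IsOneSided (C : Set S) : Prop :=
  ∃ f : Band (-1) → S, Topology.IsOpenEmbedding f ∧ f '' core (-1) = C

/-- A reflection curve of `ι`: a simple closed curve which `ι` fixes pointwise. -/
def IsReflectionCurve (ι : S → S) (C : Set S) : Prop :=
  IsSimpleClosedCurve C ∧ ∀ p ∈ C, ι p = p

end SurfaceCurve

/-! ### Fermi coordinates along a geodesic line -/

/-! The kernel of `θ` is torsion-free. For `g ≥ 2` the surface group embeds in an extension of ℤ by
a free group (`toExtension_injective`); `g = 1` is impossible because the square of a translation `e
i` lies in the kernel and has infinite order. Point stabilizers of a discrete group are finite, so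
the kernel acts freely on the plane, and every nontrivial involution of `Γ`, in particular every `c
i`, is sent to `X`.

A fixed point of `ι` lifts to a fixed point of some `γ` with `θ γ = X`, and `γ² = 1` by freeness.
Such a `γ` is conjugate to some `c i` or some `x j` (`involution_isConj`). Indeed `Γ` is a
semidirect product of a free product of groups of order two, generated by the conjugates of the `c
i`, with the group generated by the remaining generators. The latter has the same shape, with the `x
j` in place of the `c i` and a free complement, since the long relation can be solved for one of the
`e i`. Actions on reduced words provide the normal forms, and a normal form that squares to 1 is a
palindrome, which can be conjugated to its middle. So the fixed points of `ι` are the images of the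
axes of the `c i` and finitely many further points.

The stabilizer of the axis of `c i` in the kernel is infinite cyclic. Its generator `τ` shifts the
axis and acts on the two sides by a sign `σ`, and a thin tube around the axis descends to `Band σ`
(`exists_band`). If `θ (e i) = X`, then `e i * c i` lies in the kernel and exchanges the sides, so
`σ = -1`. Otherwise `e i` is a power of `τ`. The exponent is odd, because a representation in the
dihedral group of order eight shows that `e i` is not a square in the centralizer of `c i`
(`mul_self_ne_e`). As `e i` preserves the sides, `σ = 1`.

Distinct `i` give distinct curves because the `c i` are pairwise non-conjugate (`not_isConj_c`).
Connectedness shows that there are no other reflection curves (`exists_eq_curve`), and a curve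
cannot be both two-sided and one-sided (`IsTwoSided.not_isOneSided`). The geometry enters only
through the structure `FermiPlane`, so both planes are treated at once. -/

/-- Fermi coordinates along a geodesic line of a plane, the translations along this line, the
reflection in this line, and a group of isometries that plays the role of the
orientation-preserving ones. -/
structure FermiPlane (U : Type*) [MetricSpace U] where
  coord : ℝ × ℝ ≃ₜ U
  trans : ℝ → U ≃ᵢ U
  refl : U ≃ᵢ U
  rot : Subgroup (U ≃ᵢ U)
  trans_coord : ∀ a s t, trans a (coord (s, t)) = coord (s + a, t)
  refl_coord : ∀ s t, refl (coord (s, t)) = coord (s, -t)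
  isometry_axis : Isometry fun s : ℝ => coord (s, 0)
  trans_mem : ∀ a, trans a ∈ rot
  refl_not_mem : refl ∉ rot
  conj_mem : ∀ f ∈ rot, refl * f * refl ∈ rot
  exists_axis : ∀ z w, z ≠ w → ∃ f ∈ rot, f (coord (0, 0)) = z ∧ f (coord (dist z w, 0)) = w
  axis_unique : ∀ p s d, d ≠ 0 → dist p (coord (0, 0)) = |s| → dist p (coord (d, 0)) = |s - d| →
    p = coord (s, 0)
  eq_one_or_refl : ∀ f : U ≃ᵢ U, (∀ s, f (coord (s, 0)) = coord (s, 0)) → f = 1 ∨ f = refl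
  proper : ProperSpace U

namespace FermiPlane

/-! ### The model of the hyperbolic plane. -/

section Models

/-- The reflection `z ↦ -conj z` of the hyperbolic plane. -/
noncomputable def hyperbolicRefl : ℍ ≃ᵢ ℍ where
  toEquiv := MulAction.toPerm UpperHalfPlane.J
  isometry_toFun := by
    refine Isometry.of_dist_eq fun z w => ?_
    simp only [Equiv.toFun_as_coe, MulAction.toPerm_apply, UpperHalfPlane.dist_eq]
    have h1 : ∀ z : ℍ, (UpperHalfPlane.J • z).im = z.im := fun z => by
      rw [← UpperHalfPlane.coe_im, UpperHalfPlane.coe_J_smul]; simp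
    rw [h1, h1, UpperHalfPlane.coe_J_smul, UpperHalfPlane.coe_J_smul]
    congr 2
    rw [dist_neg_neg, Complex.dist_conj_conj]

theorem hyperbolicRefl_re (z : ℍ) : (hyperbolicRefl z).re = -z.re := by
  change (UpperHalfPlane.J • z).re = _
  rw [← UpperHalfPlane.coe_re, UpperHalfPlane.coe_J_smul]; simp

theorem hyperbolicRefl_im (z : ℍ) : (hyperbolicRefl z).im = z.im := by
  change (UpperHalfPlane.J • z).im = _
  rw [← UpperHalfPlane.coe_im, UpperHalfPlane.coe_J_smul]; simp

/-- The translation `z ↦ e^a z` of the hyperbolic plane. -/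
noncomputable def hyperbolicTrans (a : ℝ) : ℍ ≃ᵢ ℍ where
  toEquiv := MulAction.toPerm (⟨Real.exp a, Real.exp_pos a⟩ : {x : ℝ // 0 < x})
  isometry_toFun := UpperHalfPlane.isometry_pos_mul _

theorem coe_hyperbolicTrans (a : ℝ) (z : ℍ) :
    (hyperbolicTrans a z : ℂ) = Real.exp a * z := by
  change ((((⟨Real.exp a, Real.exp_pos a⟩ : {x : ℝ // 0 < x}) • z : ℍ)) : ℂ) = _
  rw [UpperHalfPlane.coe_pos_real_smul]
  simp

/-- The holomorphic isometries of the hyperbolic plane. -/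
def hyperbolicRot : Subgroup (ℍ ≃ᵢ ℍ) where
  carrier := {f | ∃ g : GL (Fin 2) ℝ, 0 < g.det.val ∧ ∀ z, f z = g • z}
  one_mem' := ⟨1, by simp, fun z => by simp⟩
  mul_mem' := by
    rintro f f' ⟨g, hg, h⟩ ⟨g', hg', h'⟩
    exact ⟨g * g', by simpa using mul_pos hg hg', fun z => by
      rw [IsometryEquiv.mul_apply, h', h, mul_smul]⟩
  inv_mem' := by
    rintro f ⟨g, hg, h⟩
    refine ⟨g⁻¹, by rw [map_inv, Units.val_inv_eq_inv_val]; exact inv_pos.2 hg, fun z => ?_⟩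
    apply f.injective
    rw [IsometryEquiv.apply_inv_self, h, smul_inv_smul]

/-- The Fermi coordinates `e^s (t + i)` of the hyperbolic plane. -/
noncomputable def hyperbolicCoord : ℝ × ℝ ≃ₜ ℍ where
  toFun p := ⟨⟨Real.exp p.1 * p.2, Real.exp p.1⟩, Real.exp_pos p.1⟩
  invFun z := (Real.log z.im, z.re / z.im)
  left_inv p := by
    have : Real.exp p.1 ≠ 0 := (Real.exp_pos _).ne'
    ext
    · simp [UpperHalfPlane.im]
    · simp [UpperHalfPlane.re, UpperHalfPlane.im]
  right_inv z := by
    have h := z.im_pos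
    apply UpperHalfPlane.ext
    apply Complex.ext
    · simp only [Real.exp_log h, UpperHalfPlane.coe_re]
      field_simp
    · simp [Real.exp_log h]
  continuous_toFun := by
    rw [UpperHalfPlane.isEmbedding_coe.continuous_iff]
    have : (fun p : ℝ × ℝ => (Real.exp p.1 * p.2 : ℝ) + (Real.exp p.1 : ℝ) * Complex.I) =
      UpperHalfPlane.coe ∘ fun p : ℝ × ℝ =>
        (⟨⟨Real.exp p.1 * p.2, Real.exp p.1⟩, Real.exp_pos p.1⟩ : ℍ) := by
      funext p
      apply Complex.ext <;> simp [Complex.exp_ofReal_re]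
    rw [← this]
    fun_prop
  continuous_invFun := by
    refine Continuous.prodMk ?_ ?_
    · exact UpperHalfPlane.continuous_im.log fun z => z.im_pos.ne'
    · exact UpperHalfPlane.continuous_re.div UpperHalfPlane.continuous_im fun z => z.im_pos.ne'

theorem hyperbolicCoord_re (s t : ℝ) : (hyperbolicCoord (s, t)).re = Real.exp s * t := rfl
theorem hyperbolicCoord_im (s t : ℝ) : (hyperbolicCoord (s, t)).im = Real.exp s := rfl

theorem upperHalfPlane_ext {z w : ℍ} (h : z.re = w.re) (h' : z.im = w.im) : z = w :=
  UpperHalfPlane.ext (Complex.ext h h')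

/-- Since `cosh` is injective on nonnegative numbers, distance conditions become polynomial
identities in the coordinates, which the following lemmas combine linearly. -/
theorem hyperbolic_dist_eq_iff (z w : ℍ) (d : ℝ) (hd : 0 ≤ d) :
    dist z w = d ↔ (z.re - w.re) ^ 2 + z.im ^ 2 + w.im ^ 2 = 2 * z.im * w.im * Real.cosh d := by
  have hz := z.im_pos
  have hw := w.im_pos
  have h : Real.cosh (dist z w) * (2 * z.im * w.im) =
      (z.re - w.re) ^ 2 + z.im ^ 2 + w.im ^ 2 := by
    rw [UpperHalfPlane.cosh_dist, Complex.dist_eq, ← Complex.normSq_eq_norm_sq,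
      Complex.normSq_apply]
    simp only [Complex.sub_re, Complex.sub_im, UpperHalfPlane.coe_re, UpperHalfPlane.coe_im]
    field_simp
    ring
  rw [← h]
  constructor
  · rintro rfl; ring
  · intro h2
    have h3 : Real.cosh (dist z w) = Real.cosh d := by
      have : (2 * z.im * w.im) ≠ 0 := by positivity
      apply mul_right_cancel₀ this
      linarith
    exact Real.cosh_strictMonoOn.injOn dist_nonneg hd h3

theorem hyperbolic_axis_unique (p : ℍ) (s d : ℝ) (hd : d ≠ 0)
    (h1 : dist p (hyperbolicCoord (0, 0)) = |s|)
    (h2 : dist p (hyperbolicCoord (d, 0)) = |s - d|) : p = hyperbolicCoord (s, 0) := by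
  rw [hyperbolic_dist_eq_iff _ _ _ (abs_nonneg _), Real.cosh_abs, hyperbolicCoord_re,
    hyperbolicCoord_im, Real.cosh_eq] at h1 h2
  have hy := p.im_pos
  have e1 : Real.exp s * Real.exp (-s) = 1 := by rw [← Real.exp_add]; simp
  have e2 : Real.exp (s - d) = Real.exp s * (Real.exp d)⁻¹ := by
    rw [sub_eq_add_neg, Real.exp_add, Real.exp_neg]
  have e3 : Real.exp (-(s - d)) = Real.exp (-s) * Real.exp d := by
    rw [← Real.exp_add]; congr 1; ring
  rw [e2, e3] at h2
  have hD := Real.exp_pos d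
  have hD1 : Real.exp d ≠ 1 := by simpa using hd
  have hS := Real.exp_pos s
  have hS' := Real.exp_pos (-s)
  rw [Real.exp_zero] at h1
  have h2' : p.re ^ 2 + p.im ^ 2 + Real.exp d ^ 2 =
      p.im * (Real.exp s + Real.exp (-s) * Real.exp d ^ 2) := by
    have : Real.exp d * (Real.exp d)⁻¹ = 1 := mul_inv_cancel₀ hD.ne'
    linear_combination h2 + p.im * Real.exp s * this
  -- The difference of the two circle equations no longer contains the real part.
  have h3 : (Real.exp d ^ 2 - 1) * (1 - p.im * Real.exp (-s)) = 0 := by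
    linear_combination h2' - h1
  have h4 : Real.exp d ^ 2 - 1 ≠ 0 := by
    intro h
    apply hD1
    nlinarith
  have h5 : p.im * Real.exp (-s) = 1 := by
    have := (mul_eq_zero.1 h3).resolve_left h4
    linarith
  have h6 : p.im = Real.exp s := by
    linear_combination Real.exp s * h5 - p.im * e1
  have h7 : p.re ^ 2 = 0 := by
    rw [h6] at h1
    linear_combination h1 + e1
  refine upperHalfPlane_ext ?_ h6
  rw [hyperbolicCoord_re, pow_eq_zero_iff two_ne_zero |>.1 h7, mul_zero]

/-- The distances to two points of the axis determine a point up to the sign of its real part. If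
one point off the axis keeps its sign, then the distances to that point fix the sign for all others;
if none does, every sign is reversed. -/
theorem hyperbolic_eq_one_or_refl (f : ℍ ≃ᵢ ℍ)
    (hf : ∀ s, f (hyperbolicCoord (s, 0)) = hyperbolicCoord (s, 0)) :
    f = 1 ∨ f = hyperbolicRefl := by
  have key : ∀ z : ℍ, (f z).im = z.im ∧ ((f z).re = z.re ∨ (f z).re = -z.re) := by
    intro z
    have h : ∀ s, ((f z).re ^ 2 + (f z).im ^ 2 + Real.exp s ^ 2) * z.im =
        (z.re ^ 2 + z.im ^ 2 + Real.exp s ^ 2) * (f z).im := by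
      intro s
      have h1 := (hyperbolic_dist_eq_iff z (hyperbolicCoord (s, 0)) _ dist_nonneg).1 rfl
      have h2 := (hyperbolic_dist_eq_iff (f z) (hyperbolicCoord (s, 0)) _ dist_nonneg).1 rfl
      have h3 : dist (f z) (hyperbolicCoord (s, 0)) = dist z (hyperbolicCoord (s, 0)) := by
        conv_lhs => rw [← hf s]
        exact f.dist_eq _ _
      rw [h3] at h2
      rw [hyperbolicCoord_re, hyperbolicCoord_im, mul_zero, sub_zero] at h1 h2
      rw [h1, h2]; ring
    have h0 := h 0
    have h1 := h 1
    have hE : Real.exp 1 ^ 2 - 1 ≠ 0 := by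
      have : 1 < Real.exp 1 := by simp
      nlinarith
    rw [Real.exp_zero] at h0
    have him : (f z).im = z.im := by
      apply mul_left_cancel₀ hE
      linear_combination h0 - h1
    refine ⟨him, ?_⟩
    rw [him] at h0
    have := mul_right_cancel₀ z.im_pos.ne' h0
    apply sq_eq_sq_iff_eq_or_eq_neg.1
    linarith
  by_cases h : ∃ z, (f z).re = z.re ∧ z.re ≠ 0
  · left
    obtain ⟨z, hz, hz0⟩ := h
    ext1 w
    refine upperHalfPlane_ext ?_ (key w).1
    rcases (key w).2 with h | h
    · exact h
    · have h1 := (hyperbolic_dist_eq_iff z w _ dist_nonneg).1 rfl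
      have h2 := (hyperbolic_dist_eq_iff (f z) (f w) _ dist_nonneg).1 rfl
      rw [f.dist_eq, (key z).1, (key w).1, ← h1, hz, h] at h2
      have : z.re * w.re = 0 := by linarith
      rw [h, (mul_eq_zero.1 this).resolve_left hz0]
      simp only [neg_zero, IsometryEquiv.coe_one, id]
      exact ((mul_eq_zero.1 this).resolve_left hz0).symm
  · right
    push Not at h
    ext1 w
    refine upperHalfPlane_ext ?_ ((key w).1.trans (hyperbolicRefl_im w).symm)
    rw [hyperbolicRefl_re]
    rcases (key w).2 with h' | h'
    · rw [h', h w h', neg_zero]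
    · exact h'

theorem sl2_mem_hyperbolicRot (g : Matrix.SpecialLinearGroup (Fin 2) ℝ) :
    (IsometryEquiv.constSMul g : ℍ ≃ᵢ ℍ) ∈ hyperbolicRot :=
  ⟨(g : GL (Fin 2) ℝ), by simp, fun z => rfl⟩

/-- The matrix with rows `a, b` and `c, d`. -/
def sl2 (a b c d : ℝ) (h : a * d - b * c = 1) : Matrix.SpecialLinearGroup (Fin 2) ℝ :=
  ⟨!![a, b; c, d], by rw [Matrix.det_fin_two_of, h]⟩

theorem coe_sl2_smul (a b c d : ℝ) (h : a * d - b * c = 1) (z : ℍ) :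
    ((sl2 a b c d h • z : ℍ) : ℂ) = (a * z + b) / (c * z + d) := by
  rw [UpperHalfPlane.coe_specialLinearGroup_apply]; rfl

/-- A rotation about `i` takes an arbitrary point to the imaginary axis. -/
theorem exists_sl2_re_eq_zero (w : ℍ) : ∃ g : Matrix.SpecialLinearGroup (Fin 2) ℝ,
    g • (UpperHalfPlane.I : ℍ) = UpperHalfPlane.I ∧ (g • w).re = 0 := by
  -- The expression is the numerator of the real part of the rotated point. It equals `w.re` at `0`
  -- and `-w.re` at `π / 2`, so it vanishes in between.
  obtain ⟨θ, -, hθ⟩ : ∃ θ ∈ Set.Icc 0 (Real.pi / 2), w.re * (Real.cos θ ^ 2 - Real.sin θ ^ 2) +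
      (1 - w.re ^ 2 - w.im ^ 2) * (Real.cos θ * Real.sin θ) = 0 := by
    have hc : Continuous fun θ => w.re * (Real.cos θ ^ 2 - Real.sin θ ^ 2) +
      (1 - w.re ^ 2 - w.im ^ 2) * (Real.cos θ * Real.sin θ) := by fun_prop
    have hpi : (0 : ℝ) ≤ Real.pi / 2 := by positivity
    rcases le_total 0 w.re with h | h
    · exact intermediate_value_Icc' hpi hc.continuousOn ⟨by simpa using h, by simpa using h⟩
    · exact intermediate_value_Icc hpi hc.continuousOn ⟨by simpa using h, by simpa using h⟩
  have hcs := Real.cos_sq_add_sin_sq θ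
  generalize Real.cos θ = c at hθ hcs
  generalize Real.sin θ = s at hθ hcs
  refine ⟨sl2 c s (-s) c (by linear_combination hcs), ?_, ?_⟩
  · apply UpperHalfPlane.ext
    rw [coe_sl2_smul, div_eq_iff]
    · apply Complex.ext <;> simp
    · intro h
      have h1 := congrArg Complex.re h
      have h2 := congrArg Complex.im h
      simp at h1 h2
      rw [h1, h2] at hcs
      norm_num at hcs
  · rw [← UpperHalfPlane.coe_re, coe_sl2_smul, Complex.div_re,
      ← add_div]
    have : ∀ x y : ℝ, x = 0 → x / y = 0 := fun x y h => by rw [h, zero_div]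
    apply this
    simp
    linear_combination hθ

theorem hyperbolic_exists_axis (z w : ℍ) : ∃ f ∈ hyperbolicRot,
    f (hyperbolicCoord (0, 0)) = z ∧ f (hyperbolicCoord (dist z w, 0)) = w := by
  have hI : hyperbolicCoord (0, 0) = UpperHalfPlane.I :=
    upperHalfPlane_ext (by simp [hyperbolicCoord_re]) (by simp [hyperbolicCoord_im])
  obtain ⟨g, hg, hgw⟩ := exists_sl2_re_eq_zero (z.toSL2R⁻¹ • w)
  suffices H : ∃ k : Matrix.SpecialLinearGroup (Fin 2) ℝ, k • (UpperHalfPlane.I : ℍ) = z ∧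
      k • hyperbolicCoord (dist z w, 0) = w by
    obtain ⟨k, h1, h2⟩ := H
    exact ⟨_, sl2_mem_hyperbolicRot k, by rw [hI]; exact h1, h2⟩
  set k := z.toSL2R * g⁻¹ with hk
  have hkI : k • (UpperHalfPlane.I : ℍ) = z := by
    rw [hk, mul_smul, inv_smul_eq_iff.2 hg.symm, UpperHalfPlane.toSL2R_smul_I]
  set p := k⁻¹ • w with hp
  have hp0 : p.re = 0 := by rw [hp, hk, mul_inv_rev, inv_inv, mul_smul]; exact hgw
  have hpw : k • p = w := smul_inv_smul _ _
  have hdist : dist (UpperHalfPlane.I : ℍ) p = dist z w := by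
    rw [← hkI, ← hpw, dist_smul]
  have hlog : |Real.log p.im| = dist z w := by
    rw [← hdist, UpperHalfPlane.dist_of_re_eq (by simp [hp0]), Real.dist_eq]
    simp
  rcases le_total 0 (Real.log p.im) with h | h
  · refine ⟨k, hkI, ?_⟩
    rw [abs_of_nonneg h] at hlog
    rw [← hlog, ← hpw]
    congr 1
    exact upperHalfPlane_ext (by simp [hyperbolicCoord_re, hp0])
      (by simp [hyperbolicCoord_im, Real.exp_log p.im_pos])
  -- Here `p` lies below `i` on the axis, and the half turn `q ↦ -1 / q` about `i` reverses the axis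
  -- first.
  · have hS : ∀ q : ℍ, ((sl2 0 (-1) 1 0 (by norm_num) • q : ℍ) : ℂ) = -1 / q := fun q => by
      rw [coe_sl2_smul]; simp
    refine ⟨k * sl2 0 (-1) 1 0 (by norm_num), ?_, ?_⟩
    · rw [mul_smul]
      convert hkI using 2
      apply UpperHalfPlane.ext
      rw [hS]
      simp
    · rw [mul_smul]
      convert hpw using 2
      apply UpperHalfPlane.ext
      rw [abs_of_nonpos h] at hlog
      rw [hS, ← hlog]
      have h1 : ((hyperbolicCoord (-Real.log p.im, 0) : ℍ) : ℂ) = (p.im : ℂ)⁻¹ * Complex.I := by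
        apply Complex.ext
        · rw [UpperHalfPlane.coe_re, hyperbolicCoord_re, ← Complex.ofReal_inv]
          simp
        · rw [UpperHalfPlane.coe_im, hyperbolicCoord_im, ← Complex.ofReal_inv, Real.exp_neg,
            Real.exp_log p.im_pos]
          simp
      have h2 : (p : ℂ) = p.im * Complex.I := by
        apply Complex.ext <;> simp [hp0]
      rw [h1, h2]
      have : (p.im : ℂ) ≠ 0 := by exact_mod_cast p.im_pos.ne'
      field_simp
      simp

/-- Evaluating a Möbius transformation that agrees with `z ↦ -conj z` at `i`, `2i` and `1 + i` makes
the bottom row of its matrix vanish, against the positive determinant. -/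
theorem hyperbolicRefl_not_mem : hyperbolicRefl ∉ hyperbolicRot := by
  rintro ⟨g, hg, h⟩
  have key : ∀ x y : ℝ, 0 < y → (⟨-x, y⟩ : ℂ) * (g 1 0 * ⟨x, y⟩ + g 1 1) =
      g 0 0 * ⟨x, y⟩ + g 0 1 := by
    intro x y hy
    have h1 := h ⟨⟨x, y⟩, hy⟩
    have h2 : ((hyperbolicRefl ⟨⟨x, y⟩, hy⟩ : ℍ) : ℂ) = ⟨-x, y⟩ :=
      Complex.ext (hyperbolicRefl_re _) (hyperbolicRefl_im _)
    rw [h1, UpperHalfPlane.coe_smul_of_det_pos hg, div_eq_iff (UpperHalfPlane.denom_ne_zero _ _)]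
      at h2
    exact h2.symm
  have e1 := congrArg Complex.re (key 0 1 one_pos)
  have e2 := congrArg Complex.re (key 0 2 two_pos)
  have e3 := congrArg Complex.im (key 0 1 one_pos)
  have e4 := congrArg Complex.re (key 1 1 one_pos)
  simp at e1 e2 e3 e4
  have hd : g.det.val = g 0 0 * g 1 1 - g 0 1 * g 1 0 := by
    rw [Matrix.GeneralLinearGroup.val_det_apply, Matrix.det_fin_two]
  have c0 : g 1 0 = 0 := by linarith
  have d0 : g 1 1 = 0 := by linarith
  rw [hd, c0, d0] at hg
  simp at hg

/-- The hyperbolic plane. -/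
noncomputable def hyperbolic : FermiPlane ℍ where
  coord := hyperbolicCoord
  trans := hyperbolicTrans
  refl := hyperbolicRefl
  rot := hyperbolicRot
  trans_coord a s t := by
    apply UpperHalfPlane.ext
    rw [coe_hyperbolicTrans]
    apply Complex.ext
    · simp [hyperbolicCoord_re, hyperbolicCoord_im, Real.exp_add, Complex.exp_ofReal_re]; ring
    · simp [hyperbolicCoord_re, hyperbolicCoord_im, Real.exp_add, Complex.exp_ofReal_re]; ring
  refl_coord s t := upperHalfPlane_ext
    (by rw [hyperbolicRefl_re, hyperbolicCoord_re, hyperbolicCoord_re, mul_neg])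
    (by rw [hyperbolicRefl_im, hyperbolicCoord_im, hyperbolicCoord_im])
  isometry_axis := by
    convert UpperHalfPlane.isometry_vertical_line 0 using 2
    exact upperHalfPlane_ext (by simp [hyperbolicCoord_re]) (by simp [hyperbolicCoord_im])
  trans_mem a := by
    refine ⟨Matrix.GeneralLinearGroup.mkOfDetNeZero !![Real.exp a, 0; 0, 1] (by simp), ?_, ?_⟩
    · simp [Matrix.GeneralLinearGroup.mkOfDetNeZero, Matrix.GeneralLinearGroup.val_det_apply,
        Real.exp_pos]
    · intro z
      apply UpperHalfPlane.ext
      rw [coe_hyperbolicTrans, UpperHalfPlane.coe_smul_of_det_pos]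
      · simp [UpperHalfPlane.num, UpperHalfPlane.denom, Matrix.GeneralLinearGroup.mkOfDetNeZero]
      · simp [Matrix.GeneralLinearGroup.mkOfDetNeZero, Matrix.GeneralLinearGroup.val_det_apply,
        Real.exp_pos]
  refl_not_mem := hyperbolicRefl_not_mem
  conj_mem := by
    rintro f ⟨g, hg, h⟩
    refine ⟨UpperHalfPlane.J * g * UpperHalfPlane.J, by simpa using hg, fun z => ?_⟩
    rw [IsometryEquiv.mul_apply, IsometryEquiv.mul_apply, h, mul_smul, mul_smul]
    rfl
  exists_axis z w _ := hyperbolic_exists_axis z w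
  axis_unique := hyperbolic_axis_unique
  eq_one_or_refl := hyperbolic_eq_one_or_refl
  proper := inferInstance

end Models

end FermiPlane

namespace FermiPlane

/-! ### The model of the Euclidean plane, and transport of the structure to isometric copies. -/

section Models

/-- The holomorphic isometries of the Euclidean plane. -/
def euclideanRot : Subgroup (ℂ ≃ᵢ ℂ) where
  carrier := {f | ∃ u v : ℂ, ∀ z, f z = u * z + v}
  one_mem' := ⟨1, 0, fun z => by simp⟩
  mul_mem' := by
    rintro f f' ⟨u, v, h⟩ ⟨u', v', h'⟩
    exact ⟨u * u', u * v' + v, fun z => by rw [IsometryEquiv.mul_apply, h', h]; ring⟩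
  inv_mem' := by
    rintro f ⟨u, v, h⟩
    have hu : u ≠ 0 := by
      rintro rfl
      have : f 0 = f 1 := by rw [h, h]; ring
      exact zero_ne_one (f.injective this)
    refine ⟨u⁻¹, -u⁻¹ * v, fun z => ?_⟩
    apply f.injective
    rw [IsometryEquiv.apply_inv_self, h]
    field_simp
    ring

/-- The reflection `z ↦ conj z` of the Euclidean plane. -/
noncomputable def euclideanRefl : ℂ ≃ᵢ ℂ := Complex.conjLIE.toIsometryEquiv

theorem euclideanRefl_apply (z : ℂ) : euclideanRefl z = (starRingEnd ℂ) z := rfl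

/-- The Cartesian coordinates `s + t i` of the Euclidean plane. -/
noncomputable def euclideanCoord : ℝ × ℝ ≃ₜ ℂ := Complex.equivRealProdCLM.toHomeomorph.symm

theorem euclideanCoord_apply (s t : ℝ) : euclideanCoord (s, t) = ⟨s, t⟩ := rfl

/-- The Euclidean plane. -/
noncomputable def euclidean : FermiPlane ℂ where
  coord := euclideanCoord
  trans a := IsometryEquiv.addRight (a : ℂ)
  refl := euclideanRefl
  rot := euclideanRot
  trans_coord a s t := by
    apply Complex.ext <;> simp [euclideanCoord_apply]
  refl_coord s t := by
    apply Complex.ext <;> simp [euclideanCoord_apply, euclideanRefl_apply]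
  isometry_axis := by
    have : (fun s : ℝ => euclideanCoord (s, 0)) =
        fun s : ℝ => (s : ℂ) := by
      funext s
      apply Complex.ext <;> simp [euclideanCoord_apply]
    rw [this]
    exact Complex.isometry_ofReal
  trans_mem a := ⟨1, a, fun z => by simp⟩
  refl_not_mem := by
    rintro ⟨u, v, h⟩
    simp only [euclideanRefl_apply] at h
    have h0 := h 0
    have h1 := h 1
    have h2 := h Complex.I
    simp at h0 h1 h2
    rw [← h0, add_zero] at h1 h2
    rw [← h1, one_mul] at h2
    have := congrArg Complex.im h2
    norm_num at this
  conj_mem := by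
    rintro f ⟨u, v, h⟩
    refine ⟨(starRingEnd ℂ) u, (starRingEnd ℂ) v, fun z => ?_⟩
    rw [IsometryEquiv.mul_apply, IsometryEquiv.mul_apply, h, euclideanRefl_apply,
      euclideanRefl_apply]
    simp
  exists_axis z w hzw := by
    have hd : (dist z w : ℂ) ≠ 0 := by exact_mod_cast (dist_pos.2 hzw).ne'
    set u : ℂ := (w - z) / dist z w with hu
    have hu1 : ‖u‖ = 1 := by
      rw [hu, norm_div, Complex.norm_real, Real.norm_of_nonneg dist_nonneg, dist_comm,
        Complex.dist_eq]
      apply div_self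
      rw [norm_ne_zero_iff]
      exact sub_ne_zero.2 hzw.symm
    have hu0 : u ≠ 0 := by rw [← norm_ne_zero_iff, hu1]; exact one_ne_zero
    let f : ℂ ≃ᵢ ℂ :=
      { toFun := fun x => u * x + z
        invFun := fun x => u⁻¹ * (x - z)
        left_inv := fun x => by field_simp; ring
        right_inv := fun x => by field_simp; ring
        isometry_toFun := Isometry.of_dist_eq fun x y => by
          rw [Complex.dist_eq, Complex.dist_eq, add_sub_add_right_eq_sub, ← mul_sub, norm_mul, hu1,
            one_mul] }
    refine ⟨f, ⟨u, z, fun x => rfl⟩, ?_, ?_⟩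
    · have : euclideanCoord (0, 0) = 0 := by
        apply Complex.ext <;> simp [euclideanCoord_apply]
      rw [this]
      change u * 0 + z = z
      simp
    · have : euclideanCoord (dist z w, 0) = (dist z w : ℂ) := by
        apply Complex.ext <;> simp [euclideanCoord_apply]
      rw [this]
      change u * _ + z = w
      rw [hu]
      field_simp
      ring
  axis_unique p s d hd h1 h2 := by
    have h : ∀ a b : ℝ, dist p (euclideanCoord (a, 0)) = |b| →
        (p.re - a) ^ 2 + p.im ^ 2 = b ^ 2 := by
      intro a b h
      rw [← sq_abs b, ← h, Complex.dist_eq, ← Complex.normSq_eq_norm_sq, Complex.normSq_apply]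
      simp [euclideanCoord_apply]
      ring
    have e1 := h _ _ h1
    have e2 := h _ _ h2
    have e3 : p.re = s := by
      apply mul_left_cancel₀ hd
      linear_combination (e1 - e2) / 2
    have e4 : p.im = 0 := by
      rw [← pow_eq_zero_iff two_ne_zero]
      rw [e3] at e1
      linear_combination e1
    apply Complex.ext <;> simp [euclideanCoord_apply, e3, e4]
  eq_one_or_refl f hf := by
    have hr : ∀ s : ℝ, f s = s := by
      intro s
      have : euclideanCoord (s, 0) = (s : ℂ) := by
        apply Complex.ext <;> simp [euclideanCoord_apply]
      rw [← this, hf]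
    have h0 : f 0 = 0 := by simpa using hr 0
    have h1 : f 1 = 1 := by simpa using hr 1
    obtain ⟨a, ha⟩ := linear_isometry_complex (f.toRealLinearIsometryEquivOfMapZero h0)
    have hfa : ∀ z, f z = (f.toRealLinearIsometryEquivOfMapZero h0) z := fun z => by simp
    rcases ha with ha | ha
    · left
      have ha1 : (a : ℂ) = 1 := by
        have := hfa 1
        rw [ha, h1, rotation_apply, mul_one] at this
        exact this.symm
      ext1 z
      rw [hfa, ha, rotation_apply, ha1, one_mul]
      rfl
    · right
      have ha1 : (a : ℂ) = 1 := by
        have := hfa 1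
        rw [ha, h1] at this
        simpa using this.symm
      ext1 z
      rw [hfa, ha]
      simp [ha1, euclideanRefl_apply]
  proper := inferInstance

/-- Transport of Fermi coordinates along an isometry. -/
noncomputable def transport {U V : Type*} [MetricSpace U] [MetricSpace V] (M : FermiPlane V)
    (e : U ≃ᵢ V) : FermiPlane U where
  coord := M.coord.trans e.symm.toHomeomorph
  trans a := (e.trans (M.trans a)).trans e.symm
  refl := (e.trans M.refl).trans e.symm
  rot :=
    { carrier := {f | (e.symm.trans f).trans e ∈ M.rot}
      one_mem' := by
        have : (e.symm.trans (1 : U ≃ᵢ U)).trans e = 1 := by ext1 z; simp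
        change _ ∈ M.rot
        rw [this]; exact one_mem _
      mul_mem' := fun {f f'} h h' => by
        have : (e.symm.trans (f * f')).trans e =
          (e.symm.trans f).trans e * (e.symm.trans f').trans e := by ext1 z; simp
        change _ ∈ M.rot
        rw [this]; exact mul_mem h h'
      inv_mem' := fun {f} h => by
        have : (e.symm.trans f⁻¹).trans e = ((e.symm.trans f).trans e)⁻¹ := by
          rw [eq_inv_iff_mul_eq_one]; ext1 z; simp
        change _ ∈ M.rot
        rw [this]; exact inv_mem h }
  trans_coord a s t := by simp [M.trans_coord]
  refl_coord s t := by simp [M.refl_coord]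
  isometry_axis := e.symm.isometry.comp M.isometry_axis
  trans_mem a := by
    change _ ∈ M.rot
    convert M.trans_mem a using 1
    ext1 z; simp
  refl_not_mem h := by
    apply M.refl_not_mem
    change _ ∈ M.rot at h
    convert h using 1
    ext1 z; simp
  conj_mem f hf := by
    change _ ∈ M.rot
    convert M.conj_mem _ hf using 1
    ext1 z; simp
  exists_axis z w h := by
    obtain ⟨f, hf, h1, h2⟩ := M.exists_axis (e z) (e w) fun h' => h (e.injective h')
    refine ⟨(e.trans f).trans e.symm, ?_, ?_, ?_⟩
    · change _ ∈ M.rot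
      convert hf using 1
      ext1 z; simp
    · simp [h1]
    · rw [e.dist_eq] at h2
      simp [h2]
  axis_unique p s d hd h1 h2 := by
    have h : ∀ a, dist (e p) (M.coord (a, 0)) =
        dist p ((M.coord.trans e.symm.toHomeomorph) (a, 0)) := fun a => by
      rw [← e.symm.dist_eq]; simp
    have := M.axis_unique (e p) s d hd (by rw [h, h1]) (by rw [h, h2])
    simp [← this]
  eq_one_or_refl f hf := by
    rcases M.eq_one_or_refl ((e.symm.trans f).trans e) (fun s => by
      have := hf s
      simp only [Homeomorph.trans_apply, IsometryEquiv.coe_toHomeomorph] at this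
      simp [this]) with h | h
    · left
      ext1 z
      have := congrArg (fun k => e.symm (k (e z))) h
      simpa using this
    · right
      ext1 z
      have := congrArg (fun k => e.symm (k (e z))) h
      simpa using this
  proper := by
    have := M.proper
    refine ⟨fun x r => ?_⟩
    have h := (isCompact_closedBall (e x) r).image e.symm.continuous
    rwa [IsometryEquiv.image_closedBall, IsometryEquiv.symm_apply_apply] at h

end Models

/-- The hyperbolic plane and the Euclidean plane have Fermi coordinates. -/
theorem nonempty_of_isometryEquiv {U : Type*} [MetricSpace U]
    (hU : Nonempty (U ≃ᵢ ℍ) ∨ Nonempty (U ≃ᵢ EuclideanSpace ℝ (Fin 2))) :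
    Nonempty (FermiPlane U) := by
  rcases hU with ⟨⟨e⟩⟩ | ⟨⟨e⟩⟩
  · exact ⟨hyperbolic.transport e⟩
  · exact ⟨euclidean.transport
      (e.trans Complex.orthonormalBasisOneI.repr.toIsometryEquiv.symm)⟩

/-! ### Isometries in relation to a line. -/

open PlaneIsometry

variable {U : Type*} [MetricSpace U] (M : FermiPlane U)

theorem dist_axis (s t : ℝ) : dist (M.coord (s, 0)) (M.coord (t, 0)) = |s - t| := by
  rw [M.isometry_axis.dist_eq s t, Real.dist_eq]

/-- Matching the axis with `ℓ` at the parameters `0` and `1` suffices, since `axis_unique` recovers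
a point of the axis from its distances to two others. -/
theorem exists_rot_eq_line {ℓ : ℝ → U} (hℓ : Isometry ℓ) :
    ∃ f ∈ M.rot, ∀ s, f (M.coord (s, 0)) = ℓ s := by
  have h01 : ℓ 0 ≠ ℓ 1 := fun h => zero_ne_one (hℓ.injective h)
  obtain ⟨f, hf, h0, h1⟩ := M.exists_axis _ _ h01
  rw [hℓ.dist_eq, dist_zero_left, norm_one] at h1
  refine ⟨f, hf, fun s => ?_⟩
  have h : M.coord (s, 0) = f⁻¹ (ℓ s) := by
    symm
    apply M.axis_unique _ s 1 one_ne_zero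
    · rw [← f.dist_eq, IsometryEquiv.apply_inv_self, h0, hℓ.dist_eq, Real.dist_eq, sub_zero]
    · rw [← f.dist_eq, IsometryEquiv.apply_inv_self, h1, hℓ.dist_eq, Real.dist_eq]
  rw [h, IsometryEquiv.apply_inv_self]

theorem refl_mul_refl : M.refl * M.refl = 1 := by
  ext1 z
  obtain ⟨⟨s, t⟩, rfl⟩ := M.coord.surjective z
  simp [M.refl_coord]

theorem refl_eq_self_iff (s t : ℝ) : M.refl (M.coord (s, t)) = M.coord (s, t) ↔ t = 0 := by
  rw [M.refl_coord, M.coord.injective.eq_iff, Prod.mk.injEq]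
  constructor
  · rintro ⟨-, h⟩; linarith
  · rintro rfl; simp

/-- A reflection in a line is conjugate to the standard one. -/
theorem exists_eq_conj_refl {c : U ≃ᵢ U} (hc : IsReflection c) :
    ∃ f ∈ M.rot, c = f * M.refl * f⁻¹ := by
  obtain ⟨ℓ, hℓ, hfix⟩ := hc
  obtain ⟨f, hf, hfℓ⟩ := M.exists_rot_eq_line hℓ
  refine ⟨f, hf, ?_⟩
  rcases M.eq_one_or_refl (f⁻¹ * c * f) (fun s => by
    have : c (ℓ s) = ℓ s := by
      have : ℓ s ∈ {z | c z = z} := by rw [hfix]; exact ⟨s, rfl⟩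
      exact this
    rw [IsometryEquiv.mul_apply, IsometryEquiv.mul_apply, hfℓ, this, ← hfℓ,
      IsometryEquiv.inv_apply_self]) with h | h
  · exfalso
    have hc1 : c = 1 := by
      have : c = f * (f⁻¹ * c * f) * f⁻¹ := by group
      rw [this, h]; group
    have : f (M.coord (0, 1)) ∈ {z | c z = z} := by rw [hc1]; rfl
    rw [hfix] at this
    obtain ⟨s, hs⟩ := this
    rw [← hfℓ, f.injective.eq_iff, M.coord.injective.eq_iff] at hs
    simpa using congrArg Prod.snd hs
  · rw [← h]; group

/-- Both reflections are conjugates of `M.refl` by elements of `M.rot`, and their product regroups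
so that the two copies of `M.refl` enclose an element of `M.rot`. -/
theorem mem_rot_of_isOrientationPreserving {f : U ≃ᵢ U} (hf : IsOrientationPreserving f) :
    f ∈ M.rot := by
  obtain ⟨s, t, hs, ht, rfl⟩ := hf
  obtain ⟨p, hp, rfl⟩ := M.exists_eq_conj_refl hs
  obtain ⟨q, hq, rfl⟩ := M.exists_eq_conj_refl ht
  have : p * M.refl * p⁻¹ * (q * M.refl * q⁻¹) = p * (M.refl * (p⁻¹ * q) * M.refl) * q⁻¹ := by
    group
  rw [this]
  exact mul_mem (mul_mem hp (M.conj_mem _ (mul_mem (inv_mem hp) hq))) (inv_mem hq)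

/-- Fermi coordinates along another line. -/
noncomputable def move (f : U ≃ᵢ U) (hf : f ∈ M.rot) : FermiPlane U where
  coord := M.coord.trans f.toHomeomorph
  trans a := f * M.trans a * f⁻¹
  refl := f * M.refl * f⁻¹
  rot := M.rot
  trans_coord a s t := by simp [M.trans_coord]
  refl_coord s t := by simp [M.refl_coord]
  isometry_axis := f.isometry.comp M.isometry_axis
  trans_mem a := mul_mem (mul_mem hf (M.trans_mem a)) (inv_mem hf)
  refl_not_mem h := M.refl_not_mem (by
    have := mul_mem (mul_mem (inv_mem hf) h) hf
    convert this using 1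
    group)
  conj_mem g hg := by
    have : f * M.refl * f⁻¹ * g * (f * M.refl * f⁻¹) =
      f * (M.refl * (f⁻¹ * g * f) * M.refl) * f⁻¹ := by group
    rw [this]
    exact mul_mem (mul_mem hf (M.conj_mem _ (mul_mem (mul_mem (inv_mem hf) hg) hf))) (inv_mem hf)
  exists_axis z w h := by
    obtain ⟨g, hg, h1, h2⟩ := M.exists_axis z w h
    exact ⟨g * f⁻¹, mul_mem hg (inv_mem hf), by simp [h1], by simp [h2]⟩
  axis_unique p s d hd h1 h2 := by
    have h : ∀ a, dist (f⁻¹ p) (M.coord (a, 0)) =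
        dist p ((M.coord.trans f.toHomeomorph) (a, 0)) := fun a => by
      rw [← f.dist_eq]; simp
    have := M.axis_unique (f⁻¹ p) s d hd (by rw [h, h1]) (by rw [h, h2])
    simp [← this]
  eq_one_or_refl g hg := by
    rcases M.eq_one_or_refl (f⁻¹ * g * f) (fun s => by
      have := hg s
      simp only [Homeomorph.trans_apply, IsometryEquiv.coe_toHomeomorph] at this
      simp [this]) with h | h
    · left
      have : g = f * (f⁻¹ * g * f) * f⁻¹ := by group
      rw [this, h]; group
    · right
      rw [← h]; group
  proper := M.proper

/-- A reflection is the standard reflection of suitable Fermi coordinates. -/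
theorem exists_refl_eq (M : FermiPlane U) {c : U ≃ᵢ U} (hc : IsReflection c) :
    ∃ N : FermiPlane U, N.refl = c := by
  obtain ⟨f, hf, rfl⟩ := M.exists_eq_conj_refl hc
  exact ⟨M.move f hf, rfl⟩

theorem real_isometry_cases {u : ℝ → ℝ} (hu : Isometry u) :
    (∀ s, u s = s + u 0) ∨ ∀ s, u s = u 0 - s := by
  have h : ∀ s t, (u s - u t) ^ 2 = (s - t) ^ 2 := fun s t => by
    have := hu.dist_eq s t
    rw [Real.dist_eq, Real.dist_eq] at this
    rw [← sq_abs, this, sq_abs]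
  have h1 := h 1 0
  have h2 : (u 1 - u 0 - 1) * (u 1 - u 0 + 1) = 0 := by linear_combination h1
  rcases mul_eq_zero.1 h2 with h2 | h2
  · left
    intro s
    have h3 := h s 0
    have h4 := h s 1
    have : u 1 = u 0 + 1 := by linarith
    rw [this] at h4
    linear_combination (h3 - h4) / 2
  · right
    intro s
    have h3 := h s 0
    have h4 := h s 1
    have : u 1 = u 0 - 1 := by linarith
    rw [this] at h4
    linear_combination (h4 - h3) / 2

theorem trans_zero : M.trans 0 = 1 := by
  ext1 z
  obtain ⟨⟨s, t⟩, rfl⟩ := M.coord.surjective z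
  simp [M.trans_coord]

theorem exists_axis_eq {z : U} (hz : M.refl z = z) : ∃ s, M.coord (s, 0) = z := by
  obtain ⟨⟨s, t⟩, rfl⟩ := M.coord.surjective z
  exact ⟨s, by rw [(M.refl_eq_self_iff s t).1 hz]⟩

/-- An isometry that commutes with the reflection acts on its axis. -/
theorem axis_cases {f : U ≃ᵢ U} (hf : Commute f M.refl) :
    (∃ a, f = M.trans a) ∨ (∃ a, f = M.trans a * M.refl) ∨
      ∃ a, ∀ s, f (M.coord (s, 0)) = M.coord (a - s, 0) := by
  have h : ∀ s, ∃ s', M.coord (s', 0) = f (M.coord (s, 0)) := fun s => by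
    apply M.exists_axis_eq
    have := congrArg (fun k => k (M.coord (s, 0))) hf.eq
    simp only [IsometryEquiv.mul_apply] at this
    rw [← this, M.refl_coord, neg_zero]
  choose u hu using h
  have hui : Isometry u := Isometry.of_dist_eq fun s t => by
    rw [← M.isometry_axis.dist_eq, hu, hu, f.dist_eq, M.isometry_axis.dist_eq]
  rcases real_isometry_cases hui with h | h
  · have key : ∀ s, ((M.trans (u 0))⁻¹ * f) (M.coord (s, 0)) = M.coord (s, 0) := fun s => by
      rw [IsometryEquiv.mul_apply, ← hu, h s, ← M.trans_coord, IsometryEquiv.inv_apply_self]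
    rcases M.eq_one_or_refl _ key with h' | h'
    · exact Or.inl ⟨u 0, (inv_mul_eq_one.1 h').symm⟩
    · exact Or.inr (Or.inl ⟨u 0, inv_mul_eq_iff_eq_mul.1 h'⟩)
  · exact Or.inr (Or.inr ⟨u 0, fun s => by rw [← hu, h]⟩)

theorem trans_mul_refl_not_mem (a : ℝ) : M.trans a * M.refl ∉ M.rot := fun h =>
  M.refl_not_mem ((Subgroup.mul_mem_cancel_left _ (M.trans_mem a)).1 h)

/-- The power `f ^ n` shifts the same line by `n * a`. This infinite order is used to rule out half
turns and exponent-two kernels. -/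
theorem pow_ne_one_of_shiftsLine {f : U ≃ᵢ U} (hf : ShiftsLine f) {n : ℕ} (hn : n ≠ 0) :
    f ^ n ≠ 1 := by
  obtain ⟨ℓ, hℓ, a, ha, h⟩ := hf
  have key : ∀ m : ℕ, (f ^ m) (ℓ 0) = ℓ (m * a) := by
    intro m
    induction m with
    | zero => simp
    | succ m ih => rw [pow_succ', IsometryEquiv.mul_apply, ih, h]; congr 1; push_cast; ring
  intro h1
  have := key n
  rw [h1] at this
  have := hℓ.injective this
  rcases mul_eq_zero.1 this.symm with h | h
  · exact hn (by exact_mod_cast h)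
  · exact ha h

/-- A translation that commutes with a reflection is a translation along its axis. -/
theorem eq_trans_of_isTranslation {f : U ≃ᵢ U} (hf : IsTranslation f) (hc : Commute f M.refl) :
    ∃ a, a ≠ 0 ∧ f = M.trans a := by
  rcases M.axis_cases hc with ⟨a, rfl⟩ | ⟨a, rfl⟩ | ⟨a, h⟩
  · refine ⟨a, ?_, rfl⟩
    rintro rfl
    exact pow_ne_one_of_shiftsLine hf.2 one_ne_zero (by rw [M.trans_zero, one_pow])
  · exact absurd (M.mem_rot_of_isOrientationPreserving hf.1) (M.trans_mul_refl_not_mem a)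
  -- If `f` reversed the axis, `f ^ 2` would fix it pointwise, hence be `1` or the reflection, and
  -- `f` would have finite order.
  · exfalso
    have h2 : ∀ s, (f ^ 2) (M.coord (s, 0)) = M.coord (s, 0) := fun s => by
      rw [pow_two, IsometryEquiv.mul_apply, h, h, sub_sub_cancel]
    have h4 : f ^ 4 = 1 := by
      rw [show 4 = 2 * 2 from rfl, pow_mul]
      rcases M.eq_one_or_refl _ h2 with h | h
      · rw [h, one_pow]
      · rw [h, pow_two, M.refl_mul_refl]
    exact pow_ne_one_of_shiftsLine hf.2 four_ne_zero h4

end FermiPlane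

/-! ### Surface groups are torsion-free -/

namespace NSK

section Torsion

open FreeGroup (of lift)

/-- Generators of the kernel of the homomorphism from the surface group to `ℤ`. -/
abbrev CoverGroup (m : ℕ) : Type := FreeGroup (Option (Fin m × ℤ))

/-- The product of the squares at level `n`. -/
def levelWord (m : ℕ) (n : ℤ) : CoverGroup m :=
  (List.ofFn fun j : Fin m => of (some (j, n)) ^ 2).prod

/-- A generator of the deck transformations of the infinite cyclic cover. -/
def deckHom (m : ℕ) : CoverGroup m →* CoverGroup m :=
  -- With `t = d_1⁻¹` for the second generator, `none` stands for `a = d_0 d_1` and `some (j, n)`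
  -- for the conjugate of `d_{j+2}` by `t ^ n`. The surface relation reads `a * (t * a * t⁻¹) * w =
  -- 1` with `w = levelWord m 0`, so conjugation by `t` takes `a` to `a⁻¹ * w⁻¹`.
  lift fun o => o.elim ((of none)⁻¹ * (levelWord m 0)⁻¹) fun p => of (some (p.1, p.2 + 1))

/-- The inverse of `deckHom`. -/
def deckHomInv (m : ℕ) : CoverGroup m →* CoverGroup m :=
  lift fun o => o.elim ((levelWord m (-1))⁻¹ * (of none)⁻¹) fun p => of (some (p.1, p.2 - 1))

theorem deckHom_levelWord (m : ℕ) (n : ℤ) :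
    deckHom m (levelWord m n) = levelWord m (n + 1) := by
  simp [levelWord, map_list_prod, List.map_ofFn, Function.comp_def, deckHom]

theorem deckHomInv_levelWord (m : ℕ) (n : ℤ) :
    deckHomInv m (levelWord m n) = levelWord m (n - 1) := by
  simp [levelWord, map_list_prod, List.map_ofFn, Function.comp_def, deckHomInv]

theorem deckHom_none (m : ℕ) :
    deckHom m (of none) = (of none)⁻¹ * (levelWord m 0)⁻¹ := by
  simp [deckHom]

theorem deckHomInv_none (m : ℕ) :
    deckHomInv m (of none) = (levelWord m (-1))⁻¹ * (of none)⁻¹ := by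
  simp [deckHomInv]

/-- The deck transformation as an automorphism. -/
def deck (m : ℕ) : MulAut (CoverGroup m) :=
  MonoidHom.toMulEquiv (deckHom m) (deckHomInv m)
    (by
      ext o
      rcases o with _ | ⟨j, n⟩
      · simp [deckHom_none, deckHomInv_none, deckHomInv_levelWord]
      · simp [deckHom, deckHomInv])
    (by
      ext o
      rcases o with _ | ⟨j, n⟩
      · simp [deckHom_none, deckHomInv_none, deckHom_levelWord]
      · simp [deckHom, deckHomInv])

/-- The compatibility required for a homomorphism out of a semidirect product with ℤ follows from
the case of the generator. -/
theorem map_zpow_mulAut {G H : Type*} [Group G] [Group H] (f : G →* H) (φ : MulAut G) (t : H)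
    (h : ∀ x, f (φ x) = t * f x * t⁻¹) (n : ℤ) (x : G) :
    f ((φ ^ n) x) = t ^ n * f x * (t ^ n)⁻¹ := by
  induction n using Int.induction_on generalizing x with
  | zero => simp
  | succ i ih =>
    rw [zpow_add_one, zpow_add_one, MulAut.mul_apply, ih, h]
    group
  | pred i ih =>
    have h' : f (φ⁻¹ x) = t⁻¹ * f x * t := by
      have := h (φ⁻¹ x)
      rw [MulAut.apply_inv_self] at this
      rw [this]; group
    rw [zpow_sub_one, zpow_sub_one, MulAut.mul_apply, ih, h']
    group

/-- The surface group embeds in an extension of `ℤ` by a free group. -/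
abbrev CyclicExtension (m : ℕ) : Type :=
  CoverGroup m ⋊[zpowersHom (MulAut (CoverGroup m)) (deck m)] Multiplicative ℤ

/-- The quotient ℤ is torsion-free, so a torsion element lies in the free group, which is
torsion-free as well. -/
theorem eq_one_of_pow_eq_one_cyclicExtension (m : ℕ) (x : CyclicExtension m) {n : ℕ} (hn : n ≠ 0)
    (hx : x ^ n = 1) : x = 1 := by
  have h1 : x.right ^ n = 1 := by
    have := congrArg SemidirectProduct.rightHom hx
    rwa [map_pow, map_one] at this
  have h2 : x.right = 1 := pow_left_injective hn (h1.trans (one_pow n).symm)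
  have h3 : x = SemidirectProduct.inl x.left := by
    conv_lhs => rw [← SemidirectProduct.inl_left_mul_inr_right x, h2]
    simp
  rw [h3, ← map_pow, ← map_one SemidirectProduct.inl,
    SemidirectProduct.inl_injective.eq_iff] at hx
  rw [h3, show x.left = 1 from pow_left_injective hn (hx.trans (one_pow n).symm), map_one]

/-- The images of the generators of the surface group. -/
def toExtensionFun (m : ℕ) : Fin (m + 2) → CyclicExtension m :=
  Fin.cons (SemidirectProduct.inl (of none) * SemidirectProduct.inr (Multiplicative.ofAdd (1 : ℤ)))
    (Fin.cons (SemidirectProduct.inr (Multiplicative.ofAdd (1 : ℤ)))⁻¹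
      fun j => SemidirectProduct.inl (of (some (j, 0))))

theorem map_prod_sq {G : Type*} [Group G] {m : ℕ} (f : FreeGroup (Fin (m + 2)) →* G) :
    f (List.ofFn fun j : Fin (m + 2) => of j ^ 2).prod =
      f (of 0) ^ 2 * (f (of 1) ^ 2 * (List.ofFn fun j : Fin m => f (of j.succ.succ) ^ 2).prod) := by
  rw [map_list_prod, List.map_ofFn, List.ofFn_succ, List.ofFn_succ, List.prod_cons, List.prod_cons]
  simp

/-- The homomorphism from the surface group to the extension of `ℤ` by a free group. -/
def toExtension (m : ℕ) : SurfaceGroup (m + 2) →* CyclicExtension m :=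
  PresentedGroup.toGroup (f := toExtensionFun m) (by
    rintro _ rfl
    have hw : (List.ofFn fun j : Fin m => toExtensionFun m j.succ.succ ^ 2).prod =
        SemidirectProduct.inl (levelWord m 0) := by
      simp [levelWord, map_list_prod, List.map_ofFn, Function.comp_def, toExtensionFun]
    have hd : SemidirectProduct.inr (Multiplicative.ofAdd (1 : ℤ)) * SemidirectProduct.inl (of none) *
        (SemidirectProduct.inr (Multiplicative.ofAdd (1 : ℤ)))⁻¹ =
        (SemidirectProduct.inl ((of none)⁻¹ * (levelWord m 0)⁻¹) : CyclicExtension m) := by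
      rw [← map_inv, ← SemidirectProduct.inl_aut]
      congr 1
      rw [← deckHom_none]
      simp [deck]
    rw [map_prod_sq]
    simp only [FreeGroup.lift_apply_of]
    rw [hw]
    change (SemidirectProduct.inl (of none) *
      SemidirectProduct.inr (Multiplicative.ofAdd (1 : ℤ))) ^ 2 *
      ((SemidirectProduct.inr (Multiplicative.ofAdd (1 : ℤ)))⁻¹ ^ 2 * _) = 1
    generalize (SemidirectProduct.inr (Multiplicative.ofAdd (1 : ℤ)) : CyclicExtension m) = t at hd ⊢
    rw [map_mul, map_inv, map_inv] at hd
    generalize (SemidirectProduct.inl (of none) : CyclicExtension m) = a at hd ⊢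
    generalize (SemidirectProduct.inl (levelWord m 0) : CyclicExtension m) = w at hd ⊢
    have : (a * t) ^ 2 * (t⁻¹ ^ 2 * w) = a * (t * a * t⁻¹) * w := by
      rw [pow_two, pow_two]; group
    rw [this, hd]
    group)

/-- The left inverse `Θ` sends the free generators to the elements of the surface group that they
stand for and the generator of ℤ to `(d 1)⁻¹`. -/
theorem toExtension_injective (m : ℕ) : Function.Injective (toExtension m) := by
  let d : Fin (m + 2) → SurfaceGroup (m + 2) := PresentedGroup.of
  let f₁ : CoverGroup m →* SurfaceGroup (m + 2) := lift fun o => o.elim (d 0 * d 1)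
    fun p => (d 1)⁻¹ ^ p.2 * d p.1.succ.succ * ((d 1)⁻¹ ^ p.2)⁻¹
  have hrel : d 0 ^ 2 * (d 1 ^ 2 * (List.ofFn fun j : Fin m => d j.succ.succ ^ 2).prod) = 1 :=
    (map_prod_sq _).symm.trans (PresentedGroup.one_of_mem
      (rels := {(List.ofFn fun j : Fin (m + 2) => FreeGroup.of j ^ 2).prod}) rfl)
  have hcompat : ∀ x, f₁ (deck m x) = (d 1)⁻¹ * f₁ x * (d 1)⁻¹⁻¹ := by
    intro x
    suffices H : f₁.comp (deckHom m) = (MulAut.conj (d 1)⁻¹).toMonoidHom.comp f₁ from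
      DFunLike.congr_fun H x
    ext o
    rcases o with _ | ⟨j, n⟩
    · have hw : f₁ (levelWord m 0) = (List.ofFn fun j : Fin m => d j.succ.succ ^ 2).prod := by
        simp [levelWord, map_list_prod, List.map_ofFn, Function.comp_def, f₁]
      have h0 : f₁ (of none) = d 0 * d 1 := by simp [f₁]
      rw [MonoidHom.comp_apply, deckHom_none, map_mul, map_inv, map_inv, h0, hw]
      simp only [MonoidHom.comp_apply, h0, MulEquiv.coe_toMonoidHom, MulAut.conj_apply]
      generalize (List.ofFn fun j : Fin m => d j.succ.succ ^ 2).prod = w at hrel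
      have : w⁻¹ = d 0 ^ 2 * d 1 ^ 2 := by
        rw [← mul_assoc] at hrel
        exact (eq_inv_of_mul_eq_one_left hrel).symm
      rw [this, pow_two, pow_two]
      group
    · simp [f₁, deckHom, zpow_add]
      group
  let Θ : CyclicExtension m →* SurfaceGroup (m + 2) :=
    SemidirectProduct.lift f₁ (zpowersHom _ (d 1)⁻¹) (by
      intro n
      ext1 x
      exact map_zpow_mulAut f₁ (deck m) _ hcompat n.toAdd _)
  have hΘ : Θ.comp (toExtension m) = MonoidHom.id _ := by
    ext j
    refine Fin.cases ?_ (fun j => Fin.cases ?_ (fun j => ?_) j) j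
    · simp [Θ, toExtension, toExtensionFun, f₁, d]
    · simp [Θ, toExtension, toExtensionFun, d]
    · simp [Θ, toExtension, toExtensionFun, f₁, d]
  exact Function.LeftInverse.injective (g := Θ) fun x => DFunLike.congr_fun hΘ x

/-- The fundamental group of the projective plane has exponent two, the other ones are
torsion-free. -/
theorem surfaceGroup_torsion {g : ℕ} (hg : 1 ≤ g) : (∀ y : SurfaceGroup g, y ^ 2 = 1) ∨
    ∀ (y : SurfaceGroup g) (n : ℕ), n ≠ 0 → y ^ n = 1 → y = 1 := by
  obtain rfl | ⟨m, rfl⟩ : g = 1 ∨ ∃ m, g = m + 2 := by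
    rcases g with _ | _ | m
    · omega
    · exact Or.inl rfl
    · exact Or.inr ⟨m, rfl⟩
  · left
    intro y
    have hrel : (PresentedGroup.of 0 : SurfaceGroup 1) ^ 2 = 1 := by
      refine Eq.trans ?_ (PresentedGroup.one_of_mem
        (rels := {(List.ofFn fun j : Fin 1 => FreeGroup.of j ^ 2).prod}) rfl)
      rw [map_list_prod, List.map_ofFn, List.ofFn_succ, List.prod_cons]
      simp [PresentedGroup.of]
    have hy : y ∈ Subgroup.closure (Set.range (PresentedGroup.of : Fin 1 → SurfaceGroup 1)) := by
      rw [PresentedGroup.closure_range_of]; trivial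
    rw [Set.range_unique, Subgroup.mem_closure_singleton] at hy
    obtain ⟨n, rfl⟩ := hy
    rw [← zpow_natCast, zpow_comm]
    have : (PresentedGroup.of (default : Fin 1) : SurfaceGroup 1) ^ ((2 : ℕ) : ℤ) = 1 := by
      rw [zpow_natCast]; exact hrel
    rw [this, one_zpow]
  · right
    intro y n hn hy
    apply toExtension_injective m
    rw [map_one]
    exact eq_one_of_pow_eq_one_cyclicExtension m _ hn (by rw [← map_pow, hy, map_one])

end Torsion

end NSK

/-! ### Involutions in semidirect products with free products of groups of order two -/

namespace ReducedWord

variable {G : Type*}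

/-- Reduced words in a set of involutions. -/
abbrev Red (R : Set G) : Type _ := {l : List G // (∀ t ∈ l, t ∈ R) ∧ l.IsChain (· ≠ ·)}

/-- The empty word. -/
def empty (R : Set G) : Red R := ⟨[], by simp, List.isChain_nil⟩

open Classical in
/-- Left multiplication of a reduced word by an involution. -/
noncomputable def toggleList (t : G) : List G → List G
  | [] => [t]
  | s :: l => if s = t then l else t :: s :: l

theorem toggleList_mem {R : Set G} {t : G} (ht : t ∈ R) {l : List G}
    (hl : (∀ s ∈ l, s ∈ R) ∧ l.IsChain (· ≠ ·)) :
    (∀ s ∈ toggleList t l, s ∈ R) ∧ (toggleList t l).IsChain (· ≠ ·) := by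
  rcases l with _ | ⟨s, l⟩
  · simp [toggleList, ht]
  · by_cases h : s = t
    · simp only [toggleList, if_pos h]
      exact ⟨fun u hu => hl.1 u (List.mem_cons_of_mem _ hu), hl.2.tail⟩
    · simp only [toggleList, if_neg h]
      refine ⟨fun u hu => ?_, List.IsChain.cons_cons (Ne.symm h) hl.2⟩
      rcases List.mem_cons.1 hu with rfl | hu
      · exact ht
      · exact hl.1 u hu

theorem toggleList_toggleList (t : G) {l : List G} (hl : l.IsChain (· ≠ ·)) :
    toggleList t (toggleList t l) = l := by
  rcases l with _ | ⟨s, l⟩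
  · simp [toggleList]
  · by_cases h : s = t
    · subst h
      simp only [toggleList, if_true]
      rcases l with _ | ⟨u, l⟩
      · rfl
      · have : u ≠ s := (List.isChain_cons_cons.1 hl).1.symm
        simp [this]
    · simp [toggleList, h]

theorem toggleList_cons {t : G} {l : List G} (hl : (t :: l).IsChain (· ≠ ·)) :
    toggleList t l = t :: l := by
  rcases l with _ | ⟨u, l⟩
  · rfl
  · have : u ≠ t := (List.isChain_cons_cons.1 hl).1.symm
    simp [toggleList, this]

/-- Left multiplication by an involution as a permutation of the reduced words. -/
noncomputable def toggle {R : Set G} (t : G) (ht : t ∈ R) : Equiv.Perm (Red R) :=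
  Function.Involutive.toPerm (fun l => ⟨toggleList t l.1, toggleList_mem ht l.2⟩)
    fun l => Subtype.ext (toggleList_toggleList t l.2.2)

theorem toggle_mul_self {R : Set G} (t : G) (ht : t ∈ R) : toggle t ht * toggle t ht = 1 := by
  ext1 l
  exact (Function.Involutive.toPerm_involutive _) l

variable [Group G]

/-- The letterwise conjugation. -/
def conjList (a : G) (l : List G) : List G := l.map fun t => a * t * a⁻¹

theorem conj_injective (a : G) : Function.Injective fun t => a * t * a⁻¹ := fun x y h => by
  simpa using h

theorem toggleList_conjList (a t : G) (l : List G) :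
    conjList a (toggleList t l) = toggleList (a * t * a⁻¹) (conjList a l) := by
  rcases l with _ | ⟨s, l⟩
  · rfl
  · by_cases h : s = t
    · simp [conjList, toggleList, h]
    · simp [conjList, toggleList, h]

theorem prod_conjList (a : G) (l : List G) : (conjList a l).prod = a * l.prod * a⁻¹ := by
  induction l with
  | nil => simp [conjList]
  | cons s l ih =>
    have : (conjList a (s :: l)).prod = a * s * a⁻¹ * (conjList a l).prod := by simp [conjList]
    rw [this, ih, List.prod_cons]
    group

theorem conjList_mem {R : Set G} {a : G} (ha : ∀ t ∈ R, a * t * a⁻¹ ∈ R) {l : List G}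
    (hl : (∀ s ∈ l, s ∈ R) ∧ l.IsChain (· ≠ ·)) :
    (∀ s ∈ conjList a l, s ∈ R) ∧ (conjList a l).IsChain (· ≠ ·) := by
  refine ⟨fun s hs => ?_, ?_⟩
  · obtain ⟨t, ht, rfl⟩ := List.mem_map.1 hs
    exact ha t (hl.1 t ht)
  · rw [conjList, List.isChain_map]
    exact hl.2.imp fun x y h h' => h (conj_injective a h')

/-- The action of a group by letterwise conjugation. -/
def conjPerm {R : Set G} {A : Subgroup G} (hA : ∀ a ∈ A, ∀ t ∈ R, a * t * a⁻¹ ∈ R) :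
    A →* Equiv.Perm (Red R) where
  toFun a :=
    { toFun := fun l => ⟨conjList a l.1, conjList_mem (hA a a.2) l.2⟩
      invFun := fun l => ⟨conjList a⁻¹ l.1, conjList_mem (hA _ (inv_mem a.2)) l.2⟩
      left_inv := fun l => by
        apply Subtype.ext
        simp only [conjList, List.map_map]
        convert List.map_id _ using 2
        funext t
        simp only [Function.comp_apply, id]
        group
      right_inv := fun l => by
        apply Subtype.ext
        simp only [conjList, List.map_map]
        convert List.map_id _ using 2
        funext t
        simp only [Function.comp_apply, id]
        group }
  map_one' := by
    ext1 l
    apply Subtype.ext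
    simp [conjList]
  map_mul' a b := by
    ext1 l
    apply Subtype.ext
    simp [conjList, Function.comp_def, mul_assoc]

theorem conjPerm_mul_toggle {R : Set G} {A : Subgroup G}
    (hA : ∀ a ∈ A, ∀ t ∈ R, a * t * a⁻¹ ∈ R) (a : A) (t : G) (ht : t ∈ R) :
    conjPerm hA a * toggle t ht = toggle (a * t * a⁻¹) (hA a a.2 t ht) * conjPerm hA a := by
  ext1 l
  exact Subtype.ext (toggleList_conjList _ _ _)

/-- `ψ` is the action of the semidirect product on reduced words. -/
structure IsWordAction (R : Set G) (A : Subgroup G) (hA : ∀ a ∈ A, ∀ t ∈ R, a * t * a⁻¹ ∈ R)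
    (ψ : G →* Equiv.Perm (Red R)) : Prop where
  letter : ∀ t (ht : t ∈ R), ψ t = toggle t ht
  conj : ∀ a (ha : a ∈ A), ψ a = conjPerm hA ⟨a, ha⟩

variable {R : Set G} {A : Subgroup G} {hA : ∀ a ∈ A, ∀ t ∈ R, a * t * a⁻¹ ∈ R}
  {ψ : G →* Equiv.Perm (Red R)}

/-- This is the uniqueness of normal forms: elements of `A` fix the empty word, and the letters of
`l` then rebuild `l`, so the group element determines `l`. -/
theorem IsWordAction.apply_empty (hψ : IsWordAction R A hA ψ) {a : G} (ha : a ∈ A) (l : Red R) :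
    ψ (l.1.prod * a) (empty R) = l := by
  obtain ⟨l, hl⟩ := l
  induction l with
  | nil =>
    rw [List.prod_nil, one_mul, hψ.conj a ha]
    rfl
  | cons t l ih =>
    have hl' : (∀ t ∈ l, t ∈ R) ∧ l.IsChain (· ≠ ·) :=
      ⟨fun s hs => hl.1 s (List.mem_cons_of_mem _ hs), hl.2.tail⟩
    rw [List.prod_cons, mul_assoc, map_mul, Equiv.Perm.mul_apply, ih hl',
      hψ.letter t (hl.1 t List.mem_cons_self)]
    exact Subtype.ext (toggleList_cons hl.2)

theorem toggleList_prod (t : G) (ht : t * t = 1) (l : List G) :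
    (toggleList t l).prod = t * l.prod := by
  rcases l with _ | ⟨s, l⟩
  · rfl
  · by_cases h : s = t
    · subst h
      simp only [toggleList, if_true, List.prod_cons]
      rw [← mul_assoc, ht, one_mul]
    · simp [toggleList, h]

/-- Existence of normal forms: the set of elements of this shape is stable under left multiplication
by letters, which toggle the word, and by elements of `A`, which conjugate it. -/
theorem exists_prod_mul_eq (hA : ∀ a ∈ A, ∀ t ∈ R, a * t * a⁻¹ ∈ R) (hR : ∀ t ∈ R, t * t = 1)
    {g : G} (hg : g ∈ Subgroup.closure (R ∪ A)) :
    ∃ l : Red R, ∃ a ∈ A, g = l.1.prod * a := by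
  have hinv : ∀ t ∈ R, t⁻¹ = t := fun t ht => inv_eq_of_mul_eq_one_left (hR t ht)
  have key : ∀ s ∈ R ∪ (A : Set G), ∀ y, (∃ l : Red R, ∃ a ∈ A, y = l.1.prod * a) →
      ∃ l : Red R, ∃ a ∈ A, s * y = l.1.prod * a := by
    rintro s (hs | hs) y ⟨l, a, ha, rfl⟩
    · exact ⟨⟨_, toggleList_mem hs l.2⟩, a, ha, by
        rw [toggleList_prod s (hR s hs), mul_assoc]⟩
    · refine ⟨⟨_, conjList_mem (hA s hs) l.2⟩, s * a, mul_mem hs ha, ?_⟩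
      rw [prod_conjList]
      group
  induction hg using Subgroup.closure_induction_left with
  | one => exact ⟨empty R, 1, one_mem _, by simp [empty]⟩
  | mul_left s hs y _ ih => exact key s hs y ih
  | inv_mul_cancel s hs y _ ih =>
    refine key s⁻¹ ?_ y ih
    rcases hs with hs | hs
    · exact Or.inl (by rwa [hinv s hs])
    · exact Or.inr (inv_mem hs)

theorem reverse_prod (hR : ∀ t ∈ R, t * t = 1) {l : List G} (hl : ∀ t ∈ l, t ∈ R) :
    l.reverse.prod = l.prod⁻¹ := by
  rw [List.prod_inv_reverse, List.map_congr_left (g := id), List.map_id]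
  exact fun t ht => inv_eq_of_mul_eq_one_left (hR t (hl t ht))

/-- A palindromic word is conjugate to its middle. -/
theorem exists_conj_of_palindrome (hR : ∀ t ∈ R, t * t = 1) (a : G) (l : List G)
    (hl : ∀ t ∈ l, t ∈ R) (h : conjList a l = l.reverse) :
    ∃ x, x⁻¹ * (l.prod * a) * x = a ∨ ∃ t ∈ R, Commute a t ∧ x⁻¹ * (l.prod * a) * x = t * a := by
  induction l using List.bidirectionalRec with
  | nil => exact ⟨1, Or.inl (by simp)⟩
  | singleton t =>
    refine ⟨1, Or.inr ⟨t, hl t (by simp), ?_, by simp⟩⟩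
    have : a * t * a⁻¹ = t := by simpa [conjList] using h
    rw [mul_inv_eq_iff_eq_mul] at this
    exact this
  | cons_append s m t ih =>
    have hs : s * s = 1 := hR s (hl s (by simp))
    have ht : t * t = 1 := hR t (hl t (by simp))
    have h' : (a * s * a⁻¹) :: (conjList a m ++ [a * t * a⁻¹]) = t :: (m.reverse ++ [s]) := by
      simpa [conjList] using h
    rw [List.cons.injEq] at h'
    obtain ⟨h1, h2⟩ := h'
    have h3 : conjList a m = m.reverse := (List.append_inj' h2 rfl).1
    obtain ⟨x, hx⟩ := ih (fun u hu => hl u (by simp [hu])) h3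
    -- Conjugation by the first letter moves it to the end, where it crosses `a`, becomes `t`
    -- because `a * s * a⁻¹ = t`, and cancels the last letter.
    refine ⟨s * x, ?_⟩
    have e : (s * x)⁻¹ * ((s :: (m ++ [t])).prod * a) * (s * x) = x⁻¹ * (m.prod * a) * x := by
      have e1 : a * s = t * a := by rw [← h1]; group
      calc (s * x)⁻¹ * ((s :: (m ++ [t])).prod * a) * (s * x)
          = x⁻¹ * (m.prod * t * (a * s)) * x := by
            simp only [List.prod_cons, List.prod_append, List.prod_nil]; group
        _ = x⁻¹ * (m.prod * (t * t) * a) * x := by rw [e1]; group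
        _ = _ := by rw [ht]; group
    rw [e]
    exact hx

/-- Every involution of the semidirect product is conjugate to an involution of the complement, or
to the product of such an involution with a commuting letter. -/
theorem IsWordAction.involution_cases (hψ : IsWordAction R A hA ψ) (hR : ∀ t ∈ R, t * t = 1)
    {g : G} (hg : g ∈ Subgroup.closure (R ∪ A)) (hgg : g * g = 1) :
    ∃ x, ∃ a ∈ A, a * a = 1 ∧ (x⁻¹ * g * x = a ∨
      ∃ t ∈ R, Commute a t ∧ x⁻¹ * g * x = t * a) := by
  obtain ⟨l, a, ha, rfl⟩ := exists_prod_mul_eq hA hR hg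
  let l₁ : Red R := ⟨_, conjList_mem (hA a ha) l.2⟩
  let l₂ : Red R := ⟨l.1.reverse, fun t ht => l.2.1 t (List.mem_reverse.1 ht), by
    rw [List.isChain_reverse]
    exact l.2.2.imp fun x y h => h.symm⟩
  -- Both sides are normal forms of the same element, by `(l * a)² = 1`. Uniqueness gives `a * a =
  -- 1` and says that conjugation by `a` reverses the word `l`.
  have e1 : l₁.1.prod * (a * a) = l₂.1.prod * 1 := by
    have h2 : l₂.1.prod = l.1.prod⁻¹ := reverse_prod hR l.2.1
    have h1 : l₁.1.prod = a * l.1.prod * a⁻¹ := prod_conjList a l.1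
    rw [h1, h2, mul_one, eq_inv_iff_mul_eq_one]
    have : l.1.prod⁻¹ * (l.1.prod * a * (l.1.prod * a)) * l.1.prod = 1 := by
      rw [hgg]; group
    rw [← this]; group
  have e2 : l₁ = l₂ := by
    rw [← hψ.apply_empty (mul_mem ha ha) l₁, e1, hψ.apply_empty (one_mem _)]
  rw [e2, mul_right_inj] at e1
  obtain ⟨x, hx⟩ := exists_conj_of_palindrome hR a l.1 l.2.1 (congrArg Subtype.val e2)
  exact ⟨x, a, ha, e1, hx⟩

section Generators

variable {ι : Type*} (gen : ι → G) (L S : Set ι)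

/-- The subgroup generated by the generators in `S`. -/
def complement : Subgroup G := Subgroup.closure (gen '' S)

/-- The conjugates of the generators in `L` by the subgroup generated by `S`. -/
def letters : Set G := {t | ∃ a ∈ complement gen S, ∃ s ∈ L, t = a * gen s * a⁻¹}

theorem gen_mem_complement {s : ι} (hs : s ∈ S) : gen s ∈ complement gen S :=
  Subgroup.subset_closure ⟨s, hs, rfl⟩

theorem gen_mem_letters {s : ι} (hs : s ∈ L) : gen s ∈ letters gen L S :=
  ⟨1, one_mem _, s, hs, by simp⟩

theorem letters_conj : ∀ a ∈ complement gen S, ∀ t ∈ letters gen L S,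
    a * t * a⁻¹ ∈ letters gen L S := by
  rintro a ha _ ⟨b, hb, s, hs, rfl⟩
  exact ⟨a * b, mul_mem ha hb, s, hs, by group⟩

theorem letters_mul_self (h : ∀ s ∈ L, gen s * gen s = 1) :
    ∀ t ∈ letters gen L S, t * t = 1 := by
  rintro _ ⟨b, hb, s, hs, rfl⟩
  have : b * gen s * b⁻¹ * (b * gen s * b⁻¹) = b * (gen s * gen s) * b⁻¹ := by group
  rw [this, h s hs]
  group

variable {gen L S}

/-- A letter is a conjugate of a generator by the complement, and `conjPerm_mul_toggle` says that
toggles transform in the same way, so the generators decide. -/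
theorem isWordAction_of_gen {ψ : G →* Equiv.Perm (Red (letters gen L S))}
    (h1 : ∀ s (hs : s ∈ L), ψ (gen s) = toggle (gen s) (gen_mem_letters gen L S hs))
    (h2 : ∀ s (hs : s ∈ S), ψ (gen s) =
      conjPerm (letters_conj gen L S) ⟨gen s, gen_mem_complement gen S hs⟩) :
    IsWordAction (letters gen L S) (complement gen S) (letters_conj gen L S) ψ := by
  have hc : ∀ a (ha : a ∈ complement gen S), ψ a = conjPerm (letters_conj gen L S) ⟨a, ha⟩ := by
    intro a ha
    induction ha using Subgroup.closure_induction with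
    | mem x hx =>
      obtain ⟨s, hs, rfl⟩ := hx
      exact h2 s hs
    | one => rw [map_one]; exact (map_one _).symm
    | mul x y hx hy ihx ihy =>
      rw [map_mul, ihx, ihy, ← map_mul]
      rfl
    | inv x hx ihx =>
      rw [map_inv, ihx, ← map_inv]
      rfl
  refine ⟨?_, hc⟩
  rintro _ ⟨a, ha, s, hs, rfl⟩
  rw [map_mul, map_mul, map_inv, h1 s hs, hc a ha, mul_inv_eq_iff_eq_mul, conjPerm_mul_toggle]
  rfl

end Generators

end ReducedWord

/-! ### Consequences of the presentation -/

namespace NEC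

open CanonicalGen ReducedWord

variable {h r k : ℕ} {ε : Sign}

/-! ### Evaluation of the relators. -/

section Words

variable {M : Type*} [Group M]

theorem lift_longRelator (f : CanonicalGen h r k ε → M) :
    FreeGroup.lift f (longRelator h r k ε) = (List.ofFn fun j : Fin r => f (x j)).prod *
      (List.ofFn fun i : Fin k => f (e i)).prod * FreeGroup.lift f (handleWord h r k ε) := by
  simp [longRelator, map_list_prod, List.map_ofFn, Function.comp_def]

theorem lift_handleWord_congr {f f' : CanonicalGen h r k ε → M}
    (hf : ∀ s, (∀ j, s ≠ x j) → (∀ i, s ≠ e i) → (∀ i, s ≠ c i) → f s = f' s) :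
    FreeGroup.lift f (handleWord h r k ε) = FreeGroup.lift f' (handleWord h r k ε) := by
  cases ε with
  | plus =>
    have ha : ∀ j, f (a j) = f' (a j) := fun j => hf _ (by simp) (by simp) (by simp)
    have hb : ∀ j, f (b j) = f' (b j) := fun j => hf _ (by simp) (by simp) (by simp)
    simp [handleWord, map_list_prod, List.map_ofFn, Function.comp_def, ha, hb]
  | minus =>
    have hd : ∀ j, f (d j) = f' (d j) := fun j => hf _ (by simp) (by simp) (by simp)
    simp [handleWord, map_list_prod, List.map_ofFn, Function.comp_def, hd]

theorem lift_longRelator_congr {f f' : CanonicalGen h r k ε → M}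
    (hf : ∀ s, (∀ i, s ≠ c i) → f s = f' s) :
    FreeGroup.lift f (longRelator h r k ε) = FreeGroup.lift f' (longRelator h r k ε) := by
  have hx : ∀ j, f (x j) = f' (x j) := fun j => hf _ (by simp)
  have he : ∀ j, f (e j) = f' (e j) := fun j => hf _ (by simp)
  rw [lift_longRelator, lift_longRelator, lift_handleWord_congr fun s _ _ hs => hf s hs]
  simp [hx, he]

/-- The checklist for defining a homomorphism on the canonical generators, used with
`IsPresentation.exists_hom`. -/
theorem lift_relators_eq_one {f : CanonicalGen h r k ε → M} (hx : ∀ j, f (x j) * f (x j) = 1)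
    (hc : ∀ i, f (c i) * f (c i) = 1) (hce : ∀ i, Commute (f (c i)) (f (e i)))
    (hl : FreeGroup.lift f (longRelator h r k ε) = 1) :
    ∀ w ∈ relators h r k ε, FreeGroup.lift f w = 1 := by
  rintro w (((⟨j, rfl⟩ | ⟨i, rfl⟩) | ⟨i, rfl⟩) | rfl)
  · simpa [pow_two] using hx j
  · simpa [pow_two] using hc i
  · have := (hce i).eq
    simp only [map_mul, map_inv, FreeGroup.lift_apply_of]
    rw [mul_assoc, this]
    group
  · exact hl

open Classical in
/-- Change the value at the first `e` so that the long relation holds. -/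
noncomputable def solved (f : CanonicalGen h r (k + 1) ε → M) (s : CanonicalGen h r (k + 1) ε) : M :=
  if s = e 0 then (List.ofFn fun j : Fin r => f (x j)).prod⁻¹ *
    ((List.ofFn fun i : Fin k => f (e i.succ)).prod * FreeGroup.lift f (handleWord h r _ ε))⁻¹
  else f s

theorem solved_of_ne {f : CanonicalGen h r (k + 1) ε → M} {s : CanonicalGen h r (k + 1) ε}
    (hs : s ≠ e 0) : solved f s = f s := if_neg hs

theorem lift_solved_longRelator (f : CanonicalGen h r (k + 1) ε → M) :
    FreeGroup.lift (solved f) (longRelator h r (k + 1) ε) = 1 := by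
  have hx : ∀ j, solved f (x j) = f (x j) := fun j => solved_of_ne (by simp)
  have he : ∀ j : Fin k, solved f (e j.succ) = f (e j.succ) := fun j =>
    solved_of_ne (by simp [Fin.succ_ne_zero])
  rw [lift_longRelator, lift_handleWord_congr (f' := f) fun s _ hs _ => solved_of_ne (hs 0),
    List.ofFn_succ, List.prod_cons]
  simp only [hx, he]
  rw [solved, if_pos rfl]
  group

end Words

/-- `gen` generates `G` with the defining relators of the signature. -/
structure IsPresentation {G : Type*} [Group G] (gen : CanonicalGen h r k ε → G) : Prop where
  generates : Function.Surjective (FreeGroup.lift gen)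
  relations : (FreeGroup.lift gen).ker = Subgroup.normalClosure (relators h r k ε)

namespace IsPresentation

variable {G : Type*} [Group G]

section

variable {gen : CanonicalGen h r k ε → G}

theorem exists_hom (P : IsPresentation gen) {M : Type*} [Group M] (f : CanonicalGen h r k ε → M)
    (hf : ∀ w ∈ relators h r k ε, FreeGroup.lift f w = 1) :
    ∃ F : G →* M, ∀ s, F (gen s) = f s := by
  have hker : (FreeGroup.lift gen).ker ≤ (FreeGroup.lift f).ker := by
    rw [P.relations]
    exact Subgroup.normalClosure_le_normal fun w hw => hf w hw
  refine ⟨(FreeGroup.lift gen).liftOfSurjective P.generates ⟨FreeGroup.lift f, hker⟩, fun s => ?_⟩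
  have := (FreeGroup.lift gen).liftOfRightInverse_comp_apply _
    (Function.rightInverse_surjInv P.generates) ⟨FreeGroup.lift f, hker⟩ (FreeGroup.of s)
  simpa using this

theorem lift_eq_one (P : IsPresentation gen) {w : FreeGroup (CanonicalGen h r k ε)}
    (hw : w ∈ relators h r k ε) : FreeGroup.lift gen w = 1 := by
  have : w ∈ (FreeGroup.lift gen).ker := by
    rw [P.relations]; exact Subgroup.subset_normalClosure hw
  exact this

theorem x_mul_self (P : IsPresentation gen) (j : Fin r) : gen (x j) * gen (x j) = 1 := by
  have := P.lift_eq_one (w := FreeGroup.of (x j) ^ 2) (Or.inl (Or.inl (Or.inl ⟨j, rfl⟩)))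
  simpa [pow_two] using this

theorem c_mul_self (P : IsPresentation gen) (i : Fin k) : gen (c i) * gen (c i) = 1 := by
  have := P.lift_eq_one (w := FreeGroup.of (c i) ^ 2) (Or.inl (Or.inl (Or.inr ⟨i, rfl⟩)))
  simpa [pow_two] using this

theorem commute_c_e (P : IsPresentation gen) (i : Fin k) :
    Commute (gen (c i)) (gen (e i)) := by
  have := P.lift_eq_one
    (w := (FreeGroup.of (c i))⁻¹ * ((FreeGroup.of (e i))⁻¹ * FreeGroup.of (c i) * FreeGroup.of (e i)))
    (Or.inl (Or.inr ⟨i, rfl⟩))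
  simp only [map_mul, map_inv, FreeGroup.lift_apply_of] at this
  rw [inv_mul_eq_one, mul_assoc, eq_inv_mul_iff_mul_eq] at this
  exact this.symm

theorem lift_long (P : IsPresentation gen) :
    FreeGroup.lift gen (longRelator h r k ε) = 1 := P.lift_eq_one (Or.inr rfl)

theorem mem_closure (P : IsPresentation gen) (g : G) : g ∈ Subgroup.closure (Set.range gen) := by
  obtain ⟨w, rfl⟩ := P.generates g
  rw [← FreeGroup.range_lift_eq_closure]
  exact ⟨w, rfl⟩

-- The `c i` act as toggles and the other generators by conjugation. The long relator contains no `c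
-- i`, so it already holds in the complement; `c i` commutes with `e i`, so conjugation by `e i`
-- preserves its toggle.
open Classical in
theorem exists_action_c (P : IsPresentation gen) :
    ∃ ψ : G →* Equiv.Perm (Red (letters gen (Set.range c) (Set.range c)ᶜ)),
      IsWordAction _ (complement gen (Set.range c)ᶜ) (letters_conj gen _ _) ψ := by
  set L : Set (CanonicalGen h r k ε) := Set.range c with hL
  let f : CanonicalGen h r k ε → Equiv.Perm (Red (letters gen L Lᶜ)) := fun s =>
    if hs : s ∈ L then toggle (gen s) (gen_mem_letters gen L Lᶜ hs)
    else conjPerm (letters_conj gen L Lᶜ) ⟨gen s, gen_mem_complement gen Lᶜ hs⟩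
  have hfL : ∀ s (hs : s ∈ L), f s = toggle (gen s) (gen_mem_letters gen L Lᶜ hs) :=
    fun s hs => dif_pos hs
  have hfS : ∀ s (hs : s ∈ Lᶜ), f s =
      conjPerm (letters_conj gen L Lᶜ) ⟨gen s, gen_mem_complement gen Lᶜ hs⟩ :=
    fun s hs => dif_neg hs
  have hx : ∀ j, x j ∈ Lᶜ := fun j => by simp [L]
  have he : ∀ j, e j ∈ Lᶜ := fun j => by simp [L]
  have hc : ∀ i, c i ∈ L := fun i => ⟨i, rfl⟩
  obtain ⟨ψ, hψ⟩ := P.exists_hom f (lift_relators_eq_one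
    (fun j => by
      rw [hfS _ (hx j), ← map_mul, ← map_one (conjPerm (letters_conj gen L Lᶜ))]
      congr 1
      exact Subtype.ext (P.x_mul_self j))
    (fun i => by rw [hfL _ (hc i), toggle_mul_self])
    (fun i => by
      rw [hfL _ (hc i), hfS _ (he i)]
      refine Eq.symm ((conjPerm_mul_toggle _ _ _ _).trans ?_)
      congr 1
      have : gen (e i) * gen (c i) * (gen (e i))⁻¹ = gen (c i) := by
        rw [← (P.commute_c_e i).eq]; group
      change toggle (gen (e i) * gen (c i) * (gen (e i))⁻¹) _ = _
      simp only [this])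
    (by
      let fA : CanonicalGen h r k ε → complement gen Lᶜ := fun s =>
        if hs : s ∈ L then 1 else ⟨gen s, gen_mem_complement gen Lᶜ hs⟩
      have h1 : FreeGroup.lift fA (longRelator h r k ε) = 1 := by
        apply Subtype.ext
        have : (complement gen Lᶜ).subtype.comp (FreeGroup.lift fA) =
            FreeGroup.lift fun s => (fA s : G) := by ext s; simp
        refine (DFunLike.congr_fun this _).trans ?_
        rw [lift_longRelator_congr (f' := gen)]
        · exact P.lift_long
        · intro s hs
          have : s ∉ L := by rintro ⟨i, rfl⟩; exact hs i rfl
          simp [fA, this]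
      rw [lift_longRelator_congr (f' := fun s => conjPerm (letters_conj gen L Lᶜ) (fA s))]
      · have : FreeGroup.lift (fun s => conjPerm (letters_conj gen L Lᶜ) (fA s)) =
            (conjPerm (letters_conj gen L Lᶜ)).comp (FreeGroup.lift fA) := by ext1 s; simp
        rw [this, MonoidHom.comp_apply, h1, map_one]
      · intro s hs
        have : s ∉ L := by rintro ⟨i, rfl⟩; exact hs i rfl
        rw [hfS s this]
        simp only [fA, dif_neg this]))
  exact ⟨ψ, isWordAction_of_gen (fun s hs => by rw [hψ, hfL s hs])
    fun s hs => by rw [hψ, hfS s hs]⟩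

theorem mem_closure_c (P : IsPresentation gen) (g : G) : g ∈ Subgroup.closure
    (letters gen (Set.range c) (Set.range c)ᶜ ∪ complement gen (Set.range c)ᶜ) := by
  refine (Subgroup.closure_le _).2 ?_ (P.mem_closure g)
  rintro _ ⟨s, rfl⟩
  by_cases hs : s ∈ Set.range (c : Fin k → CanonicalGen h r k ε)
  · exact Subgroup.subset_closure (Or.inl (gen_mem_letters gen _ _ hs))
  · exact Subgroup.subset_closure (Or.inr (gen_mem_complement gen _ hs))

end

section

variable {gen : CanonicalGen h r (k + 1) ε → G}

/-- The generators that are neither reflections nor rotations nor the first `e`. -/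
def freeGens (h r k : ℕ) (ε : Sign) : Set (CanonicalGen h r (k + 1) ε) :=
  {s | (∀ j, s ≠ x j) ∧ (∀ i, s ≠ c i) ∧ s ≠ e 0}

-- This is the second layer of the decomposition: the `c i` act trivially and the `x j` as toggles.
-- The action of `e 0` is prescribed by the long relation, so the generators in `freeGens` are
-- unconstrained.
open Classical in
theorem exists_action_x (P : IsPresentation gen) :
    ∃ ψ : G →* Equiv.Perm (Red (letters gen (Set.range x) (freeGens h r k ε))),
      IsWordAction _ (complement gen (freeGens h r k ε)) (letters_conj gen _ _) ψ := by
  set L : Set (CanonicalGen h r (k + 1) ε) := Set.range x with hL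
  set S := freeGens h r k ε with hS
  let f₀ : CanonicalGen h r (k + 1) ε → Equiv.Perm (Red (letters gen L S)) := fun s =>
    if hs : s ∈ L then toggle (gen s) (gen_mem_letters gen L S hs)
    else if hs' : s ∈ S then conjPerm (letters_conj gen L S) ⟨gen s, gen_mem_complement gen S hs'⟩
    else 1
  have hfL : ∀ s (hs : s ∈ L), solved f₀ s = toggle (gen s) (gen_mem_letters gen L S hs) := by
    intro s hs
    rw [solved_of_ne]
    · exact dif_pos hs
    · rintro rfl; obtain ⟨j, hj⟩ := hs; simp at hj
  have hfS : ∀ s (hs : s ∈ S), solved f₀ s =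
      conjPerm (letters_conj gen L S) ⟨gen s, gen_mem_complement gen S hs⟩ := by
    intro s hs
    have h1 : s ∉ L := by rintro ⟨j, rfl⟩; exact hs.1 j rfl
    rw [solved_of_ne hs.2.2]
    simp only [f₀, dif_neg h1, dif_pos hs]
  have hfc : ∀ i, solved f₀ (c i) = 1 := by
    intro i
    have h1 : c i ∉ L := by simp [L]
    have h2 : c i ∉ S := fun hs => hs.2.1 i rfl
    rw [solved_of_ne (by simp)]
    simp only [f₀, dif_neg h1, dif_neg h2]
  obtain ⟨ψ, hψ⟩ := P.exists_hom (solved f₀) (lift_relators_eq_one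
    (fun j => by rw [hfL _ ⟨j, rfl⟩, toggle_mul_self])
    (fun i => by rw [hfc, mul_one])
    (fun i => by rw [hfc]; exact Commute.one_left _)
    (lift_solved_longRelator f₀))
  exact ⟨ψ, isWordAction_of_gen (fun s hs => by rw [hψ, hfL s hs])
    fun s hs => by rw [hψ, hfS s hs]⟩

/-- The long relation expresses `e 0` through the generators other than `e 0` and the `c i`. -/
theorem e_zero_mem (P : IsPresentation gen) (H : Subgroup G)
    (hH : ∀ s, (∀ i, s ≠ c i) → s ≠ e 0 → gen s ∈ H) : gen (e 0) ∈ H := by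
  classical
  let f : CanonicalGen h r (k + 1) ε → H := fun s =>
    if hs : gen s ∈ H then ⟨gen s, hs⟩ else 1
  have hf : ∀ s, (∀ i, s ≠ c i) → s ≠ e 0 → ((f s : H) : G) = gen s := fun s hs hs' => by
    simp only [f, dif_pos (hH s hs hs')]
  have hf' : ∀ s, (∀ i, s ≠ c i) → s ≠ e 0 → ((solved f s : H) : G) = gen s := fun s hs hs' => by
    rw [solved_of_ne hs', hf s hs hs']
  have h1 : FreeGroup.lift (fun s => (solved f s).1) (longRelator h r (k + 1) ε) = 1 := by
    have : H.subtype.comp (FreeGroup.lift (solved f)) =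
        FreeGroup.lift fun s => (solved f s).1 := by ext s; simp
    rw [← this, MonoidHom.comp_apply, lift_solved_longRelator, map_one]
  have h2 := P.lift_long
  rw [lift_longRelator, List.ofFn_succ, List.prod_cons] at h1 h2
  have hx : ∀ j, (solved f (x j)).1 = gen (x j) := fun j => hf' _ (by simp) (by simp)
  have he : ∀ j : Fin k, (solved f (e j.succ)).1 = gen (e j.succ) := fun j =>
    hf' _ (by simp) (by simp [Fin.succ_ne_zero])
  rw [lift_handleWord_congr (f' := gen) fun s _ hs hc => hf' s hc (hs 0)] at h1
  simp only [hx, he] at h1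
  rw [← h2] at h1
  have : (solved f (e 0)).1 = gen (e 0) := by simpa using h1
  rw [← this]
  exact (solved f (e 0)).2

theorem complement_le (P : IsPresentation gen) : complement gen (Set.range c)ᶜ ≤
    Subgroup.closure (letters gen (Set.range x) (freeGens h r k ε) ∪
      complement gen (freeGens h r k ε)) := by
  have key : ∀ s, (∀ i, s ≠ c i) → s ≠ e 0 → gen s ∈ Subgroup.closure
      (letters gen (Set.range x) (freeGens h r k ε) ∪ complement gen (freeGens h r k ε)) := by
    intro s hs hs'
    by_cases hx : s ∈ Set.range (x : Fin r → CanonicalGen h r (k + 1) ε)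
    · exact Subgroup.subset_closure (Or.inl (gen_mem_letters gen _ _ hx))
    · refine Subgroup.subset_closure (Or.inr (gen_mem_complement gen _ ⟨?_, hs, hs'⟩))
      rintro j rfl
      exact hx ⟨j, rfl⟩
  refine (Subgroup.closure_le _).2 ?_
  rintro _ ⟨s, hs, rfl⟩
  have hs' : ∀ i, s ≠ c i := by
    rintro i rfl
    exact hs ⟨i, rfl⟩
  by_cases h0 : s = e 0
  · subst h0
    exact P.e_zero_mem _ key
  · exact key s hs' h0

/-- The generators in `freeGens` generate a free group. -/
theorem eq_one_of_mul_self (P : IsPresentation gen) {y : G}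
    (hy : y ∈ complement gen (freeGens h r k ε)) (hyy : y * y = 1) : y = 1 := by
  classical
  let f : CanonicalGen h r (k + 1) ε → FreeGroup (CanonicalGen h r (k + 1) ε) := fun s =>
    if s ∈ freeGens h r k ε then FreeGroup.of s else 1
  obtain ⟨χ, hχ⟩ := P.exists_hom (solved f) (lift_relators_eq_one
    (fun j => by
      have : x j ∉ freeGens h r k ε := fun hs => hs.1 j rfl
      rw [solved_of_ne (by simp)]; simp [f, this])
    (fun i => by
      have : c i ∉ freeGens h r k ε := fun hs => hs.2.1 i rfl
      rw [solved_of_ne (by simp)]; simp [f, this])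
    (fun i => by
      have : c i ∉ freeGens h r k ε := fun hs => hs.2.1 i rfl
      rw [solved_of_ne (by simp)]; simp [f, this])
    (lift_solved_longRelator f))
  -- On the complement `χ` has a left inverse, so the complement embeds in a free group, where
  -- squares detect the identity.
  have key : FreeGroup.lift gen (χ y) = y := by
    clear hyy
    induction hy using Subgroup.closure_induction with
    | mem z hz =>
      obtain ⟨s, hs, rfl⟩ := hz
      rw [hχ, solved_of_ne hs.2.2]
      simp [f, hs]
    | one => simp
    | mul z w _ _ hz hw => rw [map_mul, map_mul, hz, hw]
    | inv z _ hz => rw [map_inv, map_inv, hz]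
  have h1 : χ y ^ 2 = 1 := by rw [pow_two, ← map_mul, hyy, map_one]
  rw [← key, sq_eq_one.1 h1, map_one]

/-- The involutions of the complement of the reflections. -/
theorem involution_complement (P : IsPresentation gen) {y : G}
    (hy : y ∈ complement gen (Set.range c)ᶜ) (hyy : y * y = 1) (hy1 : y ≠ 1) :
    ∃ j, IsConj (gen (x j)) y := by
  obtain ⟨ψ, hψ⟩ := P.exists_action_x
  obtain ⟨z, w, hw, hww, hz⟩ := hψ.involution_cases
    (letters_mul_self gen _ _ (by rintro _ ⟨j, rfl⟩; exact P.x_mul_self j))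
    (P.complement_le hy) hyy
  obtain rfl := P.eq_one_of_mul_self hw hww
  rcases hz with hz | ⟨t, ⟨u, -, _, ⟨j, rfl⟩, rfl⟩, -, hz⟩
  · refine absurd ?_ hy1
    have : y = z * (z⁻¹ * y * z) * z⁻¹ := by group
    rw [this, hz]; group
  · refine ⟨j, isConj_iff.2 ⟨z * u, ?_⟩⟩
    have : y = z * (z⁻¹ * y * z) * z⁻¹ := by group
    rw [this, hz]; group

/-- If the elements of order two are not in the kernel of a homomorphism to `ℤ₂`, then they are
conjugate to canonical generators. -/
theorem involution_isConj (P : IsPresentation gen) (θ : G →* NSK.Z2)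
    (hθ : ∀ y, θ y = 1 → y * y = 1 → y = 1) {y : G} (hyy : y * y = 1) (hy1 : y ≠ 1) :
    (∃ i, IsConj (gen (c i)) y) ∨ ∃ j, IsConj (gen (x j)) y := by
  obtain ⟨ψ, hψ⟩ := P.exists_action_c
  have hRR := letters_mul_self gen (Set.range c) (Set.range c)ᶜ
    (by rintro _ ⟨j, rfl⟩; exact P.c_mul_self j)
  obtain ⟨z, w, hw, hww, hz⟩ := hψ.involution_cases hRR (P.mem_closure_c y) hyy
  have hy : y = z * (z⁻¹ * y * z) * z⁻¹ := by group
  have conj_w : z⁻¹ * y * z = w → ∃ j, IsConj (gen (x j)) y := by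
    intro hz
    rw [hz] at hy
    obtain ⟨j, hj⟩ := P.involution_complement hw hww (by
      rintro rfl
      exact hy1 (by rw [hy]; group))
    exact ⟨j, hj.trans (isConj_iff.2 ⟨z, hy.symm⟩)⟩
  rcases hz with hz | ⟨t, ht, hwt, hz⟩
  · exact Or.inr (conj_w hz)
  · have htt := hRR t ht
    by_cases hw1 : w = 1
    · obtain ⟨u, -, _, ⟨i, rfl⟩, rfl⟩ := ht
      left
      refine ⟨i, isConj_iff.2 ⟨z * u, ?_⟩⟩
      rw [hy, hz, hw1]; group
    by_cases ht1 : t = 1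
    · exact Or.inr (conj_w (by rw [hz, ht1, one_mul]))
    exfalso
    have h1 : θ w ≠ 1 := fun h => hw1 (hθ w h hww)
    have h2 : θ t ≠ 1 := fun h => ht1 (hθ t h htt)
    -- Two nontrivial commuting involutions both map to `X`, so their product is an involution in
    -- the kernel and must be trivial.
    have h3 : θ (t * w) = 1 := by
      rw [map_mul]
      have : ∀ u v : NSK.Z2, u ≠ 1 → v ≠ 1 → u * v = 1 := by decide
      exact this _ _ h2 h1
    have h4 : t * w * (t * w) = 1 := by
      rw [mul_assoc, ← mul_assoc w, hwt.eq, mul_assoc t w, hww, mul_one, htt]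
    apply hy1
    rw [hy, hz, hθ _ h3 h4]
    group

end

end IsPresentation

end NEC

/-! ### Finite representations that separate reflections and exclude square roots. -/

namespace NEC

open CanonicalGen

variable {h r k : ℕ} {ε : Sign}

/-- The character that detects the number of reflections `c i`. -/
def countC (i : Fin k) : ∀ {ε : Sign}, CanonicalGen h r k ε → NSK.Z2
  | _, c i' => if i' = i then NSK.X else 1
  | _, _ => 1

/-- The inclusion of the centre of the dihedral group of order eight. -/
def dihedralCentre : NSK.Z2 →* DihedralGroup 4 where
  toFun u := if u = 1 then 1 else DihedralGroup.r 2
  map_one' := rfl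
  map_mul' := by decide

/-- A representation in the dihedral group of order eight. -/
def dihedralGen (u : Fin r → NSK.Z2) (v : Fin k → NSK.Z2) :
    ∀ {ε : Sign}, CanonicalGen h r k ε → DihedralGroup 4
  | _, x j => dihedralCentre (u j)
  | _, e i => dihedralCentre (v i)
  | _, c _ => DihedralGroup.sr 0
  | _, a j => if j.val = 0 then DihedralGroup.r 1 else 1
  | _, b j => if j.val = 0 then DihedralGroup.sr 0 else 1
  | _, d j => if j.val = 0 then DihedralGroup.r 1 else 1

theorem prod_ofFn_val_zero {M : Type*} [Monoid M] (z : M) (n : ℕ) :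
    (List.ofFn fun j : Fin n => if j.val = 0 then z else 1).prod = if n = 0 then 1 else z := by
  cases n with
  | zero => simp
  | succ n => simp [List.ofFn_succ]

theorem lift_dihedralGen_handleWord (u : Fin r → NSK.Z2) (v : Fin k → NSK.Z2) :
    FreeGroup.lift (dihedralGen u v) (handleWord h r k ε) =
      dihedralCentre (if h = 0 then 1 else NSK.X) := by
  have key : ∀ f : Fin h → DihedralGroup 4,
      (∀ j, f j = if j.val = 0 then DihedralGroup.r 2 else 1) →
      (List.ofFn f).prod = dihedralCentre (if h = 0 then 1 else NSK.X) := by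
    intro f hf
    rw [funext hf, prod_ofFn_val_zero]
    split_ifs
    · rfl
    · rfl
  cases ε with
  | plus =>
    rw [handleWord, map_list_prod, List.map_ofFn]
    apply key
    intro j
    simp only [Function.comp_apply, map_mul, map_inv, FreeGroup.lift_apply_of, dihedralGen]
    split_ifs
    · decide
    · decide
  | minus =>
    rw [handleWord, map_list_prod, List.map_ofFn]
    apply key
    intro j
    simp only [Function.comp_apply, map_pow, FreeGroup.lift_apply_of, dihedralGen]
    split_ifs
    · decide
    · decide

namespace IsPresentation

variable {G : Type*} [Group G] {gen : CanonicalGen h r k ε → G}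

/-- Every relator contains each `c i` an even number of times, counted modulo 2, so the parity of `c
i` is a character of the group; it distinguishes `c i` from `c i'`. -/
theorem not_isConj_c (P : IsPresentation gen) {i i' : Fin k} (hi : i ≠ i') :
    ¬ IsConj (gen (c i)) (gen (c i')) := by
  have hcc : ∀ u : NSK.Z2, u * u = 1 := by decide
  obtain ⟨χ, hχ⟩ := P.exists_hom (countC i : CanonicalGen h r k ε → NSK.Z2)
    (lift_relators_eq_one (fun _ => hcc _) (fun _ => hcc _) (fun _ => Commute.all _ _) (by
      rw [lift_longRelator_congr (f' := fun _ => 1)]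
      · have : FreeGroup.lift (fun _ : CanonicalGen h r k ε => (1 : NSK.Z2)) = 1 := by ext; simp
        rw [this]; rfl
      · intro s hs
        cases s with
        | c i' => exact absurd rfl (hs i')
        | _ => rfl))
  intro hconj
  have := χ.map_isConj hconj
  rw [isConj_iff_eq, hχ, hχ] at this
  simp [countC, hi.symm] at this

/-- The commuting product `e i` is not a square in the centralizer of `c i`. -/
theorem mul_self_ne_e (P : IsPresentation gen) (i : Fin k) (hei : gen (e i) ≠ 1) {y : G}
    (hy : Commute y (gen (c i))) : y * y ≠ gen (e i) := by
  -- The `x j` and `e j` go to the centre of the dihedral group and the `c j` to a fixed reflection.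
  -- A nonempty handle part contributes the central element `r 2`, and `u`, `v` are to be chosen so
  -- that the long relator becomes trivial while `e i` goes to `r 2`.
  have key : ∀ (u : Fin r → NSK.Z2) (v : Fin k → NSK.Z2), v i = NSK.X →
      (∏ j, u j) * (∏ j, v j) * (if h = 0 then 1 else NSK.X) = 1 → y * y ≠ gen (e i) := by
    intro u v hv huv hyy
    obtain ⟨χ, hχ⟩ := P.exists_hom (dihedralGen u v)
      (lift_relators_eq_one
        (fun j => by
          change dihedralCentre (u j) * dihedralCentre (u j) = 1
          generalize u j = w
          revert w; decide)
        (fun j => by change DihedralGroup.sr 0 * DihedralGroup.sr 0 = 1; decide)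
        (fun j => by
          change DihedralGroup.sr 0 * dihedralCentre (v j) = dihedralCentre (v j) * DihedralGroup.sr 0
          generalize v j = w
          revert w; decide)
        (by
          rw [lift_longRelator, lift_dihedralGen_handleWord]
          have h1 : (List.ofFn fun j : Fin r => dihedralGen u v (x j : CanonicalGen h r k ε)).prod =
              dihedralCentre (∏ j, u j) := by
            rw [← List.prod_ofFn, map_list_prod, List.map_ofFn]; rfl
          have h2 : (List.ofFn fun j : Fin k => dihedralGen u v (e j : CanonicalGen h r k ε)).prod =
              dihedralCentre (∏ j, v j) := by
            rw [← List.prod_ofFn, map_list_prod, List.map_ofFn]; rfl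
          rw [h1, h2, ← map_mul, ← map_mul, huv, map_one]))
    have hc : χ (gen (c i)) = DihedralGroup.sr 0 := hχ _
    have he : χ (gen (e i)) = DihedralGroup.r 2 := by
      rw [hχ]
      change dihedralCentre (v i) = _
      rw [hv]; rfl
    have h1 := (hy.map χ).eq
    have h2 := congrArg χ hyy
    rw [map_mul, he] at h2
    rw [hc] at h1
    -- The centralizer of `sr 0` has exponent two, so the square of `w` cannot be `r 2`.
    generalize χ y = w at h1 h2
    revert w
    decide
  have hXX : NSK.X * NSK.X = 1 := by decide
  by_cases hh : h = 0
  · rcases r with _ | r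
    -- Without handles a second central factor must compensate `e i`: another `e j` here, or `x 0`
    -- if there are rotations. With neither available, the long relation says `e i = 1`.
    · by_cases hk : ∃ j, j ≠ i
      · obtain ⟨j, hj⟩ := hk
        refine key 1 (Pi.mulSingle i NSK.X * Pi.mulSingle j NSK.X) (by simp [hj.symm]) ?_
        simp [hh, Finset.prod_mul_distrib, Finset.prod_pi_mulSingle', hXX]
      · push Not at hk
        exfalso
        apply hei
        have h1 := P.lift_long
        subst hh
        obtain rfl : k = 1 := by
          have := Fintype.card_eq_one_iff.2 ⟨i, hk⟩
          simpa using this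
        have h2 : FreeGroup.lift gen (handleWord 0 0 1 ε) = 1 := by
          cases ε <;> simp [handleWord]
        rw [lift_longRelator, h2] at h1
        obtain rfl : i = 0 := Subsingleton.elim _ _
        simpa using h1
    · refine key (Pi.mulSingle 0 NSK.X) (Pi.mulSingle i NSK.X) (by simp) ?_
      simp [hh, Finset.prod_pi_mulSingle', hXX]
  · refine key 1 (Pi.mulSingle i NSK.X) (by simp) ?_
    simp [hh, Finset.prod_pi_mulSingle', hXX]

end IsPresentation

end NEC

/-! ### Simple closed curves and bands -/

namespace SurfaceCurve

open Topology

/-- The difference of the values at antipodal points is odd under the half turn, so it vanishes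
somewhere. -/
theorem circle_not_injective_real {u : Circle → ℝ} (hu : Continuous u) :
    ¬ Function.Injective u := by
  intro hinj
  let D : ℝ → ℝ := fun t => u (Circle.exp (t + Real.pi)) - u (Circle.exp t)
  have hD : Continuous D := by fun_prop
  have hpi : D Real.pi = - D 0 := by
    have h2 : Circle.exp (Real.pi + Real.pi) = Circle.exp 0 := by
      rw [← two_mul, Circle.exp_two_pi, Circle.exp_zero]
    simp only [D, h2, zero_add]
    ring
  obtain ⟨t, -, ht⟩ : ∃ t ∈ Set.uIcc 0 Real.pi, D t = 0 := by
    apply intermediate_value_uIcc hD.continuousOn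
    rw [hpi, Set.mem_uIcc]
    rcases le_total 0 (D 0) with h | h
    · right; constructor <;> linarith
    · left; constructor <;> linarith
  have h1 := hinj (sub_eq_zero.1 ht)
  rw [Circle.exp_add] at h1
  have h2 : Circle.exp Real.pi = 1 := by simpa using h1
  have h3 := congrArg (fun z : Circle => (z : ℂ)) h2
  simp only [Circle.coe_exp, Complex.exp_pi_mul_I, Circle.coe_one] at h3
  norm_num at h3

/-- If `p` were missed, rotating `p` to `-1` would put the image in the slit plane, where `arg` is
continuous, and yield an injective continuous real function on the circle. -/
theorem circle_surjective_of_injective {f : Circle → Circle} (hf : Continuous f)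
    (hinj : Function.Injective f) : Function.Surjective f := by
  intro p
  by_contra hp
  push Not at hp
  have hpi : ((Circle.exp Real.pi : Circle) : ℂ) = -1 := by simp
  let w : Circle → Circle := fun z => f z * p⁻¹ * Circle.exp Real.pi
  have hw : ∀ z, (w z : ℂ) ∈ Complex.slitPlane := by
    intro z
    rw [Complex.mem_slitPlane_iff_arg]
    refine ⟨fun h => hp z ?_, Circle.coe_ne_zero _⟩
    have h1 : w z = Circle.exp Real.pi := by rw [← h, Circle.exp_arg]
    have h2 : f z * p⁻¹ = 1 := by simpa [w] using h1
    rwa [mul_inv_eq_one] at h2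
  refine circle_not_injective_real (u := fun z => Complex.arg (w z)) ?_ ?_
  · rw [continuous_iff_continuousAt]
    intro z
    have hwc : Continuous fun z => (w z : ℂ) := by fun_prop
    exact ContinuousAt.comp (g := Complex.arg) (f := fun z => (w z : ℂ))
      (Complex.continuousAt_arg (hw z)) hwc.continuousAt
  · intro z z' h
    have := Circle.injective_arg h
    apply hinj
    simpa [w] using this

variable {S : Type*} [TopologicalSpace S]

/-- In a Hausdorff space the parametrization of `D` is an embedding, so the inclusion becomes an
injective continuous self-map of the circle, which is onto. -/
theorem IsSimpleClosedCurve.eq_of_subset [T2Space S] {C D : Set S} (hC : IsSimpleClosedCurve C)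
    (hD : IsSimpleClosedCurve D) (h : C ⊆ D) : C = D := by
  obtain ⟨f, hf, hfi, rfl⟩ := hC
  obtain ⟨g, hg, hgi, rfl⟩ := hD
  have hex : ∀ z, ∃ w, g w = f z := fun z => h ⟨z, rfl⟩
  choose u hu using hex
  have hgu : g ∘ u = f := funext hu
  have huc : Continuous u := by
    rw [(hg.isClosedEmbedding hgi).isInducing.continuous_iff, hgu]
    exact hf
  have hui : Function.Injective u := fun x y hxy => hfi (by rw [← hu, ← hu, hxy])
  refine h.antisymm ?_
  rintro _ ⟨w, rfl⟩
  obtain ⟨z, rfl⟩ := circle_surjective_of_injective huc hui w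
  exact ⟨z, (hu z).symm⟩

theorem IsSimpleClosedCurve.isPreconnected {C : Set S} (hC : IsSimpleClosedCurve C) :
    IsPreconnected C := by
  obtain ⟨f, hf, hfi, rfl⟩ := hC
  have : Function.Surjective Circle.exp := fun z => ⟨_, Circle.exp_arg z⟩
  rw [← this.range_comp f]
  exact isPreconnected_range (hf.comp Circle.exp.continuous)

theorem IsSimpleClosedCurve.isCompact {C : Set S} (hC : IsSimpleClosedCurve C) :
    IsCompact C := by
  obtain ⟨f, hf, hfi, rfl⟩ := hC
  exact isCompact_range hf

theorem IsSimpleClosedCurve.infinite {C : Set S} (hC : IsSimpleClosedCurve C) : C.Infinite := by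
  obtain ⟨f, hf, hfi, rfl⟩ := hC
  have : Infinite Circle := Infinite.of_injective (fun n : ℕ => Circle.exp (1 / (n + 1))) (by
    intro m n h
    have h1 : ∀ n : ℕ, (1 / ((n : ℝ) + 1)) ∈ Set.Ioc (-Real.pi) Real.pi := fun n => by
      have h0 : (0 : ℝ) < 1 / ((n : ℝ) + 1) := by positivity
      have h2 : 1 / ((n : ℝ) + 1) ≤ 1 := by
        rw [div_le_one (by positivity)]
        have : (0 : ℝ) ≤ n := n.cast_nonneg
        linarith
      have := Real.pi_gt_three
      constructor <;> linarith
    have h2 : (1 / ((m : ℝ) + 1)) = 1 / ((n : ℝ) + 1) := by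
      rw [← Circle.arg_exp (h1 m).1 (h1 m).2, ← Circle.arg_exp (h1 n).1 (h1 n).2]
      exact congrArg (fun z : Circle => Complex.arg z) h
    rw [one_div, one_div, inv_inj] at h2
    exact_mod_cast add_right_cancel h2)
  exact Set.infinite_range_of_injective hfi

/-! ### Open annuli and Möbius bands. -/

/-- The sign of a unit of `ℤ` as a real number. -/
def sgn (σ : ℤˣ) : ℝ := ((σ : ℤ) : ℝ)

theorem sgn_cases (σ : ℤˣ) : sgn σ = 1 ∨ sgn σ = -1 := by
  rcases Int.units_eq_one_or σ with rfl | rfl <;> simp [sgn]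

theorem band_eq_iff {σ : ℤˣ} {s t s' t' : ℝ} :
    (Quotient.mk (bandSetoid σ) (s, t) = Quotient.mk (bandSetoid σ) (s', t')) ↔
      ∃ n : ℤ, s' = s + n ∧ t' = sgn (σ ^ n) * t := by
  rw [Quotient.eq]
  constructor
  · rintro ⟨n, hn⟩
    exact ⟨n, congrArg Prod.fst hn, congrArg Prod.snd hn⟩
  · rintro ⟨n, h1, h2⟩
    exact ⟨n, Prod.ext h1 h2⟩

theorem mk_mem_core_iff {σ : ℤˣ} {s t : ℝ} :
    Quotient.mk (bandSetoid σ) (s, t) ∈ core σ ↔ t = 0 := by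
  constructor
  · rintro ⟨s', h⟩
    obtain ⟨n, -, h2⟩ := band_eq_iff.1 h
    rw [h2, mul_zero]
  · rintro rfl
    exact ⟨s, rfl⟩

theorem continuous_bandMk (σ : ℤˣ) : Continuous (Quotient.mk (bandSetoid σ)) :=
  continuous_quot_mk

theorem isOpenMap_bandMk (σ : ℤˣ) : IsOpenMap (Quotient.mk (bandSetoid σ)) := by
  intro O hO
  have : Quotient.mk (bandSetoid σ) ⁻¹' (Quotient.mk (bandSetoid σ) '' O) =
      ⋃ n : ℤ, (fun p : ℝ × ℝ => (p.1 + n, sgn (σ ^ n) * p.2)) ⁻¹' O := by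
    ext ⟨s, t⟩
    simp only [Set.mem_preimage, Set.mem_image, Set.mem_iUnion]
    constructor
    · rintro ⟨⟨s', t'⟩, hp, h⟩
      obtain ⟨n, rfl, rfl⟩ := band_eq_iff.1 h.symm
      exact ⟨n, hp⟩
    · rintro ⟨n, hn⟩
      exact ⟨_, hn, (band_eq_iff.2 ⟨n, rfl, rfl⟩).symm⟩
  apply isOpen_coinduced.2
  change IsOpen (Quotient.mk (bandSetoid σ) ⁻¹' (Quotient.mk (bandSetoid σ) '' O))
  rw [this]
  exact isOpen_iUnion fun n => hO.preimage (by fun_prop)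

/-- The core of a band is a simple closed curve. -/
theorem isSimpleClosedCurve_image_core {σ : ℤˣ} {f : Band σ → S} (hf : Continuous f)
    (hfi : Function.Injective f) : IsSimpleClosedCurve (f '' core σ) := by
  let u : ℝ → S := fun s => f (Quotient.mk (bandSetoid σ) (s, 0))
  have huc : Continuous u := hf.comp ((continuous_bandMk σ).comp (by fun_prop))
  have hu : ∀ s s', u s = u s' ↔ ∃ n : ℤ, s' = s + n := by
    intro s s'
    rw [hfi.eq_iff, band_eq_iff]
    simp
  have hper : Function.Periodic u 1 := fun s => ((hu s (s + 1)).2 ⟨1, by simp⟩).symm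
  have e := AddCircle.homeomorphCircle (T := (1 : ℝ)) one_ne_zero
  refine ⟨hper.lift ∘ e.symm, ?_, ?_, ?_⟩
  · exact ((QuotientAddGroup.isQuotientMap_mk _).continuous_iff.2 huc).comp e.symm.continuous
  · refine Function.Injective.comp ?_ e.symm.injective
    intro x y
    induction x using QuotientAddGroup.induction_on with
    | H s =>
    induction y using QuotientAddGroup.induction_on with
    | H s' =>
    intro h
    obtain ⟨n, rfl⟩ := (hu s s').1 h
    rw [QuotientAddGroup.eq]
    exact ⟨n, by simp⟩
  · rw [Set.range_comp, e.symm.range_coe, Set.image_univ]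
    ext p
    constructor
    · rintro ⟨x, rfl⟩
      induction x using QuotientAddGroup.induction_on with
      | H s => exact ⟨_, ⟨s, rfl⟩, rfl⟩
    · rintro ⟨_, ⟨s, rfl⟩, rfl⟩
      exact ⟨(s : AddCircle (1 : ℝ)), rfl⟩

/-- A set of points that contains the axis and is invariant under a shift contains a strip. -/
theorem exists_strip_subset {σ : ℤˣ} {V : Set (Band σ)} (hV : IsOpen V) (hcore : core σ ⊆ V) :
    ∃ δ > 0, ∀ s t : ℝ, |t| < δ → Quotient.mk (bandSetoid σ) (s, t) ∈ V := by
  have hO : IsOpen (Quotient.mk (bandSetoid σ) ⁻¹' V) := hV.preimage (continuous_bandMk σ)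
  obtain ⟨A, B, -, hB, hA', hB', hAB⟩ := generalized_tube_lemma (isCompact_Icc (a := (0 : ℝ)) (b := 1))
    (isCompact_singleton (x := (0 : ℝ))) hO (by
      rintro ⟨s, t⟩ ⟨-, ht⟩
      obtain rfl : t = 0 := ht
      exact hcore ⟨s, rfl⟩)
  obtain ⟨δ, hδ, hball⟩ := Metric.isOpen_iff.1 hB 0 (hB' rfl)
  refine ⟨δ, hδ, fun s t ht => ?_⟩
  have h1 : Quotient.mk (bandSetoid σ) (s, t) =
      Quotient.mk (bandSetoid σ) (Int.fract s, sgn (σ ^ (-⌊s⌋)) * t) :=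
    band_eq_iff.2 ⟨-⌊s⌋, by push_cast; rw [← sub_eq_add_neg]; rfl, rfl⟩
  rw [h1]
  refine @hAB (Int.fract s, sgn (σ ^ (-⌊s⌋)) * t)
    ⟨hA' ⟨Int.fract_nonneg s, (Int.fract_lt_one s).le⟩, hball ?_⟩
  rw [mem_ball_zero_iff, Real.norm_eq_abs, abs_mul]
  rcases sgn_cases (σ ^ (-⌊s⌋)) with h | h <;> rw [h] <;> simpa using ht

/-- The transversal coordinate of the annulus. -/
def annulusHeight : Band 1 → ℝ :=
  Quotient.lift Prod.snd (by rintro ⟨s, t⟩ _ ⟨n, rfl⟩; simp)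

theorem continuous_annulusHeight : Continuous annulusHeight :=
  Continuous.quotient_lift continuous_snd _

theorem mem_core_of_annulusHeight {p : Band 1} (hp : annulusHeight p = 0) : p ∈ core 1 := by
  induction p using Quotient.inductionOn with
  | _ p => exact mk_mem_core_iff.2 hp

/-- Removing the core leaves a thin Möbius band connected. Read in the annulus, this connected set
would avoid height `0` and still contain points of small positive and small negative height. -/
theorem IsTwoSided.not_isOneSided {C : Set S} (h₂ : IsTwoSided C) : ¬ IsOneSided C := by
  rintro ⟨g, hg, hgC⟩
  obtain ⟨f, hf, hfC⟩ := h₂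
  obtain ⟨δ, hδ, hstrip⟩ := exists_strip_subset (σ := -1)
    (hf.isOpen_range.preimage hg.continuous) (by
      intro p hp
      have : g p ∈ f '' core 1 := by rw [hfC, ← hgC]; exact ⟨p, hp, rfl⟩
      exact Set.image_subset_range _ _ this)
  let q := Quotient.mk (bandSetoid (-1))
  let W : Set S := g '' (q '' (Set.univ ×ˢ Set.Ioo 0 δ))
  have hW : IsPreconnected (f ⁻¹' W) := by
    refine IsPreconnected.preimage_of_isOpenMap ?_ hf.injective hf.isOpenMap ?_
    · exact ((isPreconnected_univ.prod isPreconnected_Ioo).image _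
        (continuous_bandMk _).continuousOn).image _ hg.continuous.continuousOn
    · rintro _ ⟨_, ⟨⟨s, t⟩, ⟨-, ht⟩, rfl⟩, rfl⟩
      exact hstrip s t (by rw [abs_of_pos ht.1]; exact ht.2)
  have hh := hW.image _ continuous_annulusHeight.continuousOn
  have h0 : (0 : ℝ) ∉ annulusHeight '' (f ⁻¹' W) := by
    rintro ⟨p, ⟨_, ⟨⟨s, t⟩, ⟨-, ht⟩, rfl⟩, hp⟩, hp0⟩
    have h1 : f p ∈ g '' core (-1) := by
      rw [hgC, ← hfC]
      exact ⟨p, mem_core_of_annulusHeight hp0, rfl⟩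
    rw [← hp, hg.injective.mem_set_image, mk_mem_core_iff] at h1
    exact ht.1.ne' h1
  -- In the Möbius band `(s, t)` and `(s + 1, -t)` are the same point, so positive heights already
  -- give the whole strip without its core.
  have key : ∀ s t : ℝ, |t| < δ → t ≠ 0 → g (q (s, t)) ∈ W := by
    intro s t ht ht0
    rcases lt_or_gt_of_ne ht0 with h | h
    · refine ⟨q (s + 1, -t), ⟨_, ⟨trivial, ?_⟩, rfl⟩, ?_⟩
      · rw [abs_of_neg h] at ht
        exact ⟨by linarith, ht⟩
      · congr 1
        exact (band_eq_iff.2 ⟨1, by simp, by simp [sgn]⟩).symm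
    · rw [abs_of_pos h] at ht
      exact ⟨_, ⟨_, ⟨trivial, h, ht⟩, rfl⟩, rfl⟩
  have hN : IsOpen (f ⁻¹' (g '' (q '' (Set.univ ×ˢ Set.Ioo (-δ) δ)))) :=
    (hg.isOpenMap _ (isOpenMap_bandMk _ _ (isOpen_univ.prod isOpen_Ioo))).preimage hf.continuous
  obtain ⟨η, hη, hηN⟩ := exists_strip_subset hN (by
    intro p hp
    have : f p ∈ g '' core (-1) := by rw [hgC, ← hfC]; exact ⟨p, hp, rfl⟩
    obtain ⟨_, ⟨s, rfl⟩, hs⟩ := this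
    exact ⟨_, ⟨(s, 0), ⟨trivial, by simp [hδ]⟩, rfl⟩, hs⟩)
  have key2 : ∀ t : ℝ, |t| < η → t ≠ 0 → t ∈ annulusHeight '' (f ⁻¹' W) := by
    intro t ht ht0
    refine ⟨Quotient.mk _ (0, t), ?_, rfl⟩
    obtain ⟨_, ⟨⟨s, t'⟩, ⟨-, ht'⟩, rfl⟩, h⟩ := hηN 0 t ht
    change f _ ∈ W
    rw [← h]
    refine key s t' (abs_lt.2 ht') ?_
    rintro rfl
    have h1 : f (Quotient.mk _ (0, t)) ∈ f '' core 1 := by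
      rw [hfC, ← hgC, ← h]
      exact ⟨_, ⟨s, rfl⟩, rfl⟩
    rw [hf.injective.mem_set_image, mk_mem_core_iff] at h1
    exact ht0 h1
  have hη2 : |η / 2| < η := by rw [abs_of_pos (by positivity)]; linarith
  have hp := key2 (η / 2) hη2 (by positivity)
  have hn := key2 (-(η / 2)) (by rwa [abs_neg]) (by rw [neg_ne_zero]; positivity)
  exact h0 (hh.ordConnected.out hn hp ⟨by linarith, by linarith⟩)

end SurfaceCurve

/-! ### Discrete groups of isometries -/

namespace PlaneIsometry

variable {U : Type*} [MetricSpace U] {Γ : Subgroup (U ≃ᵢ U)}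

/-- A discrete group of isometries of a proper space acts properly discontinuously. -/
theorem IsDiscreteSubgroup.finite_dist_le [ProperSpace U] (hΓ : IsDiscreteSubgroup Γ) (z : U)
    (R : ℝ) : {γ : Γ | dist ((γ : U ≃ᵢ U) z) z ≤ R}.Finite := by
  obtain ⟨K, hK, ε, hε, h⟩ := hΓ
  obtain ⟨t, -, htf, hcover⟩ := hK.finite_cover_balls (show (0 : ℝ) < ε / 4 by positivity)
  have : Fintype t := htf.fintype
  -- The elements in question send the finite net `t` of `K` to a compact product of balls. If they
  -- were infinitely many, two would be `ε / 4`-close on `t`, hence `3ε / 4`-close on `K`, and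
  -- discreteness would identify them.
  let F : Γ → (t → U) := fun γ x => (γ : U ≃ᵢ U) x
  have hP : IsCompact (Set.univ.pi fun x : t => Metric.closedBall z (R + dist (x : U) z)) :=
    isCompact_univ_pi fun x => isCompact_closedBall _ _
  obtain ⟨s, -, hsf, hs⟩ := hP.finite_cover_balls (show (0 : ℝ) < ε / 8 by positivity)
  by_contra hinf
  have hex : ∀ γ : Γ, dist ((γ : U ≃ᵢ U) z) z ≤ R → ∃ y ∈ s, dist (F γ) y < ε / 8 := by
    intro γ hγ
    have hmem : F γ ∈ Set.univ.pi fun x : t => Metric.closedBall z (R + dist (x : U) z) := by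
      intro x _
      rw [Metric.mem_closedBall]
      calc dist ((γ : U ≃ᵢ U) x) z ≤ dist ((γ : U ≃ᵢ U) x) ((γ : U ≃ᵢ U) z) +
            dist ((γ : U ≃ᵢ U) z) z := dist_triangle _ _ _
        _ ≤ R + dist (x : U) z := by rw [IsometryEquiv.dist_eq]; linarith
    obtain ⟨y, hy, hy'⟩ := Set.mem_iUnion₂.1 (hs hmem)
    exact ⟨y, hy, hy'⟩
  have : Nonempty U := ⟨z⟩
  choose! u hus hu using hex
  obtain ⟨γ, hγ, δ, hδ, hne, heq⟩ := Set.Infinite.exists_ne_map_eq_of_mapsTo (f := u) hinf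
    (fun γ hγ => hus γ hγ) hsf
  apply hne
  have hclose : ∀ x ∈ t, dist ((γ : U ≃ᵢ U) x) ((δ : U ≃ᵢ U) x) < ε / 4 := by
    intro x hx
    have h1 : dist (F γ) (F δ) < ε / 4 := by
      have h2 := hu γ hγ
      have h3 := hu δ hδ
      rw [heq] at h2
      have := dist_triangle_right (F γ) (F δ) (u δ)
      linarith
    exact (dist_le_pi_dist (F γ) (F δ) ⟨x, hx⟩).trans_lt h1
  have h1 : ((δ⁻¹ * γ : Γ) : U ≃ᵢ U) = 1 := by
    apply h _ (δ⁻¹ * γ).2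
    intro y hy
    obtain ⟨x, hx, hxy⟩ := Set.mem_iUnion₂.1 (hcover hy)
    rw [Metric.mem_ball] at hxy
    rw [← (δ : U ≃ᵢ U).dist_eq]
    have e : (δ : U ≃ᵢ U) (((δ⁻¹ * γ : Γ) : U ≃ᵢ U) y) = (γ : U ≃ᵢ U) y := by simp
    rw [e]
    calc dist ((γ : U ≃ᵢ U) y) ((δ : U ≃ᵢ U) y) ≤ dist ((γ : U ≃ᵢ U) y) ((γ : U ≃ᵢ U) x) +
          dist ((γ : U ≃ᵢ U) x) ((δ : U ≃ᵢ U) x) + dist ((δ : U ≃ᵢ U) x) ((δ : U ≃ᵢ U) y) :=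
          dist_triangle4 _ _ _ _
      _ < ε := by
        rw [IsometryEquiv.dist_eq, IsometryEquiv.dist_eq, dist_comm x y]
        have := hclose x hx
        linarith
  exact (inv_mul_eq_one.1 (Subtype.ext h1)).symm

theorem IsDiscreteSubgroup.finite_meets [ProperSpace U] (hΓ : IsDiscreteSubgroup Γ) {Q : Set U}
    (hQ : IsCompact Q) : {γ : Γ | ∃ z ∈ Q, (γ : U ≃ᵢ U) z ∈ Q}.Finite := by
  rcases Q.eq_empty_or_nonempty with rfl | ⟨z₀, -⟩
  · simp
  obtain ⟨ρ, hρ⟩ := hQ.isBounded.subset_closedBall z₀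
  refine (hΓ.finite_dist_le z₀ (ρ + ρ)).subset ?_
  rintro γ ⟨z, hz, hz'⟩
  have h1 := hρ hz
  have h2 := hρ hz'
  rw [Metric.mem_closedBall] at h1 h2
  have := dist_triangle ((γ : U ≃ᵢ U) z₀) ((γ : U ≃ᵢ U) z) z₀
  rw [IsometryEquiv.dist_eq, dist_comm z₀ z] at this
  change dist _ _ ≤ _
  linarith

/-- A point stabilizer in a discrete group is finite. -/
theorem IsDiscreteSubgroup.exists_pow_eq_one [ProperSpace U] (hΓ : IsDiscreteSubgroup Γ) {γ : Γ}
    {z : U} (hγ : (γ : U ≃ᵢ U) z = z) : ∃ n : ℕ, n ≠ 0 ∧ γ ^ n = 1 := by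
  have hfix : ∀ n : ℕ, ((γ ^ n : Γ) : U ≃ᵢ U) z = z := by
    intro n
    induction n with
    | zero => simp
    | succ n ih =>
      rw [pow_succ, Subgroup.coe_mul, IsometryEquiv.mul_apply, hγ, ih]
  have hfin : (Set.range fun n : ℕ => γ ^ n).Finite := by
    refine (hΓ.finite_dist_le z 0).subset ?_
    rintro _ ⟨n, rfl⟩
    change dist _ _ ≤ _
    rw [hfix, dist_self]
  have hni : ¬ Function.Injective fun n : ℕ => γ ^ n := fun hi =>
    Set.infinite_range_of_injective hi hfin
  rw [injective_pow_iff_not_isOfFinOrder, not_not, isOfFinOrder_iff_pow_eq_one] at hni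
  obtain ⟨n, hn, h⟩ := hni
  exact ⟨n, hn.ne', h⟩

end PlaneIsometry

/-! ### The topology of the quotient surface. -/

namespace NSK

open PlaneIsometry

variable {U : Type*} [MetricSpace U] {Γ : Subgroup (U ≃ᵢ U)} {θ : Γ →* Z2}

theorem continuous_proj : Continuous (proj θ) := continuous_quot_mk

theorem proj_eq_iff {z w : U} : proj θ z = proj θ w ↔ ∃ γ : Γ, θ γ = 1 ∧ (γ : U ≃ᵢ U) z = w :=
  ⟨fun h => Quotient.exact h, fun h => Quotient.sound h⟩

theorem isOpenMap_proj : IsOpenMap (proj θ) := by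
  intro O hO
  apply isOpen_coinduced.2
  change IsOpen (proj θ ⁻¹' (proj θ '' O))
  have : proj θ ⁻¹' (proj θ '' O) = ⋃ γ : θ.ker, ((γ : Γ) : U ≃ᵢ U) ⁻¹' O := by
    ext z
    simp only [Set.mem_preimage, Set.mem_image, Set.mem_iUnion]
    constructor
    · rintro ⟨w, hw, h⟩
      obtain ⟨γ, hγ, rfl⟩ := proj_eq_iff.1 h.symm
      exact ⟨⟨γ, hγ⟩, hw⟩
    · rintro ⟨⟨γ, hγ⟩, h⟩
      exact ⟨_, h, (proj_eq_iff.2 ⟨γ, hγ, rfl⟩).symm⟩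
  rw [this]
  exact isOpen_iUnion fun γ => hO.preimage ((γ : Γ) : U ≃ᵢ U).continuous

/-- Only finitely many points of the kernel orbit of `z`, with multiplicity, are near `w`, so the
orbit has a positive distance `ε` from `w`, and balls of radius `ε / 2` have disjoint images. -/
theorem t2Space_kernelSurface [ProperSpace U] (hΓ : IsDiscreteSubgroup Γ) :
    T2Space (KernelSurface θ) := by
  constructor
  intro p q hpq
  induction p using Quotient.inductionOn with
  | _ z =>
  induction q using Quotient.inductionOn with
  | _ w =>
  have hne : ∀ γ : Γ, θ γ = 1 → (γ : U ≃ᵢ U) z ≠ w := fun γ hγ h =>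
    hpq (Quotient.sound ⟨γ, hγ, h⟩)
  have hfin : {γ : Γ | θ γ = 1 ∧ dist ((γ : U ≃ᵢ U) z) w ≤ 1}.Finite := by
    refine (hΓ.finite_dist_le z (1 + dist w z)).subset ?_
    rintro γ ⟨-, h⟩
    exact (dist_triangle _ w _).trans (by linarith)
  obtain ⟨ε, hε, hεd⟩ : ∃ ε > 0, ∀ γ : Γ, θ γ = 1 → ε ≤ dist ((γ : U ≃ᵢ U) z) w := by
    rcases Set.eq_empty_or_nonempty {γ : Γ | θ γ = 1 ∧ dist ((γ : U ≃ᵢ U) z) w ≤ 1} with h | h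
    · refine ⟨1, one_pos, fun γ hγ => ?_⟩
      by_contra! hlt
      have : γ ∈ {γ : Γ | θ γ = 1 ∧ dist ((γ : U ≃ᵢ U) z) w ≤ 1} := ⟨hγ, hlt.le⟩
      rw [h] at this
      exact this
    · obtain ⟨γ₀, ⟨hγ₀, hle⟩, hmin⟩ := Set.exists_min_image _
        (fun γ : Γ => dist ((γ : U ≃ᵢ U) z) w) hfin h
      refine ⟨_, dist_pos.2 (hne γ₀ hγ₀), fun γ hγ => ?_⟩
      rcases le_total (dist ((γ : U ≃ᵢ U) z) w) 1 with h1 | h1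
      · exact hmin γ ⟨hγ, h1⟩
      · exact hle.trans h1
  refine ⟨proj θ '' Metric.ball z (ε / 2), proj θ '' Metric.ball w (ε / 2),
    isOpenMap_proj _ Metric.isOpen_ball, isOpenMap_proj _ Metric.isOpen_ball,
    ⟨z, Metric.mem_ball_self (by positivity), rfl⟩, ⟨w, Metric.mem_ball_self (by positivity), rfl⟩,
    ?_⟩
  rw [Set.disjoint_left]
  rintro _ ⟨z', hz', rfl⟩ ⟨w', hw', h⟩
  obtain ⟨γ, hγ, rfl⟩ := proj_eq_iff.1 h.symm
  rw [Metric.mem_ball] at hz' hw'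
  have h1 := hεd γ hγ
  have h2 := dist_triangle_left ((γ : U ≃ᵢ U) z) w ((γ : U ≃ᵢ U) z')
  rw [IsometryEquiv.dist_eq] at h2
  linarith

end NSK

/-! ### The neighbourhood of a reflection curve -/

/-- The data of a reflection `c` in a discrete group of isometries such that the kernel of `θ` acts
freely, with Fermi coordinates along its axis. -/
structure ReflectionData {U : Type*} [MetricSpace U] {Γ : Subgroup (U ≃ᵢ U)} (θ : Γ →* NSK.Z2)
    (c : Γ) (N : FermiPlane U) : Prop where
  discrete : PlaneIsometry.IsDiscreteSubgroup Γ
  free : ∀ (γ : Γ) (z : U), θ γ = 1 → (γ : U ≃ᵢ U) z = z → γ = 1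
  refl : N.refl = c
  map_c : θ c = NSK.X

namespace ReflectionData

open SurfaceCurve

variable {U : Type*} [MetricSpace U] {Γ : Subgroup (U ≃ᵢ U)} {θ : Γ →* NSK.Z2} {c : Γ}
  {N : FermiPlane U}

theorem c_coord (D : ReflectionData θ c N) (s t : ℝ) :
    (c : U ≃ᵢ U) (N.coord (s, t)) = N.coord (s, -t) := by
  rw [← D.refl, N.refl_coord]

theorem coe_commute (D : ReflectionData θ c N) {γ : Γ} (h : Commute γ c) :
    Commute (γ : U ≃ᵢ U) N.refl := by
  rw [D.refl]
  exact h.map Γ.subtype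

/-- The quotient of the two elements lies in the kernel and fixes a point. This is how incidences of
axes turn into equations in `Γ`. -/
theorem eq_of_common_fixed (D : ReflectionData θ c N) {α β : Γ} (h : θ α = θ β) {z : U}
    (hα : (α : U ≃ᵢ U) z = z) (hβ : (β : U ≃ᵢ U) z = z) : α = β := by
  rw [← inv_mul_eq_one]
  apply D.free _ z
  · rw [map_mul, map_inv, h, inv_mul_cancel]
  · rw [Subgroup.coe_mul, IsometryEquiv.mul_apply, hβ, Subgroup.coe_inv]
    apply (α : U ≃ᵢ U).injective
    rw [IsometryEquiv.apply_inv_self, hα]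

/-- Elements that take a point of the axis to the axis commute with the reflection. -/
theorem commute_of_axis (D : ReflectionData θ c N) {γ : Γ} {s s' : ℝ}
    (h : (γ : U ≃ᵢ U) (N.coord (s, 0)) = N.coord (s', 0)) : Commute γ c := by
  have h1 : γ * c * γ⁻¹ = c := by
    apply D.eq_of_common_fixed (z := N.coord (s', 0))
    · rw [map_mul, map_mul, map_inv, mul_comm (θ γ), mul_inv_cancel_right]
    · rw [← h]
      simp only [Subgroup.coe_mul, Subgroup.coe_inv, IsometryEquiv.mul_apply,
        IsometryEquiv.inv_apply_self]
      rw [D.c_coord, neg_zero]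
    · rw [D.c_coord, neg_zero]
  exact mul_inv_eq_iff_eq_mul.1 h1

/-- An element of the kernel that commutes with the reflection shifts its axis. -/
theorem exists_shift (D : ReflectionData θ c N) {γ : Γ} (hγ : θ γ = 1) (hc : Commute γ c) :
    ∃ a, ∃ σ : ℤˣ, ∀ s t, (γ : U ≃ᵢ U) (N.coord (s, t)) = N.coord (s + a, sgn σ * t) := by
  rcases N.axis_cases (D.coe_commute hc) with ⟨a, ha⟩ | ⟨a, ha⟩ | ⟨a, ha⟩
  · exact ⟨a, 1, fun s t => by rw [ha, N.trans_coord]; simp [sgn]⟩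
  · exact ⟨a, -1, fun s t => by
      rw [ha, IsometryEquiv.mul_apply, N.refl_coord, N.trans_coord]; simp [sgn]⟩
  -- A reversal of the axis fixes the point with parameter `a / 2`.
  · have : γ = 1 := D.free γ _ hγ (by rw [ha (a / 2)]; congr 2; ring)
    exact ⟨0, 1, fun s t => by rw [this]; simp [sgn]⟩

theorem eq_of_axis_eq (D : ReflectionData θ c N) {γ δ : Γ} (hγ : θ γ = 1) (hδ : θ δ = 1) {s : ℝ}
    (h : (γ : U ≃ᵢ U) (N.coord (s, 0)) = (δ : U ≃ᵢ U) (N.coord (s, 0))) : γ = δ := by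
  symm
  rw [← inv_mul_eq_one]
  apply D.free _ (N.coord (s, 0))
  · rw [map_mul, map_inv, hγ, hδ]; simp
  · rw [Subgroup.coe_mul, IsometryEquiv.mul_apply, h, Subgroup.coe_inv,
      IsometryEquiv.inv_apply_self]

theorem sgn_mul (σ σ' : ℤˣ) : sgn (σ * σ') = sgn σ * sgn σ' := by simp [sgn]

theorem zpow_coord {τ : Γ} {a : ℝ} {σ : ℤˣ}
    (hτ : ∀ s t, (τ : U ≃ᵢ U) (N.coord (s, t)) = N.coord (s + a, sgn σ * t)) (n : ℤ)
    (s t : ℝ) : ((τ ^ n : Γ) : U ≃ᵢ U) (N.coord (s, t)) = N.coord (s + n * a, sgn (σ ^ n) * t) := by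
  induction n using Int.induction_on generalizing s t with
  | zero => simp [sgn]
  | succ i ih =>
    rw [zpow_add_one, Subgroup.coe_mul, IsometryEquiv.mul_apply, hτ, ih, zpow_add_one, sgn_mul]
    push_cast
    congr 2 <;> ring
  | pred i ih =>
    have h : ((τ⁻¹ : Γ) : U ≃ᵢ U) (N.coord (s, t)) = N.coord (s - a, sgn σ⁻¹ * t) := by
      apply (τ : U ≃ᵢ U).injective
      rw [hτ, Subgroup.coe_inv, IsometryEquiv.apply_inv_self, ← mul_assoc, ← sgn_mul]
      simp [sgn]
    rw [zpow_sub_one, Subgroup.coe_mul, IsometryEquiv.mul_apply, h, ih, zpow_sub_one, sgn_mul]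
    push_cast
    congr 2 <;> ring

/-- `τ` generates the stabilizer of the axis in the kernel of `θ`. -/
structure IsGenerator (θ : Γ →* NSK.Z2) (c : Γ) (N : FermiPlane U) (τ : Γ) (a : ℝ) (σ : ℤˣ) :
    Prop where
  ker : θ τ = 1
  commute : Commute τ c
  pos : 0 < a
  coord : ∀ s t, (τ : U ≃ᵢ U) (N.coord (s, t)) = N.coord (s + a, sgn σ * t)
  generates : ∀ γ : Γ, θ γ = 1 → Commute γ c → ∃ n : ℤ, γ = τ ^ n

/-- The translation lengths of the stabilizer of the axis. -/
def shifts (θ : Γ →* NSK.Z2) (N : FermiPlane U) : AddSubgroup ℝ where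
  carrier := {a | ∃ γ : Γ, θ γ = 1 ∧ ∀ s, (γ : U ≃ᵢ U) (N.coord (s, 0)) = N.coord (s + a, 0)}
  zero_mem' := ⟨1, map_one _, fun s => by simp⟩
  add_mem' := by
    rintro a b ⟨γ, hγ, h⟩ ⟨δ, hδ, h'⟩
    exact ⟨γ * δ, by rw [map_mul, hγ, hδ, one_mul], fun s => by
      rw [Subgroup.coe_mul, IsometryEquiv.mul_apply, h', h]; congr 2; ring⟩
  neg_mem' := by
    rintro a ⟨γ, hγ, h⟩
    refine ⟨γ⁻¹, by rw [map_inv, hγ, inv_one], fun s => ?_⟩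
    apply (γ : U ≃ᵢ U).injective
    rw [h, Subgroup.coe_inv, IsometryEquiv.apply_inv_self]
    congr 2; ring

/-- The shifts form a discrete subgroup of ℝ by proper discontinuity, hence a cyclic one, nonzero
because of `γ₀`; and by freeness a kernel element is determined by its shift. -/
theorem exists_generator (D : ReflectionData θ c N) {γ₀ : Γ} (hγ₀ : θ γ₀ = 1)
    (hc₀ : Commute γ₀ c) (h₀ : γ₀ ≠ 1) : ∃ τ a σ, IsGenerator θ c N τ a σ := by
  have := N.proper
  obtain ⟨b, hb⟩ : ∃ b, shifts θ N = AddSubgroup.closure {b} := by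
    have hfin : {a ∈ (shifts θ N : Set ℝ) | |a| ≤ 1}.Finite := by
      have hf := (D.discrete.finite_dist_le (N.coord (0, 0)) 1).image
        fun γ : Γ => (N.coord.symm ((γ : U ≃ᵢ U) (N.coord (0, 0)))).1
      refine hf.subset ?_
      rintro a ⟨⟨γ, hγ, h⟩, ha⟩
      refine ⟨γ, ?_, ?_⟩
      · change dist _ _ ≤ _
        rw [h, N.dist_axis]
        simpa using ha
      · simp [h]
    obtain ⟨δ, hδ, hd⟩ : ∃ δ > 0, Disjoint (shifts θ N : Set ℝ) (Set.Ioo 0 δ) := by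
      rcases Set.eq_empty_or_nonempty {a ∈ (shifts θ N : Set ℝ) | 0 < a ∧ a ≤ 1} with h | h
      · refine ⟨1, one_pos, Set.disjoint_left.2 fun a ha ha' => ?_⟩
        have : a ∈ {a ∈ (shifts θ N : Set ℝ) | 0 < a ∧ a ≤ 1} := ⟨ha, ha'.1, ha'.2.le⟩
        rw [h] at this
        exact this
      · obtain ⟨a₀, ⟨ha₀, hpos, hle⟩, hmin⟩ := Set.exists_min_image _ id (hfin.subset
          (fun a ha => ⟨ha.1, by rw [abs_of_pos ha.2.1]; exact ha.2.2⟩)) h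
        refine ⟨a₀, hpos, Set.disjoint_left.2 fun a ha ha' => ?_⟩
        have := hmin a ⟨ha, ha'.1, ha'.2.le.trans hle⟩
        exact absurd ha'.2 (not_lt.2 this)
    exact AddSubgroup.cyclic_of_isolated_zero hδ hd
  obtain ⟨a₀, σ₀, hco₀⟩ := D.exists_shift hγ₀ hc₀
  have ha₀ : a₀ ≠ 0 := by
    rintro rfl
    apply h₀
    apply D.free _ (N.coord (0, 0)) hγ₀
    rw [hco₀]; simp
  have hmem : ∀ {γ : Γ} {a : ℝ} {σ : ℤˣ}, θ γ = 1 →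
      (∀ s t, (γ : U ≃ᵢ U) (N.coord (s, t)) = N.coord (s + a, sgn σ * t)) → a ∈ shifts θ N :=
    fun {γ a σ} hγ h => ⟨γ, hγ, fun s => by rw [h, mul_zero]⟩
  have hb0 : b ≠ 0 := by
    rintro rfl
    have := hmem hγ₀ hco₀
    rw [hb, AddSubgroup.closure_singleton_zero, AddSubgroup.mem_bot] at this
    exact ha₀ this
  have habs : |b| ∈ shifts θ N := by
    have : b ∈ shifts θ N := by rw [hb]; exact AddSubgroup.subset_closure rfl
    rcases abs_choice b with h | h <;> rw [h]
    · exact this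
    · exact neg_mem this
  obtain ⟨τ, hτ, hτs⟩ := habs
  have hcomm : Commute τ c := D.commute_of_axis (hτs 0)
  obtain ⟨a, σ, hco⟩ := D.exists_shift hτ hcomm
  obtain rfl : a = |b| := by
    have h1 := hτs 0
    rw [hco, N.coord.injective.eq_iff, Prod.mk.injEq] at h1
    simpa using h1.1
  refine ⟨τ, |b|, σ, hτ, hcomm, abs_pos.2 hb0, hco, fun γ hγ hγc => ?_⟩
  obtain ⟨a', σ', hco'⟩ := D.exists_shift hγ hγc
  have := hmem hγ hco'
  rw [hb, AddSubgroup.mem_closure_singleton] at this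
  obtain ⟨n, hn⟩ := this
  obtain ⟨m, hm⟩ : ∃ m : ℤ, a' = m * |b| := by
    rcases abs_choice b with h | h
    · exact ⟨n, by rw [h, ← hn, zsmul_eq_mul]⟩
    · exact ⟨-n, by rw [h, ← hn, zsmul_eq_mul]; push_cast; ring⟩
  refine ⟨m, D.eq_of_axis_eq hγ (by rw [map_zpow, hτ, one_zpow]) (s := 0) ?_⟩
  rw [hco', zpow_coord hco, hm, mul_zero, mul_zero]

end ReflectionData

/-! ### The band around the image of an axis. -/

namespace ReflectionData

open SurfaceCurve

variable {U : Type*} [MetricSpace U] {Γ : Subgroup (U ≃ᵢ U)} {θ : Γ →* NSK.Z2} {c : Γ}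
  {N : FermiPlane U} {τ : Γ} {a : ℝ} {σ : ℤˣ}

theorem abs_sgn_mul (σ : ℤˣ) (t : ℝ) : |sgn σ * t| = |t| := by
  rcases sgn_cases σ with h | h <;> rw [h] <;> simp

/-- A thin tube around a segment of the axis is moved off itself. -/
theorem exists_thin_segment (D : ReflectionData θ c N) (a : ℝ) {γ : Γ} (hγ : ¬ Commute γ c) :
    ∃ δ > 0, ∀ s ∈ Set.Icc 0 a, ∀ s' ∈ Set.Icc 0 a, ∀ t t' : ℝ, |t| < δ → |t'| < δ →
      (γ : U ≃ᵢ U) (N.coord (s, t)) ≠ N.coord (s', t') := by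
  have hO : IsOpen {p : (ℝ × ℝ) × (ℝ × ℝ) |
      (γ : U ≃ᵢ U) (N.coord (p.1.1, p.2.1)) ≠ N.coord (p.1.2, p.2.2)} := by
    have h1 := (γ : U ≃ᵢ U).continuous
    have h2 := N.coord.continuous
    exact isOpen_ne_fun (h1.comp (h2.comp (by fun_prop))) (h2.comp (by fun_prop))
  obtain ⟨A, B, -, hB, hA', hB', hAB⟩ := generalized_tube_lemma
    ((isCompact_Icc (a := (0 : ℝ)) (b := a)).prod (isCompact_Icc (a := (0 : ℝ)) (b := a)))
    (isCompact_singleton (x := ((0 : ℝ), (0 : ℝ)))) hO (by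
      rintro ⟨⟨s, s'⟩, ⟨t, t'⟩⟩ ⟨-, ht⟩ h
      obtain ⟨rfl, rfl⟩ : t = 0 ∧ t' = 0 := Prod.mk.injEq _ _ _ _ ▸ ht
      exact hγ (D.commute_of_axis h))
  obtain ⟨δ, hδ, hball⟩ := Metric.isOpen_iff.1 hB (0, 0) (hB' rfl)
  refine ⟨δ, hδ, fun s hs s' hs' t t' ht ht' => ?_⟩
  refine @hAB ((s, s'), (t, t')) ⟨hA' ⟨hs, hs'⟩, hball ?_⟩
  rw [Metric.mem_ball, Prod.dist_eq, max_lt_iff]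
  simpa using ⟨ht, ht'⟩

/-- A thin tube around the axis meets its images only under the stabilizer of the axis. -/
theorem exists_thin_tube (D : ReflectionData θ c N) (T : IsGenerator θ c N τ a σ) :
    ∃ δ > 0, ∀ (γ : Γ) (s t s' t' : ℝ), |t| < δ → |t'| < δ →
      (γ : U ≃ᵢ U) (N.coord (s, t)) = N.coord (s', t') → Commute γ c := by
  have := N.proper
  have hQ : IsCompact (N.coord '' (Set.Icc 0 a ×ˢ Set.Icc (-1) 1)) :=
    (isCompact_Icc.prod isCompact_Icc).image N.coord.continuous
  have hfin := D.discrete.finite_meets hQ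
  have hex : ∀ γ : Γ, ∃ δ > 0, ¬ Commute γ c → ∀ s ∈ Set.Icc 0 a, ∀ s' ∈ Set.Icc 0 a,
      ∀ t t' : ℝ, |t| < δ → |t'| < δ → (γ : U ≃ᵢ U) (N.coord (s, t)) ≠ N.coord (s', t') := by
    intro γ
    by_cases h : Commute γ c
    · exact ⟨1, one_pos, fun h' => absurd h h'⟩
    · obtain ⟨δ, hδ, hδ'⟩ := D.exists_thin_segment a h
      exact ⟨δ, hδ, fun _ => hδ'⟩
  choose d hd0 hd using hex
  obtain ⟨δ, hδmem, hδmin⟩ := Set.exists_min_image _ id ((hfin.image d).insert 1)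
    (Set.insert_nonempty _ _)
  have hδ0 : 0 < δ := by
    rcases hδmem with rfl | ⟨γ, -, rfl⟩
    · exact one_pos
    · exact hd0 γ
  have hδ1 : δ ≤ 1 := hδmin 1 (Set.mem_insert _ _)
  have hseg : ∀ (γ : Γ) (s t s' t' : ℝ), s ∈ Set.Icc 0 a → s' ∈ Set.Icc 0 a → |t| < δ → |t'| < δ →
      (γ : U ≃ᵢ U) (N.coord (s, t)) = N.coord (s', t') → Commute γ c := by
    intro γ s t s' t' hs hs' ht ht' h
    by_contra hγ
    have hQt : ∀ s t : ℝ, s ∈ Set.Icc 0 a → |t| < δ →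
        N.coord (s, t) ∈ N.coord '' (Set.Icc 0 a ×ˢ Set.Icc (-1) 1) := fun s t hs ht =>
      ⟨_, ⟨hs, abs_le.1 (ht.le.trans hδ1)⟩, rfl⟩
    have hle : δ ≤ d γ := hδmin _ (Set.mem_insert_of_mem _
      ⟨γ, ⟨_, hQt s t hs ht, by rw [h]; exact hQt s' t' hs' ht'⟩, rfl⟩)
    exact hd γ hγ s hs s' hs' t t' (ht.trans_le hle) (ht'.trans_le hle) h
  refine ⟨δ, hδ0, fun γ s t s' t' ht ht' h => ?_⟩
  -- Powers of `τ` bring both points over the fundamental segment `[0, a]`; they commute with `c`,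
  -- so the conclusion is unaffected.
  have hfl : ∀ s : ℝ, s + ((-⌊s / a⌋ : ℤ) : ℝ) * a ∈ Set.Icc 0 a := by
    intro s
    have ha := T.pos
    have h1 : s + ((-⌊s / a⌋ : ℤ) : ℝ) * a = Int.fract (s / a) * a := by
      rw [Int.fract, sub_mul, div_mul_cancel₀ _ ha.ne']
      push_cast; ring
    rw [h1]
    have h2 := Int.fract_nonneg (s / a)
    have h3 := (Int.fract_lt_one (s / a)).le
    constructor
    · positivity
    · nlinarith
  have key := hseg (τ ^ (-⌊s' / a⌋) * γ * (τ ^ (-⌊s / a⌋))⁻¹) _ (sgn (σ ^ (-⌊s / a⌋)) * t) _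
    (sgn (σ ^ (-⌊s' / a⌋)) * t') (hfl s) (hfl s') (by rwa [abs_sgn_mul]) (by rwa [abs_sgn_mul]) (by
      rw [← zpow_coord T.coord, ← zpow_coord T.coord, ← h]
      simp only [Subgroup.coe_mul, Subgroup.coe_inv, IsometryEquiv.mul_apply,
        IsometryEquiv.inv_apply_self])
  have hp := T.commute.zpow_left (-⌊s / a⌋)
  have hp' := T.commute.zpow_left (-⌊s' / a⌋)
  have := (hp'.inv_left.mul_left key).mul_left hp
  simpa [mul_assoc] using this

/-- An odd homeomorphism from `ℝ` to a small interval. -/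
noncomputable def squeeze (δ t : ℝ) : ℝ := δ / 2 * Real.arctan t

theorem abs_squeeze_lt {δ : ℝ} (hδ : 0 < δ) (t : ℝ) : |squeeze δ t| < δ := by
  rw [squeeze, abs_mul, abs_of_pos (half_pos hδ)]
  have h1 : |Real.arctan t| < 2 := by
    have h2 := Real.pi_le_four
    rw [abs_lt]
    constructor
    · linarith [Real.neg_pi_div_two_lt_arctan t]
    · linarith [Real.arctan_lt_pi_div_two t]
  nlinarith

theorem squeeze_injective {δ : ℝ} (hδ : 0 < δ) : Function.Injective (squeeze δ) := fun _ _ h =>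
  Real.arctan_injective (mul_left_cancel₀ (half_pos hδ).ne' h)

theorem squeeze_sgn (δ : ℝ) (σ : ℤˣ) (t : ℝ) : squeeze δ (sgn σ * t) = sgn σ * squeeze δ t := by
  rcases sgn_cases σ with h | h <;> rw [h] <;> simp [squeeze, Real.arctan_neg]

theorem continuous_squeeze (δ : ℝ) : Continuous (squeeze δ) :=
  continuous_const.mul Real.continuous_arctan

theorem isOpenMap_squeeze {δ : ℝ} (hδ : 0 < δ) : IsOpenMap (squeeze δ) :=
  isOpenMap_of_hasStrictDerivAt (fun t => (Real.hasStrictDerivAt_arctan t).const_mul (δ / 2))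
    fun t => by positivity

/-- The image of the axis of a reflection. -/
def curve (θ : Γ →* NSK.Z2) (c : Γ) : Set (NSK.KernelSurface θ) :=
  NSK.proj θ '' {z | (c : U ≃ᵢ U) z = z}

theorem mem_curve_iff (D : ReflectionData θ c N) {p : NSK.KernelSurface θ} :
    p ∈ curve θ c ↔ ∃ s, NSK.proj θ (N.coord (s, 0)) = p := by
  constructor
  · rintro ⟨z, hz, rfl⟩
    obtain ⟨s, rfl⟩ := N.exists_axis_eq (z := z) (by rw [D.refl]; exact hz)
    exact ⟨s, rfl⟩
  · rintro ⟨s, rfl⟩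
    exact ⟨_, by rw [Set.mem_ofPred_eq, D.c_coord, neg_zero], rfl⟩

/-- The reflection curve is the core of a band, in which the involution has no other fixed
points. -/
theorem exists_band (D : ReflectionData θ c N) (T : IsGenerator θ c N τ a σ)
    (hθ : Function.Surjective θ) : ∃ f : Band σ → NSK.KernelSurface θ,
      Topology.IsOpenEmbedding f ∧ f '' core σ = curve θ c ∧
      ∀ p ∈ Set.range f, NSK.involution θ hθ p = p → p ∈ curve θ c := by
  obtain ⟨δ, hδ, htube⟩ := D.exists_thin_tube T
  have ha := T.pos
  -- The factor `a` turns the shift of `τ` into the unit shift of the band, and `squeeze δ` puts all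
  -- heights into the thin tube. It is odd, hence compatible with the sign `σ`.
  let F : ℝ × ℝ → ℝ × ℝ := Prod.map (fun s => a * s) (squeeze δ)
  have hlt := abs_squeeze_lt hδ
  have hF : ∀ s t s' t' : ℝ, (∃ γ : Γ, θ γ = 1 ∧
      (γ : U ≃ᵢ U) (N.coord (F (s, t))) = N.coord (F (s', t'))) ↔
      ∃ n : ℤ, s' = s + n ∧ t' = sgn (σ ^ n) * t := by
    intro s t s' t'
    constructor
    · rintro ⟨γ, hγ, h⟩
      obtain ⟨n, rfl⟩ := T.generates γ hγ (htube γ _ _ _ _ (hlt t) (hlt t') h)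
      change ((τ ^ n : Γ) : U ≃ᵢ U) (N.coord (a * s, squeeze δ t)) =
        N.coord (a * s', squeeze δ t') at h
      rw [zpow_coord T.coord, N.coord.injective.eq_iff, Prod.mk.injEq, ← squeeze_sgn] at h
      refine ⟨n, ?_, (squeeze_injective hδ h.2).symm⟩
      apply mul_left_cancel₀ ha.ne'
      linarith [h.1]
    · rintro ⟨n, rfl, rfl⟩
      refine ⟨τ ^ n, by rw [map_zpow, T.ker, one_zpow], ?_⟩
      change ((τ ^ n : Γ) : U ≃ᵢ U) (N.coord (a * s, squeeze δ t)) =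
        N.coord (a * (s + n), squeeze δ (sgn (σ ^ n) * t))
      rw [zpow_coord T.coord, squeeze_sgn]
      congr 2; ring
  let f : Band σ → NSK.KernelSurface θ := Quotient.lift (fun p => NSK.proj θ (N.coord (F p))) (by
    rintro ⟨s, t⟩ ⟨s', t'⟩ h
    exact NSK.proj_eq_iff.2 ((hF s t s' t').2 (band_eq_iff.1 (Quotient.sound h))))
  have hfmk : ∀ p, f (Quotient.mk _ p) = NSK.proj θ (N.coord (F p)) := fun p => rfl
  have hFc : Continuous F := (continuous_const.mul continuous_id).prodMap (continuous_squeeze δ)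
  have hFo : IsOpenMap F := (Homeomorph.mulLeft₀ a ha.ne').isOpenMap.prodMap (isOpenMap_squeeze hδ)
  have hcont : Continuous f :=
    Continuous.quotient_lift (NSK.continuous_proj.comp (N.coord.continuous.comp hFc)) _
  have hinj : Function.Injective f := by
    intro p q h
    induction p using Quotient.inductionOn with
    | _ p =>
    induction q using Quotient.inductionOn with
    | _ q =>
    rw [hfmk, hfmk, NSK.proj_eq_iff] at h
    exact band_eq_iff.2 ((hF _ _ _ _).1 h)
  have hopen : IsOpenMap f := by
    intro O hO
    have h1 : f '' O = NSK.proj θ '' (N.coord '' (F '' (Quotient.mk (bandSetoid σ) ⁻¹' O))) := by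
      ext p
      constructor
      · rintro ⟨q, hq, rfl⟩
        induction q using Quotient.inductionOn with
        | _ q => exact ⟨_, ⟨_, ⟨q, hq, rfl⟩, rfl⟩, rfl⟩
      · rintro ⟨_, ⟨_, ⟨q, hq, rfl⟩, rfl⟩, rfl⟩
        exact ⟨_, hq, rfl⟩
    rw [h1]
    exact NSK.isOpenMap_proj _ (N.coord.isOpenMap _ (hFo _ (hO.preimage (continuous_bandMk σ))))
  have hF0 : ∀ s, F (s, 0) = (a * s, 0) := fun s => by simp [F, squeeze]
  have hcore : ∀ s, f (Quotient.mk _ (s, 0)) ∈ curve θ c := fun s =>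
    D.mem_curve_iff.2 ⟨a * s, by rw [hfmk, hF0]⟩
  refine ⟨f, .of_continuous_injective_isOpenMap hcont hinj hopen, ?_, ?_⟩
  · ext p
    constructor
    · rintro ⟨_, ⟨s, rfl⟩, rfl⟩
      exact hcore s
    · intro hp
      obtain ⟨s, rfl⟩ := D.mem_curve_iff.1 hp
      refine ⟨_, ⟨s / a, rfl⟩, ?_⟩
      rw [hfmk, hF0, mul_div_cancel₀ _ ha.ne']
  · rintro _ ⟨q, rfl⟩ hfix
    induction q using Quotient.inductionOn with
    | _ q =>
    obtain ⟨s, t⟩ := q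
    have h1 : (c : U ≃ᵢ U) (N.coord (F (s, t))) = N.coord (F (s, -t)) := by
      change (c : U ≃ᵢ U) (N.coord (a * s, squeeze δ t)) = N.coord (a * s, squeeze δ (-t))
      rw [D.c_coord]
      congr 2
      simp [squeeze]
    rw [hfmk, NSK.involution_proj θ hθ c D.map_c, h1, NSK.proj_eq_iff, hF] at hfix
    obtain ⟨n, h2, h3⟩ := hfix
    have hn : n = 0 := by exact_mod_cast (left_eq_add.1 h2 : (n : ℝ) = 0)
    rw [hn, zpow_zero] at h3
    have : t = 0 := by
      have : sgn 1 = 1 := by simp [sgn]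
      rw [this] at h3
      linarith
    rw [this]
    exact hcore s

end ReflectionData

/-! ### The reflection curves of the involution -/

/-- The canonical generators of a discrete group, and a homomorphism to `ℤ₂` with torsion-free
kernel. -/
structure CanonicalData {U : Type*} [MetricSpace U] {Γ : Subgroup (U ≃ᵢ U)} {h r k : ℕ}
    {ε : NEC.Sign} (gen : NEC.CanonicalGen h r (k + 1) ε → Γ) (θ : Γ →* NSK.Z2) : Prop where
  discrete : PlaneIsometry.IsDiscreteSubgroup Γ
  system : NEC.IsCanonicalSystem Γ gen
  torsion : ∀ y, θ y = 1 → ∀ n : ℕ, n ≠ 0 → y ^ n = 1 → y = 1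

namespace NSK

theorem z2_eq_X_of_ne_one {u : Z2} (hu : u ≠ 1) : u = X := by
  revert u; decide

theorem z2_mul_self (u : Z2) : u * u = 1 := by
  revert u; decide

end NSK

namespace CanonicalData

open NEC CanonicalGen PlaneIsometry SurfaceCurve ReflectionData

variable {U : Type*} [MetricSpace U] {Γ : Subgroup (U ≃ᵢ U)} {h r k : ℕ} {ε : Sign}
  {gen : CanonicalGen h r (k + 1) ε → Γ} {θ : Γ →* NSK.Z2}

theorem presentation (D : CanonicalData gen θ) : IsPresentation gen :=
  ⟨D.system.generates, D.system.relations⟩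

theorem e_pow_ne_one (hgen : NEC.IsCanonicalSystem Γ gen) (i : Fin (k + 1)) {n : ℕ} (hn : n ≠ 0) :
    gen (e i) ^ n ≠ 1 := fun h1 => by
  have h2 : IsTranslation (gen (e i) : U ≃ᵢ U) := hgen.types (e i)
  exact FermiPlane.pow_ne_one_of_shiftsLine h2.2 hn (by rw [← Subgroup.coe_pow, h1]; rfl)

/-- Discreteness makes an element with a fixed point torsion, and the kernel is torsion-free. -/
theorem free (D : CanonicalData gen θ) (M : FermiPlane U) (γ : Γ) (z : U) (hγ : θ γ = 1)
    (hz : (γ : U ≃ᵢ U) z = z) : γ = 1 := by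
  have := M.proper
  obtain ⟨n, hn, h1⟩ := D.discrete.exists_pow_eq_one hz
  exact D.torsion γ hγ n hn h1

theorem c_ne_one (D : CanonicalData gen θ) (M : FermiPlane U) (i : Fin (k + 1)) :
    gen (c i) ≠ 1 := by
  intro h1
  obtain ⟨N, hN⟩ := M.exists_refl_eq (c := (gen (c i) : U ≃ᵢ U)) (D.system.types (c i))
  apply N.refl_not_mem
  rw [hN, h1]
  exact one_mem _

theorem map_c (D : CanonicalData gen θ) (M : FermiPlane U) (i : Fin (k + 1)) :
    θ (gen (c i)) = NSK.X :=
  NSK.z2_eq_X_of_ne_one fun h1 => D.c_ne_one M i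
    (D.torsion _ h1 2 two_ne_zero (by rw [pow_two, D.presentation.c_mul_self]))

theorem exists_reflectionData (D : CanonicalData gen θ) (M : FermiPlane U) (i : Fin (k + 1)) :
    ∃ N, ReflectionData θ (gen (c i)) N := by
  obtain ⟨N, hN⟩ := M.exists_refl_eq (c := (gen (c i) : U ≃ᵢ U)) (D.system.types (c i))
  exact ⟨N, D.discrete, D.free M, hN, D.map_c M i⟩

/-- The generator of the stabilizer of the axis of `c i` in the kernel preserves the sides of the
axis if and only if `e i` is in the kernel. -/
theorem exists_isGenerator (D : CanonicalData gen θ) {i : Fin (k + 1)} {N : FermiPlane U}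
    (R : ReflectionData θ (gen (c i)) N) : ∃ τ a σ, IsGenerator θ (gen (c i)) N τ a σ ∧
      (θ (gen (e i)) = NSK.X → σ = -1) ∧ (θ (gen (e i)) ≠ NSK.X → σ = 1) := by
  have hP := D.presentation
  have hec : Commute (gen (e i)) (gen (c i)) := (hP.commute_c_e i).symm
  have htr : IsTranslation (gen (e i) : U ≃ᵢ U) := D.system.types (e i)
  obtain ⟨b, -, hb⟩ := N.eq_trans_of_isTranslation htr (R.coe_commute hec)
  by_cases he : θ (gen (e i)) = NSK.X
  · have hker : θ (gen (e i) * gen (c i)) = 1 := by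
      rw [map_mul, he, R.map_c]; exact NSK.z2_mul_self _
    have hcomm : Commute (gen (e i) * gen (c i)) (gen (c i)) := hec.mul_left (Commute.refl _)
    obtain ⟨τ, a, σ, T⟩ := R.exists_generator hker hcomm fun h1 => by
      have h2 : gen (e i) = gen (c i) := by
        rw [eq_inv_of_mul_eq_one_left h1, inv_eq_of_mul_eq_one_left (hP.c_mul_self i)]
      exact e_pow_ne_one D.system i two_ne_zero (by rw [h2, pow_two, hP.c_mul_self])
    refine ⟨τ, a, σ, T, fun _ => ?_, fun h1 => absurd he h1⟩
    -- The kernel element `e i * c i` exchanges the sides of the axis, which no power of a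
    -- side-preserving `τ` does.
    rcases Int.units_eq_one_or σ with rfl | rfl
    · exfalso
      obtain ⟨n, hn⟩ := T.generates _ hker hcomm
      have h1 := zpow_coord T.coord n 0 1
      rw [← hn, Subgroup.coe_mul, IsometryEquiv.mul_apply, R.c_coord, hb, N.trans_coord,
        N.coord.injective.eq_iff, Prod.mk.injEq] at h1
      have h2 := h1.2
      simp [sgn] at h2
      norm_num at h2
    · rfl
  · have hker : θ (gen (e i)) = 1 := by
      by_contra h1
      exact he (NSK.z2_eq_X_of_ne_one h1)
    obtain ⟨τ, a, σ, T⟩ := R.exists_generator hker hec fun h1 =>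
      e_pow_ne_one D.system i one_ne_zero (by rw [h1, one_pow])
    refine ⟨τ, a, σ, T, fun h1 => absurd h1 he, fun _ => ?_⟩
    rcases Int.units_eq_one_or σ with rfl | rfl
    · rfl
    · exfalso
      obtain ⟨n, hn⟩ := T.generates _ hker hec
      have h1 := zpow_coord T.coord n 0 1
      rw [← hn, hb, N.trans_coord, N.coord.injective.eq_iff, Prod.mk.injEq, mul_one] at h1
      -- Suppose `τ` exchanges the sides and `e i = τ ^ n`. For even `n`, `e i` is a square in the
      -- centralizer of `c i`; for odd `n`, the translation `e i` exchanges the sides. Both are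
      -- impossible.
      obtain ⟨m, rfl | rfl⟩ := Int.even_or_odd' n
      · refine hP.mul_self_ne_e i ?_ (T.commute.zpow_left m) ?_
        · exact fun h1 => e_pow_ne_one D.system i one_ne_zero (by rw [h1, one_pow])
        · rw [hn, ← zpow_add, two_mul]
      · have h2 : ((-1 : ℤˣ) ^ (2 * m + 1)) = -1 := by
          rw [zpow_add, zpow_mul]; simp
        have h3 := h1.2
        rw [h2] at h3
        simp [sgn] at h3
        norm_num at h3

/-- The local structure of the surface near the image of the axis of `c i`. -/
theorem curve_spec (D : CanonicalData gen θ) (M : FermiPlane U) (hθ : Function.Surjective θ)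
    (i : Fin (k + 1)) : IsReflectionCurve (NSK.involution θ hθ) (curve θ (gen (c i))) ∧
      (θ (gen (e i)) = NSK.X → IsOneSided (curve θ (gen (c i)))) ∧
      (θ (gen (e i)) ≠ NSK.X → IsTwoSided (curve θ (gen (c i)))) ∧
      ∃ V, IsOpen V ∧ curve θ (gen (c i)) ⊆ V ∧
        ∀ p ∈ V, NSK.involution θ hθ p = p → p ∈ curve θ (gen (c i)) := by
  obtain ⟨N, R⟩ := D.exists_reflectionData M i
  obtain ⟨τ, a, σ, T, hX, h1⟩ := D.exists_isGenerator R
  obtain ⟨f, hf, hcore, hfix⟩ := R.exists_band T hθ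
  refine ⟨⟨?_, ?_⟩, ?_, ?_, Set.range f, hf.isOpen_range, ?_, hfix⟩
  · rw [← hcore]
    exact isSimpleClosedCurve_image_core hf.continuous hf.injective
  · rintro _ ⟨z, hz, rfl⟩
    rw [NSK.involution_proj θ hθ _ (D.map_c M i), hz]
  · intro he
    obtain rfl := hX he
    exact ⟨f, hf, hcore⟩
  · intro he
    obtain rfl := h1 he
    exact ⟨f, hf, hcore⟩
  · rw [← hcore]
    exact Set.image_subset_range _ _

/-- If two curves shared a point, a kernel element would take a point of one axis to the other axis.
The two reflections, one of them conjugated, would fix that point and agree by freeness,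
contradicting `not_isConj_c`. -/
theorem curve_injective (D : CanonicalData gen θ) (M : FermiPlane U) :
    Function.Injective fun i => curve θ (gen (c i)) := by
  intro i j hij
  by_contra hne
  obtain ⟨N, R⟩ := D.exists_reflectionData M i
  have h1 : NSK.proj θ (N.coord (0, 0)) ∈ curve θ (gen (c i)) := R.mem_curve_iff.2 ⟨0, rfl⟩
  have hfix : (gen (c i) : U ≃ᵢ U) (N.coord (0, 0)) = N.coord (0, 0) := by rw [R.c_coord, neg_zero]
  change curve θ (gen (c i)) = curve θ (gen (c j)) at hij
  rw [hij] at h1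
  obtain ⟨w, hw, h2⟩ := h1
  obtain ⟨γ, hγ, rfl⟩ := NSK.proj_eq_iff.1 h2.symm
  refine D.presentation.not_isConj_c hne (isConj_iff.2 ⟨γ, ?_⟩)
  obtain ⟨N', R'⟩ := D.exists_reflectionData M j
  refine R'.eq_of_common_fixed ?_ ?_ hw
  · rw [map_mul, map_mul, map_inv, hγ, inv_one, mul_one, one_mul, D.map_c M, D.map_c M]
  · simp only [Subgroup.coe_mul, Subgroup.coe_inv, IsometryEquiv.mul_apply,
      IsometryEquiv.inv_apply_self]
    rw [hfix]

/-- The images of the axes of conjugate reflections coincide. -/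
theorem proj_mem_curve (D : CanonicalData gen θ) (M : FermiPlane U) {i : Fin (k + 1)} {γ : Γ}
    (hγ : IsConj (gen (c i)) γ) {z : U} (hz : (γ : U ≃ᵢ U) z = z) :
    NSK.proj θ z ∈ curve θ (gen (c i)) := by
  obtain ⟨δ, rfl⟩ := isConj_iff.1 hγ
  have hfix : (gen (c i) : U ≃ᵢ U) ((δ : U ≃ᵢ U)⁻¹ z) = (δ : U ≃ᵢ U)⁻¹ z := by
    apply (δ : U ≃ᵢ U).injective
    rw [IsometryEquiv.apply_inv_self]
    exact hz
  refine ⟨_, hfix, ?_⟩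
  rw [NSK.proj_eq_iff]
  by_cases h1 : θ δ = 1
  · exact ⟨δ, h1, IsometryEquiv.apply_inv_self _ _⟩
  -- The reflection fixes the point, so it can be inserted to correct the value of `θ`.
  · refine ⟨δ * gen (c i), ?_, ?_⟩
    · rw [map_mul, NSK.z2_eq_X_of_ne_one h1, D.map_c M]; exact NSK.z2_mul_self _
    · rw [Subgroup.coe_mul, IsometryEquiv.mul_apply, hfix, IsometryEquiv.apply_inv_self]

/-- The fixed points of the involution lie on the images of the axes of the reflections, up to
finitely many exceptions. -/
theorem fixed_points (D : CanonicalData gen θ) (M : FermiPlane U) (hθ : Function.Surjective θ) :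
    ∃ E : Set (NSK.KernelSurface θ), E.Finite ∧ ∀ p, NSK.involution θ hθ p = p →
      p ∈ E ∨ ∃ i, p ∈ curve θ (gen (c i)) := by
  have hrot : ∀ j, ∃ z₀ : U, {z | (gen (x j) : U ≃ᵢ U) z = z} = {z₀} := fun j =>
    (show IsRotation (gen (x j) : U ≃ᵢ U) from D.system.types (x j)).2
  choose z₀ hz₀ using hrot
  obtain ⟨γ₀, hγ₀⟩ := hθ NSK.X
  -- The kernel has index two, so a `Γ`-orbit consists of at most two kernel orbits, here those of
  -- `z₀ j` and `γ₀ (z₀ j)`.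
  refine ⟨(Set.range fun j => NSK.proj θ (z₀ j)) ∪
    Set.range fun j => NSK.proj θ ((γ₀ : U ≃ᵢ U) (z₀ j)),
    (Set.finite_range _).union (Set.finite_range _), fun p hp => ?_⟩
  induction p using Quotient.inductionOn with
  | _ z =>
  change NSK.involution θ hθ (NSK.proj θ z) = NSK.proj θ z at hp
  rw [NSK.involution_proj θ hθ γ₀ hγ₀, NSK.proj_eq_iff] at hp
  obtain ⟨δ, hδ, hfix⟩ := hp
  have hmap : θ (δ * γ₀) = NSK.X := by rw [map_mul, hδ, hγ₀, one_mul]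
  change ((δ * γ₀ : Γ) : U ≃ᵢ U) z = z at hfix
  generalize δ * γ₀ = γ at hmap hfix
  have hsq : γ * γ = 1 := by
    apply D.free M _ z
    · rw [map_mul]; exact NSK.z2_mul_self _
    · rw [Subgroup.coe_mul, IsometryEquiv.mul_apply, hfix, hfix]
  have hne : γ ≠ 1 := by
    rintro rfl
    rw [map_one] at hmap
    exact absurd hmap (by decide)
  rcases D.presentation.involution_isConj θ
    (fun y hy hyy => D.torsion y hy 2 two_ne_zero (by rw [pow_two, hyy])) hsq hne with
    ⟨i, hi⟩ | ⟨j, hj⟩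
  · exact Or.inr ⟨i, D.proj_mem_curve M hi hfix⟩
  · left
    obtain ⟨α, rfl⟩ := isConj_iff.1 hj
    have h1 : (gen (x j) : U ≃ᵢ U) ((α : U ≃ᵢ U)⁻¹ z) = (α : U ≃ᵢ U)⁻¹ z := by
      apply (α : U ≃ᵢ U).injective
      rw [IsometryEquiv.apply_inv_self]
      exact hfix
    have h2 : (α : U ≃ᵢ U)⁻¹ z = z₀ j := by
      have : (α : U ≃ᵢ U)⁻¹ z ∈ {z | (gen (x j) : U ≃ᵢ U) z = z} := h1
      rwa [hz₀] at this
    have h3 : z = (α : U ≃ᵢ U) (z₀ j) := by rw [← h2, IsometryEquiv.apply_inv_self]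
    by_cases hα : θ α = 1
    · exact Or.inl ⟨j, NSK.proj_eq_iff.2 ⟨α, hα, h3.symm⟩⟩
    · refine Or.inr ⟨j, NSK.proj_eq_iff.2 ⟨α * γ₀⁻¹, ?_, ?_⟩⟩
      · rw [map_mul, map_inv, hγ₀, NSK.z2_eq_X_of_ne_one hα, mul_inv_cancel]
      · rw [Subgroup.coe_mul, IsometryEquiv.mul_apply, Subgroup.coe_inv,
          IsometryEquiv.inv_apply_self, h3]

/-- Every reflection curve is the image of the axis of a canonical reflection. -/
theorem exists_eq_curve (D : CanonicalData gen θ) (M : FermiPlane U) (hθ : Function.Surjective θ)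
    {C : Set (NSK.KernelSurface θ)} (hC : IsReflectionCurve (NSK.involution θ hθ) C) :
    ∃ i, curve θ (gen (c i)) = C := by
  have := M.proper
  have := NSK.t2Space_kernelSurface (θ := θ) D.discrete
  obtain ⟨E, hE, hfixed⟩ := D.fixed_points M hθ
  -- An infinite curve cannot consist of isolated centres of rotations only, so it meets the image
  -- of an axis.
  obtain ⟨p, hpC, hpE⟩ := hC.1.infinite.exists_notMem_finite hE
  obtain ⟨i, hi⟩ := (hfixed p (hC.2 p hpC)).resolve_left hpE
  obtain ⟨hR, -, -, V, hV, hcV, hVfix⟩ := D.curve_spec M hθ i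
  have hsub : C ⊆ curve θ (gen (c i)) := by
    intro q hqC
    by_contra hq
    -- Within the fixed points the image of the axis is both closed and, by the neighbourhood `V`,
    -- open, so the connected curve cannot leave it.
    obtain ⟨y, hyC, hyV, hy⟩ := hC.1.isPreconnected V _ hV hR.1.isCompact.isClosed.isOpen_compl
      (fun y _ => (em (y ∈ curve θ (gen (c i)))).imp (fun h1 => hcV h1) id) ⟨p, hpC, hcV hi⟩
      ⟨q, hqC, hq⟩
    exact hy (hVfix y hyV (hC.2 y hyC))
  exact ⟨i, (hC.1.eq_of_subset hR.1 hsub).symm⟩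

end CanonicalData

/-! ### The count of reflection curves. -/

theorem mainTheorem6 {U : Type*} [MetricSpace U]
    (hU : Nonempty (U ≃ᵢ ℍ) ∨ Nonempty (U ≃ᵢ EuclideanSpace ℝ (Fin 2)))
    (g h r k : ℕ) (ε : NEC.Sign) (hg : 1 ≤ g) (hk : 1 ≤ k)
    (Γ : Subgroup (U ≃ᵢ U)) (hΓ : PlaneIsometry.IsDiscreteSubgroup Γ)
    (gen : NEC.CanonicalGen h r k ε → Γ) (hgen : NEC.IsCanonicalSystem Γ gen)
    (θ : Γ →* NSK.Z2) (hθ : NSK.IsNSKMap g θ)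
    (n : ℕ) (hn : n = Nat.card {j : Fin k // θ (gen (.e j)) = NSK.X}) :
    {C | SurfaceCurve.IsReflectionCurve (NSK.involution θ hθ.surjective) C}.encard = k ∧
    {C | SurfaceCurve.IsReflectionCurve (NSK.involution θ hθ.surjective) C ∧
      SurfaceCurve.IsOneSided C}.encard = n ∧
    {C | SurfaceCurve.IsReflectionCurve (NSK.involution θ hθ.surjective) C ∧
      SurfaceCurve.IsTwoSided C}.encard = (k - n : ℕ) ∧
    ∀ C, SurfaceCurve.IsReflectionCurve (NSK.involution θ hθ.surjective) C →
      (SurfaceCurve.IsTwoSided C ↔ ¬ SurfaceCurve.IsOneSided C) := by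
  obtain ⟨M⟩ := FermiPlane.nonempty_of_isometryEquiv hU
  obtain ⟨k, rfl⟩ : ∃ k', k = k' + 1 := ⟨k - 1, by omega⟩
  obtain ⟨φ⟩ := hθ.ker_iso
  have D : CanonicalData gen θ := by
    refine ⟨hΓ, hgen, fun y hy m hm hym => ?_⟩
    rcases NSK.surfaceGroup_torsion hg with H | H
    -- This is the projective plane, `g = 1`: the square of the translation `e 0` lies in a kernel
    -- of exponent two, so its fourth power would be trivial.
    · exfalso
      have hker : gen (.e 0) ^ 2 ∈ θ.ker := by
        rw [MonoidHom.mem_ker, map_pow, pow_two]; exact NSK.z2_mul_self _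
      have h1 : (⟨_, hker⟩ : θ.ker) ^ 2 = 1 := by
        apply φ.injective
        rw [map_pow, H, map_one]
      have h2 := congrArg Subtype.val h1
      refine CanonicalData.e_pow_ne_one hgen 0 four_ne_zero ?_
      rw [show 4 = 2 * 2 from rfl, pow_mul]
      exact h2
    · have h1 : (⟨y, hy⟩ : θ.ker) = 1 := by
        apply φ.injective
        rw [map_one]
        apply H _ m hm
        rw [← map_pow, ← map_one φ]
        congr 1
        exact Subtype.ext hym
      exact congrArg Subtype.val h1
  have hinj := D.curve_injective M
  have hspec := D.curve_spec M hθ.surjective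
  set K : Fin (k + 1) → Set (NSK.KernelSurface θ) := fun i =>
    ReflectionData.curve θ (gen (.c i)) with hK
  have hall : ∀ C, SurfaceCurve.IsReflectionCurve (NSK.involution θ hθ.surjective) C ↔
      ∃ i, K i = C := fun C => ⟨D.exists_eq_curve M hθ.surjective, by
    rintro ⟨i, rfl⟩; exact (hspec i).1⟩
  have hone : ∀ i, SurfaceCurve.IsOneSided (K i) ↔ θ (gen (.e i)) = NSK.X := by
    intro i
    refine ⟨fun h1 => ?_, (hspec i).2.1⟩
    by_contra h2
    exact ((hspec i).2.2.1 h2).not_isOneSided h1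
  have htwo : ∀ i, SurfaceCurve.IsTwoSided (K i) ↔ ¬ SurfaceCurve.IsOneSided (K i) :=
    fun i => ⟨fun h1 => h1.not_isOneSided, fun h1 => (hspec i).2.2.1 (by rwa [hone] at h1)⟩
  have himage : ∀ P : Set (NSK.KernelSurface θ) → Prop,
      {C | SurfaceCurve.IsReflectionCurve (NSK.involution θ hθ.surjective) C ∧ P C} =
        K '' {i | P (K i)} := by
    intro P
    ext C
    simp only [Set.mem_ofPred_eq, hall, Set.mem_image]
    constructor
    · rintro ⟨⟨i, rfl⟩, hP⟩; exact ⟨i, hP, rfl⟩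
    · rintro ⟨i, hP, rfl⟩; exact ⟨⟨i, rfl⟩, hP⟩
  have hnS : {i | SurfaceCurve.IsOneSided (K i)}.encard = n := by
    simp only [hone]
    rw [hn]
    exact (Set.coe_ncard_eq_encard _).symm
  refine ⟨?_, ?_, ?_, ?_⟩
  · have := himage fun _ => True
    simp only [and_true] at this
    rw [this, hinj.encard_image]
    simp
  · rw [himage, hinj.encard_image, hnS]
  · rw [himage, hinj.encard_image]
    simp only [htwo]
    have hcompl := Set.ncard_add_ncard_compl {i | SurfaceCurve.IsOneSided (K i)}
    rw [Set.ncard_def, hnS, Nat.card_fin, ENat.toNat_natCast] at hcompl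
    rw [← Nat.eq_sub_of_add_eq' hcompl]
    exact (Set.coe_ncard_eq_encard _).symm
  · intro C hC
    obtain ⟨i, rfl⟩ := (hall C).1 hC
    exact htwo i
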